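/- **Theorem 5.1.** Let $\|\cdot\|$ be the operator norm on the $n\times n$ complex matrices, $\mathrm{cond}(A)=\|A\|\,\|A^{-1}\|$, and let $|||\cdot|||$ be a unitarily invariant norm. For positive definite $A,B$ put $A\#B=A^{1/2}(A^{-1/2}BA^{-1/2})^{1/2}A^{1/2}$, and let $(A^{-1}B)^{1/2}$ be the square root of $A^{-1}B$ with positive eigenvalues. For invertible $Z$ let $$k(Z)=\Big(\int_0^\infty\big\|e^{-t((Z^*Z)^{-1}\overline{Z^*Z})^{1/2}}\big\|^2dt\Big)\,\mathrm{cond}(Z)\,\big(1+\mathrm{cond}(Z)^4\big),$$ and for unitary $W$ with $-1\notin\sigma(W)$ let $C(W)=\int_0^1\|(t(W-I)+I)^{-1}\|^2dt$. Let $Z$ be invertible with $-1\notin\sigma\big(Z'Z\,((Z^*Z)^{-1}\#(\overline{Z^*Z})^{-1})\big)$, where $Z'$ is the transpose. Then $Z$ has a bipolar decomposition $$Z=W_1e^{iT}e^{iK}e^{S},$$ where $W_1$ is real orthogonal, $T$ and $S$ are real symmetric, $K$ is real skew symmetric, and the eigenvalues of $T$ lie in $(-\pi/2,\pi/2)$.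 If $-1\notin\sigma(W_1)$, then moreover $W_1=e^L$ with a real skew symmetric $L$ (the principal logarithm of $W_1$) whose eigenvalues lie in $i(-\pi,\pi)$, so that $Z=e^Le^{iT}e^{iK}e^S$. For a factor $F$ of $Z$ ($F=L,T,K$ or $S$) write $|||\tilde F-F|||\lesssim c\,|||\tilde Z-Z|||$ if there are $\delta>0$ and $M$ such that for every $\tilde Z$ with $|||\tilde Z-Z|||<\delta$ a corresponding factor $\tilde F$ of such a decomposition of $\tilde Z$ exists, and every such $\tilde F$ satisfies $|||\tilde F-F|||\le c\,|||\tilde Z-Z|||+M\,|||\tilde Z-Z|||^2$. Let $\sigma(e^{iT})=\{e^{i\theta_1},\dots,e^{i\theta_n}\}$, and let $(a_m)_{m\in\mathbb Z}$ be any $\ell_1$-sequence of complex numbers with $\sum_{m}(-1)^ma_me^{im\theta}=\frac1{1+e^{i\theta}}$ for all $\theta=\theta_i-\theta_j$, $1\le i,j\le n$. Then $$|||\tilde L-L|||\lesssim 2\,C(e^L)\Big(\sum_m|a_m|\Big)\frac{\|e^{-iK}\|\,\|e^{-S}\|}{2}\big(1+\|e^{iK}\|\,k(Z)\big)\,|||\tilde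 Z-Z|||\qquad\text{if }-1\notin\sigma(W_1),$$ $$|||\tilde T-T|||\lesssim 2\,C(e^{iT})\Big(\sum_m|a_m|\Big)\frac{\|e^{-iK}\|\,\|e^{-S}\|}{2}\big(1+\|e^{iK}\|\,k(Z)\big)\,|||\tilde Z-Z|||,$$ and, if the norm is normalised so that $|||A|||\ge\|A\|$ for all $A$ (as it is when $|||\mathrm{diag}(1,0,\dots,0)|||=1$), $$|||\tilde K-K|||\lesssim |||e^{-iK}|||\,\frac{\mathrm{cond}(e^{iK})\,\|e^{-S}\|}{2}\big(1+\|e^{iK}\|\,k(Z)\big)\,|||\tilde Z-Z|||,$$ $$|||\tilde S-S|||\lesssim |||e^{-S}|||\,k(Z)\,|||\tilde Z-Z|||.$$ -/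

import Mathlib

open scoped Matrix

noncomputable section

namespace Bipolar

variable {n : ℕ}

/-- A real matrix regarded as a complex matrix. -/
def toC (A : Matrix (Fin n) (Fin n) ℝ) : Matrix (Fin n) (Fin n) ℂ :=
  A.map Complex.ofReal

/-- The entrywise complex conjugate of a matrix. -/
def conj (A : Matrix (Fin n) (Fin n) ℂ) : Matrix (Fin n) (Fin n) ℂ :=
  A.map (starRingEnd ℂ)

/-- The operator (spectral) norm, with respect to the Euclidean norm on `ℂⁿ`. -/
def opNorm (A : Matrix (Fin n) (Fin n) ℂ) : ℝ :=
  ‖Matrix.toEuclideanCLM (n := Fin n) (𝕜 := ℂ) A‖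

/-- The condition number `‖A‖ ‖A⁻¹‖` (for invertible `A`). -/
def cond (A : Matrix (Fin n) (Fin n) ℂ) : ℝ :=
  opNorm A * opNorm A⁻¹

/-- A norm on the complex matrices (a definite seminorm) with `|||U A V||| = |||A|||` for all
unitary `U`, `V`. -/
structure IsUnitarilyInvariantNorm (N : Seminorm ℂ (Matrix (Fin n) (Fin n) ℂ)) : Prop where
  definite : ∀ A, N A = 0 → A = 0
  invariant : ∀ U ∈ Matrix.unitaryGroup (Fin n) ℂ, ∀ V ∈ Matrix.unitaryGroup (Fin n) ℂ,
    ∀ A, N (U * A * V) = N A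

/-- The positive square root of a positive (semi)definite matrix. -/
def psdSqrt (A : Matrix (Fin n) (Fin n) ℂ) : Matrix (Fin n) (Fin n) ℂ :=
  cfc Real.sqrt A

/-- The geometric mean `A # B = A^{1/2} (A^{-1/2} B A^{-1/2})^{1/2} A^{1/2}` of two positive
definite matrices. -/
def geomMean (A B : Matrix (Fin n) (Fin n) ℂ) : Matrix (Fin n) (Fin n) ℂ :=
  psdSqrt A * psdSqrt ((psdSqrt A)⁻¹ * B * (psdSqrt A)⁻¹) * psdSqrt A

/-- `X` is a square root of `M` all of whose eigenvalues are positive real numbers. -/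
structure IsPositiveSqrt (X M : Matrix (Fin n) (Fin n) ℂ) : Prop where
  mul_self : X * X = M
  pos : ∀ μ ∈ spectrum ℂ X, 0 < μ.re ∧ μ.im = 0

open Classical in
/-- The square root with positive eigenvalues; it exists and is unique for a product `A⁻¹ B` of
positive definite matrices, which is in general not Hermitian. -/
def positiveSqrt (M : Matrix (Fin n) (Fin n) ℂ) : Matrix (Fin n) (Fin n) ℂ :=
  if h : ∃ X, IsPositiveSqrt X M then h.choose else 0

/-- `β(Z) = ∫₀^∞ ‖exp (-t ((Z*Z)⁻¹ conj(Z*Z))^{1/2})‖² dt`. -/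
def beta (Z : Matrix (Fin n) (Fin n) ℂ) : ℝ :=
  ∫ t in Set.Ioi (0 : ℝ),
    opNorm (NormedSpace.exp (-(t • positiveSqrt ((Zᴴ * Z)⁻¹ * conj (Zᴴ * Z))))) ^ 2

/-- `k(Z) = β(Z) cond(Z) (1 + cond(Z)⁴)`. -/
def kappa (Z : Matrix (Fin n) (Fin n) ℂ) : ℝ :=
  beta Z * cond Z * (1 + cond Z ^ 4)

/-- `C(W) = ∫₀¹ ‖(t (W - I) + I)⁻¹‖² dt`, used for unitary `W` without eigenvalue `-1`, where the
integrand is continuous. -/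
def logConst (W : Matrix (Fin n) (Fin n) ℂ) : ℝ :=
  ∫ t in (0 : ℝ)..1, opNorm ((t • (W - 1) + 1)⁻¹) ^ 2

/-- The unitary matrix `e^{iT}` (or the positive matrix `e^{iK}`) of a real matrix. -/
def expI (A : Matrix (Fin n) (Fin n) ℝ) : Matrix (Fin n) (Fin n) ℂ :=
  NormedSpace.exp (Complex.I • toC A)

/-- The bipolar decomposition `Z = W₁ e^{iT} e^{iK} e^S`: `e^{iK} e^S` is the positive part of
Mostow's decomposition, the unitary part is `W₁ W₂` with `W₁` real orthogonal and `W₂ = e^{iT}`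
symmetric unitary with eigenvalues in the open right half plane, and `iT` is the principal
logarithm of `W₂`, so that the eigenvalues of `T` lie in `(-π/2, π/2)`. -/
structure IsBipolar (Z : Matrix (Fin n) (Fin n) ℂ) (W₁ T K S : Matrix (Fin n) (Fin n) ℝ) :
    Prop where
  orthogonal : W₁ ∈ Matrix.orthogonalGroup (Fin n) ℝ
  symm_T : Tᵀ = T
  spec_T : spectrum ℝ T ⊆ Set.Ioo (-(Real.pi / 2)) (Real.pi / 2)
  skew_K : Kᵀ = -K
  symm_S : Sᵀ = S
  eq : Z = toC W₁ * expI T * expI K * NormedSpace.exp (toC S)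

/-- `L` is the principal logarithm of the real orthogonal matrix `W₁`: a real skew symmetric matrix
with `e^L = W₁` and eigenvalues in `i(-π, π)`. -/
structure IsPrincipalLog (L W₁ : Matrix (Fin n) (Fin n) ℝ) : Prop where
  skew : Lᵀ = -L
  spec : ∀ μ ∈ spectrum ℂ (toC L), |μ.im| < Real.pi
  exp_eq : NormedSpace.exp L = W₁

/-- `|||F̃ - F||| ≲ c |||Z̃ - Z|||`: for all `Z̃` near `Z`, a factor `F̃` of `Z̃` (in the sense of the
relation `R`) exists, and every such factor satisfies
`|||F̃ - F||| ≤ c |||Z̃ - Z||| + M |||Z̃ - Z|||²`, where `M` does not depend on `Z̃`. -/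
def FirstOrderBound (N : Seminorm ℂ (Matrix (Fin n) (Fin n) ℂ))
    (R : Matrix (Fin n) (Fin n) ℂ → Matrix (Fin n) (Fin n) ℝ → Prop)
    (Z : Matrix (Fin n) (Fin n) ℂ) (F : Matrix (Fin n) (Fin n) ℝ) (c : ℝ) : Prop :=
  ∃ δ > 0, ∃ M : ℝ, ∀ Z' : Matrix (Fin n) (Fin n) ℂ, N (Z' - Z) < δ →
    (∃ F', R Z' F') ∧
    ∀ F', R Z' F' → N (toC F' - toC F) ≤ c * N (Z' - Z) + M * N (Z' - Z) ^ 2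

/-- The constant `(‖e^{-iK}‖ ‖e^{-S}‖ / 2) (1 + ‖e^{iK}‖ k(Z))`. -/
def unitaryConst (Z : Matrix (Fin n) (Fin n) ℂ) (K S : Matrix (Fin n) (Fin n) ℝ) : ℝ :=
  opNorm (expI (-K)) * opNorm (NormedSpace.exp (-toC S)) / 2 * (1 + opNorm (expI K) * kappa Z)

end Bipolar

end

open scoped Matrix

section

open scoped Matrix.Norms.L2Operator ComplexOrder

noncomputable section

namespace Bipolar

variable {n : ℕ}

section

/-! Near `Z` the factors are smooth functions of logarithmic coordinates. A complex matrix `m`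
splits uniquely into a real skew, an imaginary symmetric, an imaginary skew and a real symmetric
part `l, t, k, s`, and `bipolarMap` sends `m` to `B e^l e^t e^k e^s` with `B` fixed. Its derivative
at the coordinates of `Z` is an injective endomorphism, so the inverse function theorem yields
factors of every nearby matrix with a quadratic remainder, and `IsBipolar.unique` shows that there
are no others. Each assertion thus becomes a linear bound `N (p h) ≤ c * N (DΦ h)` for a coordinate
projection `p` (`firstOrderBound_of_fderiv`). Such bounds, read at `DΦ h = 0`, also give the
injectivity.

The linear bounds come in three layers. For Mostow's decomposition `Z = U Q Y` put `P = Z* Z = Y Q²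
Y`. Since `conj Q = Q⁻¹`, one has `Y² P⁻¹ Y² = conj P`. Differentiating gives a Sylvester equation
for `d(Y²)` with coefficient `A = P⁻¹ Y² = (P⁻¹ conj P)^{1/2}`, solved by an integral of `e^{-tA*} F
e^{-tA}`; this is the origin of the integral in `k(Z)` (`sylvester_identity`, `sylvester_le`). Once
`dY` is controlled, taking skew parts, or combining adjoint and conjugate, isolates the tangent
vectors at `U` and `Q` in Lyapunov equations.

In the unitary part `W₁ e^{iT}`, symmetric and skew parts separate the two factors and leave
anticommutators with `e^{iT}`. These are inverted entrywise by `1/(1 + e^{iθ})`, that is, by the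
Fourier series with coefficients `a` (`anticommutator_le`).

Finally, the derivative of `exp` is inverted by an integral of products of resolvents
(`le_integral_resolvent_mul_dexp`), which gives `C(W)` for a unitary exponential and at most
`‖e^{-x}‖` for Hermitian `x`.

Existence rests on the geometric mean of `P⁻¹` and `(conj P)⁻¹`, which equals `Y⁻²`; the spectral
hypothesis says that `-1` is not an eigenvalue of `Uᵀ U`, whose principal square root is `e^{iT}`.
-/

/-- Square complex matrices. -/
abbrev CMat (n : ℕ) := Matrix (Fin n) (Fin n) ℂ

/-- Square real matrices. -/
abbrev RMat (n : ℕ) := Matrix (Fin n) (Fin n) ℝ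

/-! ### Entrywise conjugation and real matrices -/

lemma conj_eq_mapMatrix (A : CMat n) : conj A = (starRingEnd ℂ).mapMatrix A := rfl

lemma toC_eq_mapMatrix (A : RMat n) : toC A = Complex.ofRealHom.mapMatrix A := rfl

@[simp] lemma conj_apply (A : CMat n) (i j : Fin n) : conj A i j = starRingEnd ℂ (A i j) := rfl

@[simp] lemma toC_apply (A : RMat n) (i j : Fin n) : toC A i j = (A i j : ℂ) := rfl

@[simp] lemma conj_mul (A B : CMat n) : conj (A * B) = conj A * conj B := by
  simp only [conj_eq_mapMatrix, map_mul]

@[simp] lemma conj_add (A B : CMat n) : conj (A + B) = conj A + conj B := by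
  simp only [conj_eq_mapMatrix, map_add]

@[simp] lemma conj_sub (A B : CMat n) : conj (A - B) = conj A - conj B := by
  simp only [conj_eq_mapMatrix, map_sub]

@[simp] lemma conj_neg (A : CMat n) : conj (-A) = -conj A := by
  simp only [conj_eq_mapMatrix, map_neg]

@[simp] lemma conj_one : conj (1 : CMat n) = 1 := by
  simp only [conj_eq_mapMatrix, map_one]

@[simp] lemma conj_conj (A : CMat n) : conj (conj A) = A := by ext; simp

@[simp] lemma conj_smul (c : ℂ) (A : CMat n) : conj (c • A) = starRingEnd ℂ c • conj A := by
  ext; simp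

lemma conj_conjTranspose (A : CMat n) : conj Aᴴ = Aᵀ := by ext; simp

lemma transpose_conj (A : CMat n) : (conj A)ᵀ = Aᴴ := by ext; simp

lemma conjTranspose_conj (A : CMat n) : (conj A)ᴴ = Aᵀ := by ext; simp

lemma conj_inv (A : CMat n) : conj A⁻¹ = (conj A)⁻¹ := by
  apply Matrix.transpose_injective
  rw [transpose_conj, Matrix.transpose_nonsing_inv, transpose_conj, Matrix.conjTranspose_nonsing_inv]

lemma continuous_conj : Continuous (conj : CMat n → CMat n) :=
  continuous_id.matrix_map Complex.continuous_conj

lemma conj_exp (A : CMat n) : conj (NormedSpace.exp A) = NormedSpace.exp (conj A) :=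
  letI : NormedAlgebra ℚ (CMat n) := .restrictScalars ℚ ℝ (CMat n)
  NormedSpace.map_exp ((starRingEnd ℂ).mapMatrix : CMat n →+* CMat n) continuous_conj A

@[simp] lemma conj_toC (A : RMat n) : conj (toC A) = toC A := by ext; simp

lemma toC_injective : Function.Injective (toC : RMat n → CMat n) := fun A B h => by
  ext i j
  have := congrFun (congrFun h i) j
  simpa using this

@[simp] lemma toC_mul (A B : RMat n) : toC (A * B) = toC A * toC B := by
  simp only [toC_eq_mapMatrix, map_mul]

@[simp] lemma toC_sub (A B : RMat n) : toC (A - B) = toC A - toC B := by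
  simp only [toC_eq_mapMatrix, map_sub]

@[simp] lemma toC_neg (A : RMat n) : toC (-A) = -toC A := by
  simp only [toC_eq_mapMatrix, map_neg]

@[simp] lemma toC_one : toC (1 : RMat n) = 1 := by
  simp only [toC_eq_mapMatrix, map_one]

@[simp] lemma toC_zero : toC (0 : RMat n) = 0 := by
  simp only [toC_eq_mapMatrix, map_zero]

lemma toC_transpose (A : RMat n) : toC Aᵀ = (toC A)ᵀ := rfl

lemma toC_conjTranspose (A : RMat n) : (toC A)ᴴ = toC Aᵀ := by ext; simp

lemma continuous_toC : Continuous (toC : RMat n → CMat n) :=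
  continuous_id.matrix_map Complex.continuous_ofReal

lemma toC_exp (A : RMat n) : toC (NormedSpace.exp A) = NormedSpace.exp (toC A) :=
  letI : NormedAlgebra ℚ (CMat n) := .restrictScalars ℚ ℝ (CMat n)
  letI : NormedAlgebra ℚ (RMat n) := .restrictScalars ℚ ℝ (RMat n)
  NormedSpace.map_exp (Complex.ofRealHom.mapMatrix : RMat n →+* CMat n) continuous_toC A

/-- The entrywise real part. -/
def rePart (A : CMat n) : RMat n := A.map Complex.re

lemma toC_rePart {A : CMat n} (h : conj A = A) : toC (rePart A) = A := by
  ext i j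
  have := congrFun (congrFun h i) j
  simpa [rePart] using Complex.conj_eq_iff_re.1 this

/-- The entrywise imaginary part. -/
def imPart (A : CMat n) : RMat n := A.map Complex.im

lemma toC_imPart {A : CMat n} (h : conj A = -A) : Complex.I • toC (imPart A) = A := by
  ext i j
  have := congrArg Complex.re (congrFun (congrFun h i) j)
  simp only [conj_apply, Complex.conj_re, Matrix.neg_apply, Complex.neg_re] at this
  apply Complex.ext <;> simp [imPart]
  linarith

/-! ### Diagonalisation -/

/-- The complex diagonal matrix with given real diagonal. -/
abbrev rdiag (d : Fin n → ℝ) : CMat n := Matrix.diagonal fun i => (d i : ℂ)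

lemma unitary_mul_conjTranspose {U : CMat n} (hU : U ∈ Matrix.unitaryGroup (Fin n) ℂ) :
    U * Uᴴ = 1 := Matrix.mem_unitaryGroup_iff.1 hU

lemma unitary_conjTranspose_mul {U : CMat n} (hU : U ∈ Matrix.unitaryGroup (Fin n) ℂ) :
    Uᴴ * U = 1 := Matrix.mem_unitaryGroup_iff'.1 hU

lemma unitary_conjTranspose_mem {U : CMat n} (hU : U ∈ Matrix.unitaryGroup (Fin n) ℂ) :
    Uᴴ ∈ Matrix.unitaryGroup (Fin n) ℂ := Unitary.star_mem hU

lemma unitary_inv {U : CMat n} (hU : U ∈ Matrix.unitaryGroup (Fin n) ℂ) : U⁻¹ = Uᴴ :=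
  Matrix.inv_eq_left_inv (unitary_conjTranspose_mul hU)

lemma unitary_isUnit {U : CMat n} (hU : U ∈ Matrix.unitaryGroup (Fin n) ℂ) : IsUnit U :=
  IsUnit.of_mul_eq_one _ (unitary_mul_conjTranspose hU)

lemma conj_mem_unitary {U : CMat n} (hU : U ∈ Matrix.unitaryGroup (Fin n) ℂ) :
    conj U ∈ Matrix.unitaryGroup (Fin n) ℂ := by
  rw [Matrix.mem_unitaryGroup_iff']
  change (conj U)ᴴ * conj U = 1
  rw [conjTranspose_conj, ← conj_conjTranspose, ← conj_mul, unitary_conjTranspose_mul hU, conj_one]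

lemma transpose_mem_unitary {U : CMat n} (hU : U ∈ Matrix.unitaryGroup (Fin n) ℂ) :
    Uᵀ ∈ Matrix.unitaryGroup (Fin n) ℂ := by
  rw [← conj_conjTranspose]
  exact conj_mem_unitary (unitary_conjTranspose_mem hU)

lemma diagonal_mem_unitary {d : Fin n → ℂ} (hd : ∀ i, ‖d i‖ = 1) :
    Matrix.diagonal d ∈ Matrix.unitaryGroup (Fin n) ℂ := by
  rw [Matrix.mem_unitaryGroup_iff, Matrix.star_eq_conjTranspose, Matrix.diagonal_conjTranspose,
    Matrix.diagonal_mul_diagonal, ← Matrix.diagonal_one]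
  congr 1
  ext i
  simp [Complex.mul_conj, Complex.normSq_eq_norm_sq, hd i]

lemma exists_diagonalization {A : CMat n} (hA : A.IsHermitian) :
    ∃ U ∈ Matrix.unitaryGroup (Fin n) ℂ, ∃ d : Fin n → ℝ, (∀ i, d i ∈ spectrum ℝ A) ∧
      A = U * rdiag d * Uᴴ := by
  refine ⟨hA.eigenvectorUnitary, hA.eigenvectorUnitary.2, hA.eigenvalues,
    fun i => hA.eigenvalues_mem_spectrum_real i, ?_⟩
  conv_lhs => rw [hA.spectral_theorem]
  rfl

/-- If `Aᴴ * A = W d Wᴴ`, invertibility makes `d` positive and `A W d^{-1/2}` is already unitary,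
with no kernel to complete. Other matrices are reached through `dense_isUnit`. -/
lemma exists_svd_of_isUnit {A : CMat n} (hA : IsUnit A) :
    ∃ U ∈ Matrix.unitaryGroup (Fin n) ℂ, ∃ V ∈ Matrix.unitaryGroup (Fin n) ℂ, ∃ d : Fin n → ℝ,
      A = U * rdiag d * V := by
  have hpos : (Aᴴ * A).PosDef :=
    Matrix.PosDef.conjTranspose_mul_self A (Matrix.mulVec_injective_of_isUnit hA)
  obtain ⟨W, hW, d, hd, h⟩ := exists_diagonalization hpos.isHermitian
  have hdpos : ∀ i, 0 < d i := by
    intro i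
    have hs := hd i
    rw [hpos.isHermitian.spectrum_real_eq_range_eigenvalues] at hs
    obtain ⟨j, hj⟩ := hs
    rw [← hj]
    exact hpos.eigenvalues_pos j
  have hs : ∀ i, (Real.sqrt (d i))⁻¹ * d i * (Real.sqrt (d i))⁻¹ = 1 := fun i => by
    have h1 := Real.mul_self_sqrt (hdpos i).le
    have h2 := (Real.sqrt_pos.2 (hdpos i)).ne'
    field_simp
    nlinarith
  refine ⟨A * W * rdiag fun i => (Real.sqrt (d i))⁻¹, ?_, Wᴴ, unitary_conjTranspose_mem hW,
    fun i => Real.sqrt (d i), ?_⟩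
  · rw [Matrix.mem_unitaryGroup_iff']
    simp only [Matrix.star_eq_conjTranspose, Matrix.conjTranspose_mul,
      Matrix.diagonal_conjTranspose]
    have h1 : Wᴴ * (Aᴴ * A) * W = rdiag d := by
      rw [h]
      simp only [Matrix.mul_assoc, unitary_conjTranspose_mul hW, Matrix.mul_one]
      rw [← Matrix.mul_assoc, unitary_conjTranspose_mul hW, Matrix.one_mul]
    calc _ = Matrix.diagonal (star fun i => (((Real.sqrt (d i))⁻¹ : ℝ) : ℂ)) *
          (Wᴴ * (Aᴴ * A) * W) * rdiag fun i => (Real.sqrt (d i))⁻¹ := by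
          simp only [Matrix.mul_assoc]
      _ = 1 := by
          rw [h1, Matrix.diagonal_mul_diagonal, Matrix.diagonal_mul_diagonal,
            ← Matrix.diagonal_one]
          congr 1
          ext i
          simp only [Pi.star_apply, RCLike.star_def, Complex.conj_ofReal]
          exact_mod_cast hs i
  · rw [Matrix.mul_assoc _ (rdiag _) (rdiag _), Matrix.diagonal_mul_diagonal]
    have : (Matrix.diagonal fun i => (((Real.sqrt (d i))⁻¹ : ℝ) : ℂ) * (Real.sqrt (d i) : ℂ)) =
        (1 : CMat n) := by
      rw [← Matrix.diagonal_one]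
      congr 1
      ext i
      rw [← Complex.ofReal_mul, inv_mul_cancel₀ (Real.sqrt_pos.2 (hdpos i)).ne', Complex.ofReal_one]
    rw [this, Matrix.mul_one, Matrix.mul_assoc, unitary_mul_conjTranspose hW, Matrix.mul_one]

lemma eventually_isUnit_add_smul (A : CMat n) :
    ∀ᶠ ε : ℂ in nhdsWithin 0 {0}ᶜ, IsUnit (A + ε • (1 : CMat n)) := by
  have hfin : ((fun z : ℂ => -z) ⁻¹' spectrum ℂ A).Finite :=
    (Matrix.finite_spectrum A).preimage neg_injective.injOn
  have h : ∀ᶠ ε : ℂ in nhdsWithin 0 {0}ᶜ, ε ∉ ((fun z : ℂ => -z) ⁻¹' spectrum ℂ A) := by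
    rw [Filter.Eventually, mem_nhdsWithin_iff_exists_mem_nhds_inter]
    refine ⟨((((fun z : ℂ => -z) ⁻¹' spectrum ℂ A) \ {0}))ᶜ,
      (hfin.subset Set.sdiff_subset).isClosed.isOpen_compl.mem_nhds (by simp), ?_⟩
    rintro z ⟨hz, hz0⟩ hz'
    exact hz ⟨hz', hz0⟩
  filter_upwards [h] with ε hε
  have : IsUnit (algebraMap ℂ (CMat n) (-ε) - A) := spectrum.notMem_iff.1 hε
  rw [Algebra.algebraMap_eq_smul_one] at this
  convert this.neg using 1
  module

lemma dense_isUnit : Dense {A : CMat n | IsUnit A} := fun A => by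
  have h : Filter.Tendsto (fun ε : ℂ => A + ε • (1 : CMat n)) (nhdsWithin 0 {0}ᶜ) (nhds A) := by
    have : Continuous (fun ε : ℂ => A + ε • (1 : CMat n)) := by fun_prop
    simpa using (this.tendsto 0).mono_left nhdsWithin_le_nhds
  exact mem_closure_of_tendsto h (eventually_isUnit_add_smul A)

/-! ### Unitarily invariant norms -/

namespace IsUnitarilyInvariantNorm

variable {N : Seminorm ℂ (CMat n)}

lemma unitary_mul (hN : IsUnitarilyInvariantNorm N) {U : CMat n}
    (hU : U ∈ Matrix.unitaryGroup (Fin n) ℂ) (A : CMat n) : N (U * A) = N A := by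
  simpa using hN.invariant U hU 1 (one_mem _) A

/-- With `d i = r cos (φ i)`, the diagonal matrix is `r` times the mean of the unitaries
`diag(e^{iφ})` and `diag(e^{-iφ})`, and `N` ignores each of these. -/
lemma rdiag_mul_le (hN : IsUnitarilyInvariantNorm N) {d : Fin n → ℝ} {r : ℝ} (hr : 0 ≤ r)
    (hd : ∀ i, |d i| ≤ r) (B : CMat n) : N (rdiag d * B) ≤ r * N B := by
  rcases hr.eq_or_lt with rfl | hr
  · have : d = 0 := by
      ext i
      simpa using hd i
    simp [this, rdiag]
  set φ : Fin n → ℝ := fun i => Real.arccos (d i / r)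
  have hφ : ∀ i, (d i : ℂ) =
      (r / 2 : ℂ) * (Complex.exp (φ i * Complex.I) + Complex.exp (-φ i * Complex.I)) := by
    intro i
    have h1 : Real.cos (φ i) = d i / r := by
      have := abs_le.1 (hd i)
      apply Real.cos_arccos
      · rw [le_div_iff₀ hr]; linarith
      · rw [div_le_iff₀ hr]; linarith
    have h2 : (d i : ℂ) = r * Complex.cos (φ i) := by
      rw [← Complex.ofReal_cos, h1, ← Complex.ofReal_mul]
      congr 1
      field_simp
    rw [h2, Complex.cos]
    ring
  have hdiag : rdiag d = (r / 2 : ℂ) • (Matrix.diagonal (fun i => Complex.exp (φ i * Complex.I)) +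
      Matrix.diagonal (fun i => Complex.exp (-φ i * Complex.I))) := by
    rw [Matrix.diagonal_add, ← Matrix.diagonal_smul, rdiag]
    congr 1
    funext i
    simp only [Pi.smul_apply, smul_eq_mul, hφ i]
  have hU : ∀ ψ : Fin n → ℝ, Matrix.diagonal (fun i => Complex.exp (ψ i * Complex.I)) ∈
      Matrix.unitaryGroup (Fin n) ℂ := fun ψ =>
    diagonal_mem_unitary fun i => Complex.norm_exp_ofReal_mul_I _
  rw [hdiag, Matrix.smul_mul, map_smul_eq_mul, Matrix.add_mul]
  have h1 := map_add_le_add N (Matrix.diagonal (fun i => Complex.exp (φ i * Complex.I)) * B)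
    (Matrix.diagonal (fun i => Complex.exp (-φ i * Complex.I)) * B)
  rw [hN.unitary_mul (hU φ)] at h1
  have h2 := hN.unitary_mul (hU (-φ)) B
  simp only [Pi.neg_apply, Complex.ofReal_neg] at h2
  rw [h2] at h1
  have h3 : ‖(r / 2 : ℂ)‖ = r / 2 := by
    rw [show (r / 2 : ℂ) = ((r / 2 : ℝ) : ℂ) by push_cast; ring, Complex.norm_real,
      Real.norm_of_nonneg (by positivity)]
  rw [h3]
  nlinarith [apply_nonneg N B]

end IsUnitarilyInvariantNorm

lemma isUnitarilyInvariantNorm_normSeminorm :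
    IsUnitarilyInvariantNorm (normSeminorm ℂ (CMat n)) where
  definite A h := by simpa using h
  invariant U hU V hV A := by
    simp only [coe_normSeminorm]
    rw [CStarRing.norm_mul_mem_unitary _ hV, CStarRing.norm_mem_unitary_mul _ hU]

lemma norm_rdiag_le_iff {d : Fin n → ℝ} {r : ℝ} (hr : 0 ≤ r) :
    ‖rdiag d‖ ≤ r ↔ ∀ i, |d i| ≤ r := by
  rw [Matrix.l2_opNorm_diagonal, pi_norm_le_iff_of_nonneg hr]
  simp

namespace IsUnitarilyInvariantNorm

variable {N : Seminorm ℂ (CMat n)}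

lemma le_norm_mul_of_isUnit (hN : IsUnitarilyInvariantNorm N) {A : CMat n} (hA : IsUnit A)
    (B : CMat n) : N (A * B) ≤ ‖A‖ * N B := by
  obtain ⟨U, hU, V, hV, d, h⟩ := exists_svd_of_isUnit hA
  have hnorm : ‖A‖ = ‖rdiag d‖ := by
    rw [h]
    exact isUnitarilyInvariantNorm_normSeminorm.invariant U hU V hV _
  rw [hnorm, h, Matrix.mul_assoc, Matrix.mul_assoc, hN.unitary_mul hU, ← hN.unitary_mul hV B]
  exact hN.rdiag_mul_le (norm_nonneg _) ((norm_rdiag_le_iff (norm_nonneg _)).1 le_rfl) _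

end IsUnitarilyInvariantNorm

/-- Every seminorm on matrices is continuous. -/
lemma continuous_seminorm (N : Seminorm ℂ (CMat n)) : Continuous N := by
  -- A finite convex function on a finite-dimensional space is continuous.
  have h := (N.restrictScalars ℝ).convexOn.continuousOn_interior
  simpa [continuousOn_univ] using h

namespace IsUnitarilyInvariantNorm

variable {N : Seminorm ℂ (CMat n)}

lemma mul_le_left (hN : IsUnitarilyInvariantNorm N) (A B : CMat n) : N (A * B) ≤ ‖A‖ * N B := by
  have hc := continuous_seminorm N
  refine isClosed_property (p := fun A : CMat n => N (A * B) ≤ ‖A‖ * N B)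
    (e := ((↑) : {A : CMat n | IsUnit A} → CMat n)) ?_ ?_ ?_ A
  · exact dense_isUnit.denseRange_val
  · exact isClosed_le (hc.comp (by fun_prop)) (by fun_prop)
  · exact fun A => hN.le_norm_mul_of_isUnit A.2 B

/-- Reduces invariance under conjugation and transposition to singular value decompositions, with
density of the invertible matrices covering the rest. -/
lemma apply_rdiag_star (hN : IsUnitarilyInvariantNorm N) (A : CMat n) (f : CMat n → CMat n)
    (hf : Continuous f)
    (h : ∀ U ∈ Matrix.unitaryGroup (Fin n) ℂ, ∀ V ∈ Matrix.unitaryGroup (Fin n) ℂ,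
      ∀ d : Fin n → ℝ, N (f (U * rdiag d * V)) = N (rdiag d)) : N (f A) = N A := by
  have hc := continuous_seminorm N
  refine isClosed_property (p := fun A : CMat n => N (f A) = N A)
    (e := ((↑) : {A : CMat n | IsUnit A} → CMat n)) ?_ ?_ ?_ A
  · exact dense_isUnit.denseRange_val
  · exact isClosed_eq (hc.comp hf) hc
  · rintro ⟨A, hA⟩
    obtain ⟨U, hU, V, hV, d, rfl⟩ := exists_svd_of_isUnit hA
    simp only
    rw [h U hU V hV d, hN.invariant U hU V hV]

lemma apply_conj (hN : IsUnitarilyInvariantNorm N) (A : CMat n) : N (conj A) = N A :=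
  hN.apply_rdiag_star A conj continuous_conj fun U hU V hV d => by
    have : conj (rdiag d) = rdiag d := by
      ext i j
      by_cases h : i = j <;> simp [Matrix.diagonal, h]
    rw [conj_mul, conj_mul, this, hN.invariant _ (conj_mem_unitary hU) _ (conj_mem_unitary hV)]

lemma apply_transpose (hN : IsUnitarilyInvariantNorm N) (A : CMat n) : N Aᵀ = N A :=
  hN.apply_rdiag_star A Matrix.transpose (by fun_prop) fun U hU V hV d => by
    rw [Matrix.transpose_mul, Matrix.transpose_mul, Matrix.diagonal_transpose, ← Matrix.mul_assoc,
      hN.invariant _ (transpose_mem_unitary hV) _ (transpose_mem_unitary hU)]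

lemma apply_conjTranspose (hN : IsUnitarilyInvariantNorm N) (A : CMat n) : N Aᴴ = N A := by
  rw [← transpose_conj, hN.apply_transpose, hN.apply_conj]

lemma mul_le_right (hN : IsUnitarilyInvariantNorm N) (A B : CMat n) : N (A * B) ≤ N A * ‖B‖ := by
  rw [← hN.apply_conjTranspose (A * B), Matrix.conjTranspose_mul, mul_comm,
    ← Matrix.l2_opNorm_conjTranspose, ← hN.apply_conjTranspose A]
  exact hN.mul_le_left _ _

lemma mul_mul_le (hN : IsUnitarilyInvariantNorm N) (A B C : CMat n) :
    N (A * B * C) ≤ ‖A‖ * N B * ‖C‖ :=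
  (hN.mul_le_right _ _).trans (mul_le_mul_of_nonneg_right (hN.mul_le_left _ _) (norm_nonneg _))

end IsUnitarilyInvariantNorm

@[simp] lemma norm_conj (A : CMat n) : ‖conj A‖ = ‖A‖ :=
  isUnitarilyInvariantNorm_normSeminorm.apply_conj A

@[simp] lemma norm_transpose (A : CMat n) : ‖Aᵀ‖ = ‖A‖ :=
  isUnitarilyInvariantNorm_normSeminorm.apply_transpose A

lemma norm_unitary_mul {U : CMat n} (hU : U ∈ Matrix.unitaryGroup (Fin n) ℂ) (A : CMat n) :
    ‖U * A‖ = ‖A‖ := CStarRing.norm_mem_unitary_mul _ hU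

lemma norm_mul_unitary {U : CMat n} (hU : U ∈ Matrix.unitaryGroup (Fin n) ℂ) (A : CMat n) :
    ‖A * U‖ = ‖A‖ := CStarRing.norm_mul_mem_unitary _ hU

/-- A definite seminorm on matrices dominates a multiple of the operator norm. -/
lemma exists_norm_le_mul {N : Seminorm ℂ (CMat n)} (hN : ∀ A, N A = 0 → A = 0) :
    ∃ C > 0, ∀ A : CMat n, ‖A‖ ≤ C * N A := by
  have hc := continuous_seminorm N
  have : ProperSpace (CMat n) := FiniteDimensional.proper ℂ _
  have hK : IsCompact (Metric.sphere (0 : CMat n) 1) := isCompact_sphere _ _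
  -- The sphere is empty exactly when `n = 0`; otherwise the minimum of `N` on it supplies the
  -- constant.
  rcases (Metric.sphere (0 : CMat n) 1).eq_empty_or_nonempty with he | hne
  · refine ⟨1, one_pos, fun A => ?_⟩
    by_cases hA : A = 0
    · simp [hA]
    · exfalso
      have : ((‖A‖ : ℂ)⁻¹ • A) ∈ Metric.sphere (0 : CMat n) 1 := by
        simp [norm_smul, norm_ne_zero_iff.2 hA]
      simp [he] at this
  · obtain ⟨B, hB, hmin⟩ := hK.exists_isMinOn hne hc.continuousOn
    have hB0 : B ≠ 0 := by
      rintro rfl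
      simp at hB
    have hpos : 0 < N B := (apply_nonneg N B).lt_of_ne fun h => hB0 (hN B h.symm)
    refine ⟨(N B)⁻¹, inv_pos.2 hpos, fun A => ?_⟩
    by_cases hA : A = 0
    · simp [hA]
    have hm : ((‖A‖ : ℂ)⁻¹ • A) ∈ Metric.sphere (0 : CMat n) 1 := by
      simp [norm_smul, norm_ne_zero_iff.2 hA]
    have h := hmin hm
    simp only [Set.mem_ofPred_eq, map_smul_eq_mul, norm_inv, Complex.norm_real, norm_norm] at h
    have hA' := norm_pos_iff.2 hA
    rw [inv_mul_eq_div, le_div_iff₀ hpos]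
    rw [inv_mul_eq_div, le_div_iff₀ hA'] at h
    linarith

lemma exists_le_mul_norm (N : Seminorm ℂ (CMat n)) : ∃ C > 0, ∀ A : CMat n, N A ≤ C * ‖A‖ := by
  obtain ⟨C, hC, h⟩ := Seminorm.bound_of_continuous_normedSpace N (continuous_seminorm N)
  exact ⟨C, hC, h⟩

end

section

/-! ### Seminorms of integrals -/

/-- Hahn–Banach: a supporting functional of `N` at `A`. It commutes with integrals, which lets `N`
pass under the integral sign in `seminorm_integral_le`. -/
lemma exists_dual_eq_seminorm (N : Seminorm ℂ (CMat n)) (A : CMat n) :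
    ∃ g : CMat n →L[ℝ] ℝ, g A = N A ∧ ∀ B, g B ≤ N B := by
  rcases eq_or_ne A 0 with rfl | hA
  · exact ⟨0, by simp, fun B => by simp⟩
  obtain ⟨g, hg, hgN⟩ := exists_extension_of_le_sublinear
    (LinearPMap.mkSpanSingleton A (N A) hA : CMat n →ₗ.[ℝ] ℝ) N
    (fun c hc x => by
      have := map_smul_eq_mul (N.restrictScalars ℝ) c x
      simpa [abs_of_pos hc] using this)
    (fun x y => map_add_le_add N x y)
    (by
      rintro ⟨x, hx⟩
      obtain ⟨c, rfl⟩ := Submodule.mem_span_singleton.1 hx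
      refine (LinearPMap.mkSpanSingleton'_apply A (N A) _ c hx).trans_le ?_
      have := map_smul_eq_mul (N.restrictScalars ℝ) c A
      simp only [Seminorm.coe_restrictScalars, Real.norm_eq_abs] at this
      simp only [this, smul_eq_mul, RingHom.id_apply]
      exact mul_le_mul_of_nonneg_right (le_abs_self c) (apply_nonneg N A))
  refine ⟨LinearMap.toContinuousLinearMap g, ?_, hgN⟩
  have := hg ⟨A, Submodule.mem_span_singleton_self A⟩
  simp only [LinearMap.coe_toContinuousLinearMap']
  rw [this]
  exact LinearPMap.mkSpanSingleton_apply ℝ ℝ hA _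

lemma seminorm_integral_le {α : Type*} [MeasurableSpace α] {μ : MeasureTheory.Measure α}
    (N : Seminorm ℂ (CMat n)) {f : α → CMat n} {g : α → ℝ} (hf : MeasureTheory.Integrable f μ)
    (hg : MeasureTheory.Integrable g μ) (h : ∀ x, N (f x) ≤ g x) :
    N (∫ x, f x ∂μ) ≤ ∫ x, g x ∂μ := by
  obtain ⟨φ, hφ, hle⟩ := exists_dual_eq_seminorm N (∫ x, f x ∂μ)
  rw [← hφ, ← ContinuousLinearMap.integral_comp_comm φ hf]
  exact MeasureTheory.integral_mono (φ.integrable_comp hf) hg fun x => (hle _).trans (h x)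

/-! ### Positive definite matrices -/

lemma PosDef.exists_diagonalization {A : CMat n} (hA : A.PosDef) :
    ∃ U ∈ Matrix.unitaryGroup (Fin n) ℂ, ∃ d : Fin n → ℝ, (∀ i, 0 < d i) ∧
      A = U * rdiag d * Uᴴ := by
  obtain ⟨U, hU, d, hd, h⟩ := Bipolar.exists_diagonalization hA.isHermitian
  refine ⟨U, hU, d, fun i => ?_, h⟩
  have hs := hd i
  rw [hA.isHermitian.spectrum_real_eq_range_eigenvalues] at hs
  obtain ⟨j, hj⟩ := hs
  rw [← hj]
  exact hA.eigenvalues_pos j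

lemma norm_conj_rdiag {U : CMat n} (hU : U ∈ Matrix.unitaryGroup (Fin n) ℂ) (A : CMat n) :
    ‖U * A * Uᴴ‖ = ‖A‖ :=
  isUnitarilyInvariantNorm_normSeminorm.invariant U hU _ (unitary_conjTranspose_mem hU) A

lemma rdiag_mul_rdiag (d e : Fin n → ℝ) : rdiag d * rdiag e = rdiag (fun i => d i * e i) := by
  simp [rdiag, Matrix.diagonal_mul_diagonal]

lemma rdiag_one : rdiag (fun _ : Fin n => (1 : ℝ)) = 1 := by
  simp [rdiag]

lemma inv_conj_rdiag {U : CMat n} (hU : U ∈ Matrix.unitaryGroup (Fin n) ℂ) {d : Fin n → ℝ}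
    (hd : ∀ i, 0 < d i) : (U * rdiag d * Uᴴ)⁻¹ = U * rdiag (fun i => (d i)⁻¹) * Uᴴ := by
  apply Matrix.inv_eq_left_inv
  calc _ = U * rdiag (fun i => (d i)⁻¹) * (Uᴴ * U) * rdiag d * Uᴴ := by
        simp only [Matrix.mul_assoc]
    _ = 1 := by
        rw [unitary_conjTranspose_mul hU, Matrix.mul_one, Matrix.mul_assoc U, rdiag_mul_rdiag]
        have : (fun i => (d i)⁻¹ * d i) = fun _ => 1 := funext fun i => inv_mul_cancel₀ (hd i).ne'
        rw [this, rdiag_one, Matrix.mul_one, unitary_mul_conjTranspose hU]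

/-- The midpoint of the interval spanned by the spectrum of a positive definite matrix. -/
def center (B : CMat n) : ℝ := (‖B‖ + ‖B⁻¹‖⁻¹) / 2

/-- The spectrum lies in `[‖B⁻¹‖⁻¹, ‖B‖]`; after subtracting the midpoint only half the length of
this interval remains. -/
lemma norm_sub_center_le {B : CMat n} (hB : B.PosDef) :
    ‖B - (center B : ℂ) • (1 : CMat n)‖ ≤ (‖B‖ - ‖B⁻¹‖⁻¹) / 2 := by
  obtain ⟨U, hU, d, hd, h⟩ := PosDef.exists_diagonalization hB
  have h1 : ∀ i, d i ≤ ‖B‖ := fun i => by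
    rw [h, norm_conj_rdiag hU]
    exact (le_abs_self _).trans ((norm_rdiag_le_iff (norm_nonneg _)).1 le_rfl i)
  have h2 : ∀ i, ‖B⁻¹‖⁻¹ ≤ d i := fun i => by
    have h3 : (d i)⁻¹ ≤ ‖B⁻¹‖ := by
      rw [h, inv_conj_rdiag hU hd, norm_conj_rdiag hU]
      have h3 := (norm_rdiag_le_iff (norm_nonneg (rdiag fun i => (d i)⁻¹))).1 le_rfl i
      exact (le_abs_self _).trans h3
    exact inv_le_of_inv_le₀ (hd i) h3
  have h3 : B - (center B : ℂ) • (1 : CMat n) = U * rdiag (fun i => d i - center B) * Uᴴ := by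
    have : rdiag (fun i => d i - center B) = rdiag d - (center B : ℂ) • 1 := by
      rw [Matrix.smul_one_eq_diagonal, Matrix.diagonal_sub]
      simp [rdiag]
    rw [this, Matrix.mul_sub, Matrix.sub_mul, ← h, Matrix.mul_smul, Matrix.mul_one,
      Matrix.smul_mul, unitary_mul_conjTranspose hU]
  rcases isEmpty_or_nonempty (Fin n) with he | ⟨⟨i⟩⟩
  · have : B = 0 := Subsingleton.elim _ _
    have hs : B - (center B : ℂ) • (1 : CMat n) = 0 := Subsingleton.elim _ _
    have hi : (B⁻¹ : CMat n) = 0 := Subsingleton.elim _ _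
    rw [hs, hi, this]
    simp
  · rw [h3, norm_conj_rdiag hU, norm_rdiag_le_iff (by linarith [h1 i, h2 i])]
    intro j
    rw [abs_le, center]
    constructor <;> linarith [h1 j, h2 j]

namespace IsUnitarilyInvariantNorm

variable {N : Seminorm ℂ (CMat n)}

/-- The Lyapunov equation with a positive definite coefficient. -/
lemma lyapunov_le (hN : IsUnitarilyInvariantNorm N) {B : CMat n} (hB : B.PosDef) (M : CMat n) :
    N M ≤ ‖B⁻¹‖ / 2 * N (B * M + M * B) := by
  have hc := norm_sub_center_le hB
  set b := center B with hb
  set B' := B - (b : ℂ) • (1 : CMat n) with hB'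
  -- Splitting `B = b + B'` at the midpoint, the scalar part contributes `2b` and the rest costs at
  -- most `2‖B'‖`; the difference is at least `2‖B⁻¹‖⁻¹`.
  have h1 : ((2 * b : ℝ) : ℂ) • M = (B * M + M * B) - (B' * M + M * B') := by
    rw [hB']
    simp only [Matrix.sub_mul, Matrix.mul_sub, Matrix.smul_mul, Matrix.mul_smul, Matrix.one_mul,
      Matrix.mul_one]
    push_cast
    module
  have hb0 : 0 ≤ b := by rw [hb, center]; positivity
  have h2 := map_sub_le_add N (B * M + M * B) (B' * M + M * B')
  rw [← h1, map_smul_eq_mul, Complex.norm_real, Real.norm_of_nonneg (by positivity)] at h2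
  have h3 := (map_add_le_add N (B' * M) (M * B')).trans
    (add_le_add (hN.mul_le_left B' M) (hN.mul_le_right M B'))
  have h4 : 2 * ‖B⁻¹‖⁻¹ * N M ≤ N (B * M + M * B) := by
    have h5 : ‖B'‖ * N M ≤ (‖B‖ - ‖B⁻¹‖⁻¹) / 2 * N M :=
      mul_le_mul_of_nonneg_right hc (apply_nonneg N M)
    have h6 : 2 * b = ‖B‖ + ‖B⁻¹‖⁻¹ := by rw [hb, center]; ring
    rw [h6] at h2
    nlinarith
  -- The inverse vanishes only in dimension zero.
  rcases (norm_nonneg B⁻¹).eq_or_lt with h0 | hpos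
  · have : (B⁻¹ : CMat n) = 0 := norm_eq_zero.1 h0.symm
    have hone : (1 : CMat n) = 0 := by
      rw [← Matrix.mul_nonsing_inv B ((Matrix.isUnit_iff_isUnit_det _).1 hB.isUnit), this,
        Matrix.mul_zero]
    have hM : M = 0 := by rw [← Matrix.mul_one M, hone, Matrix.mul_zero]
    simp [hM]
  · have h7 : ‖B⁻¹‖ * ‖B⁻¹‖⁻¹ = 1 := mul_inv_cancel₀ hpos.ne'
    calc N M = ‖B⁻¹‖ / 2 * (2 * ‖B⁻¹‖⁻¹ * N M) := by linear_combination (-N M) * h7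
      _ ≤ _ := by gcongr

end IsUnitarilyInvariantNorm

/-! ### The Sylvester equation with a coefficient similar to a positive matrix -/

lemma exp_rdiag (d : Fin n → ℝ) : NormedSpace.exp (rdiag d) = rdiag fun i => Real.exp (d i) := by
  rw [rdiag, Matrix.exp_diagonal]
  congr 1
  funext i
  simp [← Complex.exp_eq_exp_ℂ]

/-- The matrix `A` is similar to a diagonal matrix with positive diagonal. -/
def IsSimilarPos (A : CMat n) : Prop :=
  ∃ G : CMat n, IsUnit G ∧ ∃ d : Fin n → ℝ, (∀ i, 0 < d i) ∧ A = G * rdiag d * G⁻¹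

/-- The decay rate is the least diagonal entry and the constant is the condition number of the
similarity; this makes the integral in `k(Z)` converge. -/
lemma IsSimilarPos.exists_norm_exp_le {A : CMat n} (hA : IsSimilarPos A) :
    ∃ C δ : ℝ, 0 ≤ C ∧ 0 < δ ∧
      ∀ t : ℝ, 0 ≤ t → ‖NormedSpace.exp (-(t • A))‖ ≤ C * Real.exp (-(δ * t)) := by
  obtain ⟨G, hG, d, hd, rfl⟩ := hA
  obtain ⟨δ, hδ, hle⟩ : ∃ δ > 0, ∀ i, δ ≤ d i := by
    rcases isEmpty_or_nonempty (Fin n) with he | hne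
    · exact ⟨1, one_pos, fun i => (IsEmpty.false i).elim⟩
    · obtain ⟨i, hi⟩ := Finite.exists_min d
      exact ⟨d i, hd i, hi⟩
  refine ⟨‖G‖ * ‖G⁻¹‖, δ, by positivity, hδ, fun t ht => ?_⟩
  have h1 : -(t • (G * rdiag d * G⁻¹)) = G * rdiag (fun i => -(t * d i)) * G⁻¹ := by
    have : rdiag (fun i => -(t * d i)) = -(t • rdiag d) := by
      ext i j
      by_cases h : i = j <;> simp [rdiag, Matrix.diagonal, h]
    rw [this]
    simp
  rw [h1, Matrix.exp_conj _ _ hG, exp_rdiag]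
  have h2 : ‖rdiag (fun i => Real.exp (-(t * d i)))‖ ≤ Real.exp (-(δ * t)) := by
    rw [norm_rdiag_le_iff (Real.exp_pos _).le]
    intro i
    rw [abs_of_pos (Real.exp_pos _), Real.exp_le_exp]
    nlinarith [hle i]
  calc _ ≤ ‖G‖ * ‖rdiag (fun i => Real.exp (-(t * d i)))‖ * ‖G⁻¹‖ := norm_mul₃_le
    _ ≤ ‖G‖ * Real.exp (-(δ * t)) * ‖G⁻¹‖ := by gcongr
    _ = _ := by ring

lemma hasDerivAt_exp_neg_smul (A : CMat n) (t : ℝ) :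
    HasDerivAt (fun t : ℝ => NormedSpace.exp (-(t • A))) (-(A * NormedSpace.exp (-(t • A)))) t := by
  have h := hasDerivAt_exp_smul_const' (𝕂 := ℝ) (-A) t
  simpa [smul_neg, neg_mul] using h

lemma IsSimilarPos.integrableOn {A : CMat n} (hA : IsSimilarPos A) :
    MeasureTheory.IntegrableOn (fun t : ℝ => ‖NormedSpace.exp (-(t • A))‖ ^ 2) (Set.Ioi 0) := by
  obtain ⟨C, δ, hC, hδ, h⟩ := hA.exists_norm_exp_le
  have hcont : Continuous fun t : ℝ => NormedSpace.exp (-(t • A)) :=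
    continuous_iff_continuousAt.2 fun t => (hasDerivAt_exp_neg_smul A t).continuousAt
  have hint := (integrableOn_exp_mul_Ioi (a := -(2 * δ)) (by linarith) 0).const_mul (C ^ 2)
  refine hint.mono' (hcont.norm.pow 2).aestronglyMeasurable ?_
  filter_upwards [MeasureTheory.ae_restrict_mem measurableSet_Ioi] with t ht
  rw [Real.norm_of_nonneg (by positivity)]
  calc _ ≤ (C * Real.exp (-(δ * t))) ^ 2 := by
        gcongr
        exact h t (le_of_lt ht)
    _ = _ := by
        rw [mul_pow, ← Real.exp_nat_mul]
        congr 2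
        push_cast
        ring

/-- The derivative of `e^{-tA*} M e^{-tA}` is `-e^{-tA*} F e^{-tA}` with `F = M A + A* M`.
Integrating from `0`, where the value is `M`, to infinity, where it tends to `0`, expresses `M` by
`F`. -/
lemma IsUnitarilyInvariantNorm.sylvester_le {N : Seminorm ℂ (CMat n)}
    (hN : IsUnitarilyInvariantNorm N) {A : CMat n} (hA : IsSimilarPos A) (M : CMat n) :
    N M ≤ (∫ t in Set.Ioi (0 : ℝ), ‖NormedSpace.exp (-(t • A))‖ ^ 2) * N (M * A + Aᴴ * M) := by
  set E : ℝ → CMat n := fun t => NormedSpace.exp (-(t • A)) with hE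
  set F := M * A + Aᴴ * M with hF
  have hder : ∀ t, HasDerivAt E (-(A * E t)) t := hasDerivAt_exp_neg_smul A
  have hderS : ∀ t, HasDerivAt (fun t => (E t)ᴴ) (-((E t)ᴴ * Aᴴ)) t := fun t => by
    have := (hder t).star
    simpa [Matrix.star_eq_conjTranspose, Matrix.conjTranspose_mul] using this
  have hderf : ∀ t, HasDerivAt (fun t => (E t)ᴴ * M * E t) (-((E t)ᴴ * F * E t)) t := fun t => by
    have := ((hderS t).mul_const M).mul (hder t)
    refine this.congr_deriv ?_
    rw [hF]
    simp only [Matrix.mul_add, Matrix.add_mul, Matrix.neg_mul, Matrix.mul_neg, Matrix.mul_assoc]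
    abel
  have hcont : Continuous E := continuous_iff_continuousAt.2 fun t => (hder t).continuousAt
  have hcontf : Continuous fun t => (E t)ᴴ * F * E t := by fun_prop
  have hint2 := hA.integrableOn
  have hintf : MeasureTheory.IntegrableOn (fun t => (E t)ᴴ * F * E t) (Set.Ioi 0) := by
    refine (hint2.mul_const ‖F‖).mono' hcontf.aestronglyMeasurable ?_
    refine Filter.Eventually.of_forall fun t => ?_
    calc _ ≤ ‖(E t)ᴴ‖ * ‖F‖ * ‖E t‖ := norm_mul₃_le
      _ = _ := by rw [Matrix.l2_opNorm_conjTranspose]; ring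
  have hlim : Filter.Tendsto (fun t => (E t)ᴴ * M * E t) Filter.atTop (nhds 0) := by
    obtain ⟨C, δ, hC, hδ, h⟩ := hA.exists_norm_exp_le
    have hE0 : Filter.Tendsto E Filter.atTop (nhds 0) := by
      refine squeeze_zero_norm' (a := fun t => C * Real.exp (-(δ * t)))
        ((Filter.eventually_ge_atTop 0).mono h) ?_
      have : Filter.Tendsto (fun t : ℝ => Real.exp (-(δ * t))) Filter.atTop (nhds 0) :=
        Real.tendsto_exp_neg_atTop_nhds_zero.comp (Filter.tendsto_id.const_mul_atTop hδ)
      simpa using this.const_mul C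
    have : Continuous fun B : CMat n => Bᴴ * M * B := by fun_prop
    simpa [Function.comp_def] using (this.tendsto 0).comp hE0
  have hI := MeasureTheory.integral_Ioi_of_hasDerivAt_of_tendsto' (a := 0)
    (fun t _ => hderf t) hintf.neg hlim
  have hE0 : E 0 = 1 := by simp [hE]
  rw [hE0, Matrix.conjTranspose_one, Matrix.one_mul, Matrix.mul_one, zero_sub,
    MeasureTheory.integral_neg, neg_inj] at hI
  rw [← hI, ← MeasureTheory.integral_mul_const]
  refine seminorm_integral_le N hintf (hint2.mul_const _) fun t => ?_
  calc _ ≤ ‖(E t)ᴴ‖ * N F * ‖E t‖ := hN.mul_mul_le _ _ _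
    _ = _ := by rw [Matrix.l2_opNorm_conjTranspose]; ring

/-! ### The Sylvester equation with a unitary coefficient -/

lemma apply_of_diagonal_anticommutator {w : Fin n → ℂ} {M F : CMat n}
    (h : Matrix.diagonal w * M + M * Matrix.diagonal w = F) (i j : Fin n) :
    (w i + w j) * M i j = F i j := by
  rw [← h]
  simp [Matrix.diagonal_mul, Matrix.mul_diagonal]
  ring

lemma conj_cancel {U : CMat n} (hU : U ∈ Matrix.unitaryGroup (Fin n) ℂ) (A : CMat n) :
    U * (Uᴴ * A * U) * Uᴴ = A := by
  have h := unitary_mul_conjTranspose hU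
  calc _ = (U * Uᴴ) * A * (U * Uᴴ) := by simp only [Matrix.mul_assoc]
    _ = A := by rw [h, Matrix.one_mul, Matrix.mul_one]

lemma diagonalize_anticommutator {U : CMat n} (hU : U ∈ Matrix.unitaryGroup (Fin n) ℂ)
    (D M : CMat n) :
    D * (Uᴴ * M * U) + (Uᴴ * M * U) * D =
      Uᴴ * ((U * D * Uᴴ) * M + M * (U * D * Uᴴ)) * U := by
  have h := unitary_conjTranspose_mul hU
  calc _ = (Uᴴ * U) * D * Uᴴ * M * U + Uᴴ * M * U * D * (Uᴴ * U) := by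
        rw [h, Matrix.one_mul, Matrix.mul_one]
        simp only [Matrix.mul_assoc]
    _ = _ := by simp only [Matrix.mul_assoc, Matrix.mul_add, Matrix.add_mul]

lemma eq_zero_of_anticommute {U : CMat n} (hU : U ∈ Matrix.unitaryGroup (Fin n) ℂ)
    {w : Fin n → ℂ} (hw : ∀ i j, w i + w j ≠ 0) {M : CMat n}
    (h : (U * Matrix.diagonal w * Uᴴ) * M + M * (U * Matrix.diagonal w * Uᴴ) = 0) : M = 0 := by
  have h1 := diagonalize_anticommutator hU (Matrix.diagonal w) M
  rw [h, Matrix.mul_zero, Matrix.zero_mul] at h1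
  have h2 : Uᴴ * M * U = 0 := by
    ext i j
    have := apply_of_diagonal_anticommutator h1 i j
    simpa [hw i j] using this
  rw [← conj_cancel hU M, h2, Matrix.mul_zero, Matrix.zero_mul]

/-- The anticommutator with a unitary matrix `U diag(e^{iθ}) U*` is inverted, with a bound, by any
`ℓ₁` sequence whose Fourier series interpolates `1 / (1 + e^{iθ})` on the spectrum differences. -/
lemma IsUnitarilyInvariantNorm.anticommutator_le {N : Seminorm ℂ (CMat n)}
    (hN : IsUnitarilyInvariantNorm N) {U : CMat n} (hU : U ∈ Matrix.unitaryGroup (Fin n) ℂ)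
    {θ : Fin n → ℝ} (hθ : ∀ i j, 1 + Complex.exp ((θ i - θ j) * Complex.I) ≠ 0)
    {a : ℤ → ℂ} (ha : Summable fun m => ‖a m‖)
    (hsum : ∀ i j, ∑' m : ℤ, (-1 : ℂ) ^ m * a m * Complex.exp (m * (θ i - θ j) * Complex.I) =
      1 / (1 + Complex.exp ((θ i - θ j) * Complex.I)))
    {W : CMat n} (hW : W = U * Matrix.diagonal (fun i => Complex.exp (θ i * Complex.I)) * Uᴴ)
    (M : CMat n) : N M ≤ (∑' m : ℤ, ‖a m‖) * N (W * M + M * W) := by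
  set F := W * M + M * W with hF
  set M' := Uᴴ * M * U with hM'
  set F' := Uᴴ * F * U with hF'
  have hNM : N M' = N M := hN.invariant _ (unitary_conjTranspose_mem hU) _ hU _
  have hNF : N F' = N F := hN.invariant _ (unitary_conjTranspose_mem hU) _ hU _
  rw [← hNM, ← hNF]
  have hent := apply_of_diagonal_anticommutator (M := M') (F := F')
    (w := fun i => Complex.exp (θ i * Complex.I)) (by
      rw [hM', hF', hF, hW]
      exact diagonalize_anticommutator hU _ M)
  have hnorm1 : ∀ x : ℝ, ‖Complex.exp (x * Complex.I)‖ = 1 := Complex.norm_exp_ofReal_mul_I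
  set V : ℤ → CMat n := fun m => Matrix.diagonal fun i => Complex.exp ((m * θ i : ℝ) * Complex.I)
  have hV : ∀ m, V m ∈ Matrix.unitaryGroup (Fin n) ℂ := fun m =>
    diagonal_mem_unitary fun i => hnorm1 _
  -- Here `1/(w_i + w_j) = e^{-iθ_j}/(1 + e^{i(θ_i - θ_j)})`. The `m`-th Fourier term carries
  -- `e^{imθ_i}` on rows and `e^{-i(m+1)θ_j}` on columns, whence the exponent `-m - 1`.
  set f : ℤ → CMat n := fun m => ((-1 : ℂ) ^ m * a m) • (V m * F' * V (-m - 1)) with hf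
  have hent_f : ∀ m i j, f m i j = (-1 : ℂ) ^ m * a m *
      Complex.exp (m * (θ i - θ j) * Complex.I) * (Complex.exp (-θ j * Complex.I) * F' i j) := by
    intro m i j
    simp only [hf, V, Matrix.smul_apply, Matrix.mul_diagonal, Matrix.diagonal_mul, smul_eq_mul]
    have : Complex.exp ((m * θ i : ℝ) * Complex.I) *
        Complex.exp ((((-m - 1 : ℤ) : ℝ) * θ j : ℝ) * Complex.I) =
        Complex.exp (m * (θ i - θ j) * Complex.I) * Complex.exp (-θ j * Complex.I) := by
      rw [← Complex.exp_add, ← Complex.exp_add]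
      congr 1
      push_cast
      ring
    linear_combination ((-1 : ℂ) ^ m * a m * F' i j) * this
  have hnormc : ∀ m : ℤ, ‖(-1 : ℂ) ^ m * a m‖ = ‖a m‖ := fun m => by simp
  have hHas : HasSum f M' := by
    refine Pi.hasSum.2 fun i => Pi.hasSum.2 fun j => ?_
    have hs : Summable fun m : ℤ =>
        (-1 : ℂ) ^ m * a m * Complex.exp (m * (θ i - θ j) * Complex.I) := by
      refine Summable.of_norm (ha.congr fun m => ?_)
      rw [norm_mul, hnormc]
      have := hnorm1 (m * (θ i - θ j))
      push_cast at this
      rw [this, mul_one]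
    have h1 := (hs.hasSum.mul_right (Complex.exp (-θ j * Complex.I) * F' i j))
    rw [hsum i j] at h1
    have h2 : 1 / (1 + Complex.exp ((θ i - θ j) * Complex.I)) *
        (Complex.exp (-θ j * Complex.I) * F' i j) = M' i j := by
      rw [← hent i j]
      have h3 : Complex.exp (-θ j * Complex.I) *
          (Complex.exp (θ i * Complex.I) + Complex.exp (θ j * Complex.I)) =
          1 + Complex.exp ((θ i - θ j) * Complex.I) := by
        rw [mul_add, ← Complex.exp_add, ← Complex.exp_add, add_comm]
        congr 1
        · rw [← Complex.exp_zero]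
          congr 1
          ring
        · congr 1
          ring
      rw [← mul_assoc (Complex.exp _), h3, ← mul_assoc, one_div, inv_mul_cancel₀ (hθ i j), one_mul]
    rw [h2] at h1
    have h4 : HasSum (fun m => f m i j) (M' i j) := by
      simp only [hent_f]
      exact h1
    exact h4
  have hbound : ∀ s : Finset ℤ, N (∑ m ∈ s, f m) ≤ (∑' m : ℤ, ‖a m‖) * N F' := by
    intro s
    calc N (∑ m ∈ s, f m) ≤ ∑ m ∈ s, N (f m) :=
          Finset.le_sum_of_subadditive N (map_zero N).le (map_add_le_add N) s f
      _ = (∑ m ∈ s, ‖a m‖) * N F' := by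
          rw [Finset.sum_mul]
          refine Finset.sum_congr rfl fun m _ => ?_
          rw [hf, map_smul_eq_mul, hnormc, hN.invariant _ (hV m) _ (hV _)]
      _ ≤ _ := mul_le_mul_of_nonneg_right (ha.sum_le_tsum s fun _ _ => norm_nonneg _)
          (apply_nonneg N F')
  exact le_of_tendsto (((continuous_seminorm N).tendsto M').comp hHas)
    (Filter.Eventually.of_forall hbound)

end

section

/-! ### The derivative of the matrix exponential -/

lemma contDiff_exp (m : WithTop ℕ∞) : ContDiff ℝ m (NormedSpace.exp : CMat n → CMat n) :=
  contDiff_iff_contDiffAt.2 fun x => (NormedSpace.exp_analytic (𝕂 := ℝ) x).contDiffAt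

/-- The Fréchet derivative of the exponential at `x`. -/
def dexp (x : CMat n) : CMat n →L[ℝ] CMat n := fderiv ℝ NormedSpace.exp x

lemma hasFDerivAt_exp (x : CMat n) : HasFDerivAt NormedSpace.exp (dexp x) x :=
  ((contDiff_exp 1).differentiable one_ne_zero x).hasFDerivAt

lemma hasDerivAt_exp_line (x h : CMat n) :
    HasDerivAt (fun t : ℝ => NormedSpace.exp (x + t • h)) (dexp x h) 0 := by
  have h1 : HasDerivAt (fun t : ℝ => x + t • h) h 0 := by
    simpa using ((hasDerivAt_id (0 : ℝ)).smul_const h).const_add x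
  have h2 : HasFDerivAt NormedSpace.exp (dexp x) (x + (0 : ℝ) • h) := by
    simpa using hasFDerivAt_exp x
  exact h2.comp_hasDerivAt 0 h1

/-- Differentiates `σ ∘ exp = exp ∘ σ`; applied to conjugation, transposition and unitary
similarity. -/
lemma map_dexp (σ : CMat n →L[ℝ] CMat n)
    (hσ : ∀ x, σ (NormedSpace.exp x) = NormedSpace.exp (σ x)) (x h : CMat n) :
    σ (dexp x h) = dexp (σ x) (σ h) := by
  have h1 := (σ.hasFDerivAt (x := NormedSpace.exp x)).comp x (hasFDerivAt_exp x)
  have h2 := (hasFDerivAt_exp (σ x)).comp x (σ.hasFDerivAt (x := x))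
  have h3 : (σ ∘ NormedSpace.exp : CMat n → CMat n) = NormedSpace.exp ∘ σ := funext hσ
  rw [h3] at h1
  exact DFunLike.congr_fun (h1.unique h2) h

/-- Entrywise conjugation as a continuous linear map. -/
def conjCLM : CMat n →L[ℝ] CMat n :=
  LinearMap.toContinuousLinearMap
    { toFun := conj
      map_add' := conj_add
      map_smul' := fun r A => by ext; simp }

/-- Transposition as a continuous linear map. -/
def transposeCLM : CMat n →L[ℝ] CMat n :=
  LinearMap.toContinuousLinearMap
    { toFun := Matrix.transpose
      map_add' := Matrix.transpose_add
      map_smul' := fun r A => by ext; simp }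

lemma conj_dexp (x h : CMat n) : conj (dexp x h) = dexp (conj x) (conj h) :=
  map_dexp conjCLM conj_exp x h

lemma transpose_dexp (x h : CMat n) : (dexp x h)ᵀ = dexp xᵀ hᵀ :=
  map_dexp transposeCLM (fun x => (Matrix.exp_transpose x).symm) x h

lemma conjTranspose_dexp (x h : CMat n) : (dexp x h)ᴴ = dexp xᴴ hᴴ := by
  rw [← transpose_conj, conj_dexp, transpose_dexp, transpose_conj, transpose_conj]

lemma isUnit_exp (x : CMat n) : IsUnit (NormedSpace.exp x) := Matrix.isUnit_exp x

lemma exp_neg_mul_exp (x : CMat n) : NormedSpace.exp (-x) * NormedSpace.exp x = 1 := by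
  rw [Matrix.exp_neg]
  exact Matrix.nonsing_inv_mul _ ((Matrix.isUnit_iff_isUnit_det _).1 (isUnit_exp x))

lemma exp_mul_exp_neg (x : CMat n) : NormedSpace.exp x * NormedSpace.exp (-x) = 1 := by
  simpa using exp_neg_mul_exp (-x)

/-- Differentiates `e^{-x} e^x = 1` along a line. It yields the tangent form of `conj Q = Q⁻¹`. -/
lemma dexp_neg (x h : CMat n) :
    dexp (-x) (-h) = -(NormedSpace.exp (-x) * dexp x h * NormedSpace.exp (-x)) := by
  have h1 := hasDerivAt_exp_line x h
  have h2 := hasDerivAt_exp_line (-x) (-h)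
  have h3 := h2.mul h1
  have h4 : ((fun t : ℝ => NormedSpace.exp (-x + t • -h)) * fun t : ℝ => NormedSpace.exp (x + t • h))
      = fun _ => (1 : CMat n) := by
    funext t
    have : -x + t • -h = -(x + t • h) := by simp [add_comm]
    rw [Pi.mul_apply, this, exp_neg_mul_exp]
  rw [h4] at h3
  have h5 := (hasDerivAt_const (0 : ℝ) (1 : CMat n)).unique h3
  simp only [zero_smul, add_zero] at h5
  have h6 : dexp (-x) (-h) * NormedSpace.exp x =
      -(NormedSpace.exp (-x) * dexp x h) := eq_neg_of_add_eq_zero_left h5.symm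
  calc dexp (-x) (-h) = dexp (-x) (-h) * (NormedSpace.exp x * NormedSpace.exp (-x)) := by
        rw [exp_mul_exp_neg, Matrix.mul_one]
    _ = _ := by rw [← Matrix.mul_assoc, h6, Matrix.neg_mul]

lemma dexp_of_commute {x h : CMat n} (hc : Commute x h) :
    dexp x h = NormedSpace.exp x * h := by
  have h1 : HasDerivAt (fun t : ℝ => NormedSpace.exp (x + t • h)) (NormedSpace.exp x * h) 0 := by
    have h2 : (fun t : ℝ => NormedSpace.exp (x + t • h)) =
        fun t : ℝ => NormedSpace.exp x * NormedSpace.exp (t • h) := by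
      funext t
      exact Matrix.exp_add_of_commute x (t • h) (hc.smul_right t)
    rw [h2]
    have := (hasDerivAt_exp_smul_const (𝕂 := ℝ) h 0).const_mul (NormedSpace.exp x)
    simpa using this
  exact (hasDerivAt_exp_line x h).unique h1

/-- The divided difference of the exponential. -/
def expDiff (a b : ℂ) : ℂ :=
  if a = b then Complex.exp a else (Complex.exp a - Complex.exp b) / (a - b)

lemma exp_diagonal' (d : Fin n → ℂ) :
    NormedSpace.exp (Matrix.diagonal d) = Matrix.diagonal fun i => Complex.exp (d i) := by
  rw [Matrix.exp_diagonal]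
  congr 1
  funext i
  simp [← Complex.exp_eq_exp_ℂ]

/-- For `d i = d j` the direction commutes with the diagonal matrix. Otherwise `E² = 0`, and `x +
tE` is conjugate to `x` by `1 + tγE`, so its exponential is affine in `t` and the slope can be read
off. -/
lemma dexp_diagonal_single (d : Fin n → ℂ) (i j : Fin n) (c : ℂ) :
    dexp (Matrix.diagonal d) (Matrix.single i j c) = Matrix.single i j (expDiff (d i) (d j) * c) := by
  set x := Matrix.diagonal d with hx
  set E : CMat n := Matrix.single i j c with hE
  have hl : ∀ v : Fin n → ℂ, Matrix.diagonal v * E = v i • E := fun v => by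
    ext k l
    simp only [hE, Matrix.diagonal_mul, Matrix.smul_apply, Matrix.single_apply, smul_eq_mul]
    split_ifs with h
    · rw [h.1]
    · simp
  have hr : ∀ v : Fin n → ℂ, E * Matrix.diagonal v = v j • E := fun v => by
    ext k l
    simp only [hE, Matrix.mul_diagonal, Matrix.smul_apply, Matrix.single_apply, smul_eq_mul]
    split_ifs with h
    · rw [h.2, mul_comm]
    · simp
  have hres : Matrix.single i j (expDiff (d i) (d j) * c) = expDiff (d i) (d j) • E := by
    rw [hE, Matrix.smul_single, smul_eq_mul]
  rw [hres]
  by_cases hd : d i = d j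
  · rw [dexp_of_commute, hx, exp_diagonal', hl, expDiff, if_pos hd]
    change x * E = E * x
    rw [hx, hl, hr, hd]
  · have hij : i ≠ j := fun h => hd (by rw [h])
    have hEE : E * E = 0 := by
      rw [hE, Matrix.single_mul_single_of_ne _ _ _ _ hij.symm]
    have hd' : d i - d j ≠ 0 := sub_ne_zero.2 hd
    -- Conjugating `x` by `1 + tγE` adds `tγ(d j - d i)E`, which has to be `tE`.
    set γ : ℂ := (d j - d i)⁻¹ with hγ
    have hγ1 : γ * (d j - d i) = 1 := inv_mul_cancel₀ (sub_ne_zero.2 (Ne.symm hd))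
    have key : ∀ t : ℝ, NormedSpace.exp (x + t • E) =
        NormedSpace.exp x + t • (expDiff (d i) (d j) • E) := by
      intro t
      have hinv : (1 + ((t : ℂ) * γ) • E) * (1 - ((t : ℂ) * γ) • E) = 1 := by
        simp [Matrix.add_mul, Matrix.mul_sub, hEE]
      have hinv' : (1 + ((t : ℂ) * γ) • E)⁻¹ = 1 - ((t : ℂ) * γ) • E :=
        Matrix.inv_eq_right_inv hinv
      have hu : IsUnit (1 + ((t : ℂ) * γ) • E) := IsUnit.of_mul_eq_one _ hinv
      have hcomm : ∀ v : Fin n → ℂ, (1 + ((t : ℂ) * γ) • E) * Matrix.diagonal v *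
          (1 - ((t : ℂ) * γ) • E) = Matrix.diagonal v + ((t : ℂ) * γ * (v j - v i)) • E := by
        intro v
        simp only [Matrix.add_mul, Matrix.mul_sub, Matrix.one_mul, Matrix.mul_one, Matrix.smul_mul,
          Matrix.mul_smul, hl, hr, hEE, smul_zero]
        module
      have h1 : x + t • E = (1 + ((t : ℂ) * γ) • E) * x * (1 + ((t : ℂ) * γ) • E)⁻¹ := by
        rw [hinv', hx, hcomm, mul_assoc, hγ1, mul_one, Complex.coe_smul]
      rw [h1, Matrix.exp_conj _ _ hu, hinv', hx, exp_diagonal', hcomm, expDiff, if_neg hd,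
        ← Complex.coe_smul, smul_smul]
      have h2 : (t : ℂ) * γ * (Complex.exp (d j) - Complex.exp (d i)) =
          (t : ℂ) * ((Complex.exp (d i) - Complex.exp (d j)) / (d i - d j)) := by
        rw [hγ, ← neg_sub (d i), inv_neg, div_eq_mul_inv]
        ring
      rw [h2]
    have h1 : HasDerivAt (fun t : ℝ => NormedSpace.exp (x + t • E)) (expDiff (d i) (d j) • E) 0 := by
      rw [funext key]
      simpa using ((hasDerivAt_id (0 : ℝ)).smul_const (expDiff (d i) (d j) • E)).const_add
        (NormedSpace.exp x)
    exact (hasDerivAt_exp_line x E).unique h1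

lemma dexp_diagonal_apply (d : Fin n → ℂ) (h : CMat n) (i j : Fin n) :
    dexp (Matrix.diagonal d) h i j = expDiff (d i) (d j) * h i j := by
  have h1 : dexp (Matrix.diagonal d) h =
      ∑ k, ∑ l, Matrix.single k l (expDiff (d k) (d l) * h k l) := by
    conv_lhs => rw [Matrix.matrix_eq_sum_single h]
    simp only [map_sum, dexp_diagonal_single]
  have h2 := Matrix.matrix_eq_sum_single (Matrix.of fun k l => expDiff (d k) (d l) * h k l)
  simp only [Matrix.of_apply] at h2
  rw [h1, ← h2, Matrix.of_apply]

/-- Conjugation by a unitary matrix as a continuous linear map. -/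
def unitaryConjCLM (U : CMat n) : CMat n →L[ℝ] CMat n :=
  LinearMap.toContinuousLinearMap
    { toFun := fun A => U * A * Uᴴ
      map_add' := fun A B => by rw [Matrix.mul_add, Matrix.add_mul]
      map_smul' := fun r A => by simp }

lemma exp_unitary_conj {U : CMat n} (hU : U ∈ Matrix.unitaryGroup (Fin n) ℂ) (A : CMat n) :
    NormedSpace.exp (U * A * Uᴴ) = U * NormedSpace.exp A * Uᴴ := by
  rw [← unitary_inv hU, Matrix.exp_conj _ _ (unitary_isUnit hU)]

lemma dexp_unitary_conj {U : CMat n} (hU : U ∈ Matrix.unitaryGroup (Fin n) ℂ) (x h : CMat n) :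
    U * dexp x h * Uᴴ = dexp (U * x * Uᴴ) (U * h * Uᴴ) :=
  map_dexp (unitaryConjCLM U) (fun A => (exp_unitary_conj hU A).symm) x h

/-! ### Inverting the derivative of the exponential -/

/-- The strip condition keeps `e^a` off the negative axis, and the slit plane is star-shaped about
`1`. -/
lemma segment_mem_slitPlane {a : ℂ} (ha : |a.im| < Real.pi) {t : ℝ} (ht : t ∈ Set.Icc (0 : ℝ) 1) :
    (t : ℂ) * (Complex.exp a - 1) + 1 ∈ Complex.slitPlane := by
  have h1 : Complex.exp a ∈ Complex.slitPlane := by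
    rw [Complex.mem_slitPlane_iff_arg]
    refine ⟨?_, Complex.exp_ne_zero a⟩
    obtain ⟨h1, h2⟩ := abs_lt.1 ha
    rw [← Complex.log_im, Complex.log_exp h1 h2.le]
    exact h2.ne
  have h2 := Complex.starConvex_one_slitPlane h1 (sub_nonneg.2 ht.2) ht.1 (by ring)
  convert h2 using 1
  simp
  ring

lemma hasDerivAt_affine (w : ℂ) (t : ℝ) :
    HasDerivAt (fun t : ℝ => (t : ℂ) * (w - 1) + 1) (w - 1) t := by
  have := ((hasDerivAt_id t).ofReal_comp.mul_const (w - 1)).add_const 1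
  simpa using this

lemma continuous_affine (w : ℂ) : Continuous fun t : ℝ => (t : ℂ) * (w - 1) + 1 := by fun_prop

/-- Up to the factor `e^a - e^b` the integrand is the derivative of a difference of logarithms, so
the integral is `(a - b)/(e^a - e^b)`, the reciprocal of the divided difference. -/
lemma integral_resolvent_mul_expDiff {a b : ℂ} (ha : |a.im| < Real.pi) (hb : |b.im| < Real.pi) :
    (∫ t in (0 : ℝ)..1, ((t : ℂ) * (Complex.exp a - 1) + 1)⁻¹ *
      ((t : ℂ) * (Complex.exp b - 1) + 1)⁻¹) * expDiff a b = 1 := by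
  have hlog : ∀ {c : ℂ}, |c.im| < Real.pi → Complex.log (Complex.exp c) = c := fun hc =>
    Complex.log_exp (abs_lt.1 hc).1 (abs_lt.1 hc).2.le
  have hne : ∀ {c : ℂ}, |c.im| < Real.pi → ∀ t ∈ Set.Icc (0 : ℝ) 1,
      (t : ℂ) * (Complex.exp c - 1) + 1 ≠ 0 := fun hc t ht =>
    Complex.slitPlane_ne_zero (segment_mem_slitPlane hc ht)
  have hcont : ContinuousOn (fun t : ℝ => ((t : ℂ) * (Complex.exp a - 1) + 1)⁻¹ *
      ((t : ℂ) * (Complex.exp b - 1) + 1)⁻¹) (Set.uIcc (0 : ℝ) 1) := by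
    rw [Set.uIcc_of_le zero_le_one]
    exact ((continuous_affine _).continuousOn.inv₀ (hne ha)).mul
      ((continuous_affine _).continuousOn.inv₀ (hne hb))
  by_cases hab : a = b
  -- In the confluent case an antiderivative is `t / (t (e^a - 1) + 1)`.
  · subst hab
    have hd : ∀ t ∈ Set.uIcc (0 : ℝ) 1, HasDerivAt
        (fun t : ℝ => (t : ℂ) * ((t : ℂ) * (Complex.exp a - 1) + 1)⁻¹)
        (((t : ℂ) * (Complex.exp a - 1) + 1)⁻¹ * ((t : ℂ) * (Complex.exp a - 1) + 1)⁻¹) t := by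
      intro t ht
      rw [Set.uIcc_of_le zero_le_one] at ht
      have h0 := hne ha t ht
      have := (hasDerivAt_id t).ofReal_comp.mul ((hasDerivAt_affine (Complex.exp a) t).inv h0)
      refine this.congr_deriv ?_
      simp only [id, Pi.inv_apply, Complex.ofReal_one]
      field_simp
      ring
    rw [intervalIntegral.integral_eq_sub_of_hasDerivAt hd hcont.intervalIntegrable, expDiff,
      if_pos rfl]
    simp [Complex.exp_ne_zero]
  · have hd : ∀ t ∈ Set.uIcc (0 : ℝ) 1, HasDerivAt
        (fun t : ℝ => Complex.log ((t : ℂ) * (Complex.exp a - 1) + 1) -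
          Complex.log ((t : ℂ) * (Complex.exp b - 1) + 1))
        ((((t : ℂ) * (Complex.exp a - 1) + 1)⁻¹ * ((t : ℂ) * (Complex.exp b - 1) + 1)⁻¹) *
          (Complex.exp a - Complex.exp b)) t := by
      intro t ht
      rw [Set.uIcc_of_le zero_le_one] at ht
      have ha0 := hne ha t ht
      have hb0 := hne hb t ht
      have h1 := (hasDerivAt_affine (Complex.exp a) t).clog_real (segment_mem_slitPlane ha ht)
      have h2 := (hasDerivAt_affine (Complex.exp b) t).clog_real (segment_mem_slitPlane hb ht)
      refine (h1.sub h2).congr_deriv ?_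
      rw [div_sub_div _ _ ha0 hb0, ← mul_inv, div_eq_inv_mul]
      congr 1
      ring
    have h1 := intervalIntegral.integral_eq_sub_of_hasDerivAt hd
      (hcont.mul continuousOn_const).intervalIntegrable
    rw [intervalIntegral.integral_mul_const] at h1
    rw [expDiff, if_neg hab, ← mul_div_assoc, h1]
    simp only [Complex.ofReal_one, one_mul, sub_add_cancel, Complex.ofReal_zero, zero_mul, zero_add,
      Complex.log_one, sub_self, sub_zero, hlog ha, hlog hb]
    exact div_self (sub_ne_zero.2 hab)

lemma resolvent_diagonal {w : Fin n → ℂ} {t : ℝ} (h : ∀ i, (t : ℂ) * (w i - 1) + 1 ≠ 0) :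
    (t • (Matrix.diagonal w - 1) + 1 : CMat n)⁻¹ =
      Matrix.diagonal fun i => ((t : ℂ) * (w i - 1) + 1)⁻¹ := by
  apply Matrix.inv_eq_left_inv
  have : (t • (Matrix.diagonal w - 1) + 1 : CMat n) =
      Matrix.diagonal fun i => (t : ℂ) * (w i - 1) + 1 := by
    ext i j
    by_cases hij : i = j <;> simp [Matrix.diagonal, hij]
  rw [this, Matrix.diagonal_mul_diagonal, ← Matrix.diagonal_one]
  congr 1
  funext i
  exact inv_mul_cancel₀ (h i)

lemma norm_resolvent_unitary_conj {U : CMat n} (hU : U ∈ Matrix.unitaryGroup (Fin n) ℂ)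
    (D : CMat n) (t : ℝ) :
    ‖(t • (U * D * Uᴴ - 1) + 1)⁻¹‖ = ‖(t • (D - 1) + 1)⁻¹‖ := by
  have h1 : t • (U * D * Uᴴ - 1) + 1 = U * (t • (D - 1) + 1) * Uᴴ := by
    have h := unitary_mul_conjTranspose hU
    simp only [Matrix.mul_add, Matrix.add_mul, Matrix.mul_smul, Matrix.smul_mul, Matrix.mul_sub,
      Matrix.sub_mul, Matrix.mul_one, h]
  rw [h1, Matrix.mul_inv_rev, Matrix.mul_inv_rev, unitary_inv hU,
    unitary_inv (unitary_conjTranspose_mem hU), Matrix.conjTranspose_conjTranspose,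
    ← Matrix.mul_assoc, norm_conj_rdiag hU]

namespace IsUnitarilyInvariantNorm

variable {N : Seminorm ℂ (CMat n)}

/-- A bound for the inverse of the derivative of the exponential at a normal matrix with spectrum
in the strip `|Im z| < π`, by means of the integral representation of the logarithm. -/
lemma le_integral_resolvent_mul_dexp (hN : IsUnitarilyInvariantNorm N) {U : CMat n}
    (hU : U ∈ Matrix.unitaryGroup (Fin n) ℂ) {d : Fin n → ℂ} (hd : ∀ i, |(d i).im| < Real.pi)
    {x : CMat n} (hx : x = U * Matrix.diagonal d * Uᴴ) (h : CMat n) :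
    N h ≤ (∫ t in (0 : ℝ)..1, ‖(t • (NormedSpace.exp x - 1) + 1)⁻¹‖ ^ 2) * N (dexp x h) := by
  have hne : ∀ i, ∀ t ∈ Set.Icc (0 : ℝ) 1, (t : ℂ) * (Complex.exp (d i) - 1) + 1 ≠ 0 :=
    fun i t ht => Complex.slitPlane_ne_zero (segment_mem_slitPlane (hd i) ht)
  set h' := Uᴴ * h * U with hh'
  set D : ℝ → CMat n := fun t => Matrix.diagonal fun i => ((t : ℂ) * (Complex.exp (d i) - 1) + 1)⁻¹
    with hD
  set k := dexp (Matrix.diagonal d) h' with hk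
  have hNh : N h' = N h := hN.invariant _ (unitary_conjTranspose_mem hU) _ hU _
  have hNk : N k = N (dexp x h) := by
    rw [← hN.invariant U hU _ (unitary_conjTranspose_mem hU) k, hk, dexp_unitary_conj hU, ← hx, hh',
      conj_cancel hU]
  have hexp : NormedSpace.exp x = U * Matrix.diagonal (fun i => Complex.exp (d i)) * Uᴴ := by
    rw [hx, exp_unitary_conj hU, exp_diagonal']
  have hint : (∫ t in (0 : ℝ)..1, ‖(t • (NormedSpace.exp x - 1) + 1)⁻¹‖ ^ 2) =
      ∫ t in (0 : ℝ)..1, ‖D t‖ ^ 2 := by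
    refine intervalIntegral.integral_congr fun t ht => ?_
    rw [Set.uIcc_of_le zero_le_one] at ht
    rw [hexp, norm_resolvent_unitary_conj hU, resolvent_diagonal fun i => hne i t ht]
  have hDc : ContinuousOn D (Set.uIcc 0 1) := by
    rw [Set.uIcc_of_le zero_le_one]
    have : ContinuousOn (fun (t : ℝ) (i : Fin n) => ((t : ℂ) * (Complex.exp (d i) - 1) + 1)⁻¹)
        (Set.Icc 0 1) :=
      continuousOn_pi.2 fun i => (continuous_affine _).continuousOn.inv₀ (hne i)
    exact (Continuous.matrix_diagonal continuous_id).comp_continuousOn this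
  have hf : IntervalIntegrable (fun t => D t * k * D t) MeasureTheory.volume 0 1 :=
    ((hDc.mul continuousOn_const).mul hDc).intervalIntegrable
  have hg : IntervalIntegrable (fun t => ‖D t‖ ^ 2 * N k) MeasureTheory.volume 0 1 :=
    ((hDc.norm.pow 2).mul continuousOn_const).intervalIntegrable
  -- In the eigenbasis the derivative of `exp` multiplies the `(i, j)` entry by a divided
  -- difference, and integrating `D t * k * D t` divides by it again.
  have hval : ∫ t in (0 : ℝ)..1, D t * k * D t = h' := by
    ext i j
    have hentry : Continuous fun A : CMat n => A i j := by fun_prop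
    let φ : CMat n →L[ℝ] ℂ := LinearMap.toContinuousLinearMap
      { toFun := fun A => A i j, map_add' := fun _ _ => rfl, map_smul' := fun _ _ => rfl }
    have h1 := φ.intervalIntegral_comp_comm hf
    have h2 : ∀ t, φ (D t * k * D t) = (((t : ℂ) * (Complex.exp (d i) - 1) + 1)⁻¹ *
        ((t : ℂ) * (Complex.exp (d j) - 1) + 1)⁻¹) * (expDiff (d i) (d j) * h' i j) := by
      intro t
      change (D t * k * D t) i j = _
      simp only [hD, Matrix.mul_diagonal, Matrix.diagonal_mul, hk, dexp_diagonal_apply]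
      ring
    simp only [h2] at h1
    rw [intervalIntegral.integral_mul_const, ← mul_assoc,
      integral_resolvent_mul_expDiff (hd i) (hd j), one_mul] at h1
    exact h1.symm
  rw [← hNh, ← hNk, hint, ← hval, ← intervalIntegral.integral_mul_const,
    intervalIntegral.integral_of_le zero_le_one, intervalIntegral.integral_of_le zero_le_one]
  refine seminorm_integral_le N hf.1 hg.1 fun t => ?_
  calc _ ≤ ‖D t‖ * N k * ‖D t‖ := hN.mul_mul_le _ _ _
    _ = _ := by ring

end IsUnitarilyInvariantNorm

/-- An antiderivative is `t / (1 - t + t/s)`. With `s = ‖e^{-x}‖` this collapses the resolvent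
integral to `s` in the Hermitian case. -/
lemma integral_inv_affine_sq {s : ℝ} (hs : 0 < s) :
    ∫ t in (0 : ℝ)..1, ((1 - t + t / s)⁻¹) ^ 2 = s := by
  have hne : ∀ t ∈ Set.uIcc (0 : ℝ) 1, 0 < 1 - t + t / s := by
    intro t ht
    rw [Set.uIcc_of_le zero_le_one] at ht
    rcases ht.2.eq_or_lt with rfl | h1
    · simp [hs]
    · have : 0 ≤ t / s := div_nonneg ht.1 hs.le
      linarith
  have hd : ∀ t ∈ Set.uIcc (0 : ℝ) 1, HasDerivAt (fun t : ℝ => t * (1 - t + t / s)⁻¹)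
      (((1 - t + t / s)⁻¹) ^ 2) t := by
    intro t ht
    have h1 : HasDerivAt (fun t : ℝ => 1 - t + t / s) (-1 + 1 / s) t := by
      simpa using! ((hasDerivAt_id t).const_sub 1).add ((hasDerivAt_id t).div_const s)
    have h2 := (hasDerivAt_id t).mul (h1.inv (hne t ht).ne')
    refine h2.congr_deriv ?_
    have := (hne t ht).ne'
    simp only [id, Pi.inv_apply]
    field_simp
    ring
  have hc : ContinuousOn (fun t : ℝ => ((1 - t + t / s)⁻¹) ^ 2) (Set.uIcc 0 1) :=
    (ContinuousOn.inv₀ (by fun_prop) fun t ht => (hne t ht).ne').pow 2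
  rw [intervalIntegral.integral_eq_sub_of_hasDerivAt hd hc.intervalIntegrable]
  simp

/-- The eigenvalues of `e^x` are at least `1/s` with `s = ‖e^{-x}‖`, so the resolvents are bounded
by `(1 - t + t/s)⁻¹`, whose square integrates to `s`. -/
lemma IsUnitarilyInvariantNorm.le_norm_exp_neg_mul_dexp {N : Seminorm ℂ (CMat n)}
    (hN : IsUnitarilyInvariantNorm N) {x : CMat n} (hx : x.IsHermitian) (h : CMat n) :
    N h ≤ ‖NormedSpace.exp (-x)‖ * N (dexp x h) := by
  obtain ⟨U, hU, d, -, hd⟩ := exists_diagonalization hx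
  have him : ∀ i, |((d i : ℂ)).im| < Real.pi := fun i => by simp [Real.pi_pos]
  refine (hN.le_integral_resolvent_mul_dexp hU him hd h).trans
    (mul_le_mul_of_nonneg_right ?_ (apply_nonneg N _))
  have hexp : NormedSpace.exp x = U * rdiag (fun i => Real.exp (d i)) * Uᴴ := by
    rw [hd, exp_unitary_conj hU, exp_rdiag]
  have hexpn : NormedSpace.exp (-x) = U * rdiag (fun i => Real.exp (-d i)) * Uᴴ := by
    have h1 : rdiag (fun i => -d i) = -rdiag d := by
      rw [rdiag, rdiag, Matrix.diagonal_neg]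
      congr 1
      funext i
      simp
    have h2 : -x = U * rdiag (fun i => -d i) * Uᴴ := by
      rw [hd, h1, Matrix.mul_neg, Matrix.neg_mul]
    rw [h2, exp_unitary_conj hU, exp_rdiag]
  rcases isEmpty_or_nonempty (Fin n) with he | ⟨⟨i₀⟩⟩
  · have h0 : ∀ A : CMat n, ‖A‖ = 0 := fun A => by rw [Subsingleton.elim A 0, norm_zero]
    simp [h0]
  set s := ‖NormedSpace.exp (-x)‖ with hs
  have hle : ∀ i, Real.exp (-d i) ≤ s := fun i => by
    rw [hs, hexpn, norm_conj_rdiag hU]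
    have := (norm_rdiag_le_iff (norm_nonneg (rdiag fun i => Real.exp (-d i)))).1 le_rfl i
    exact (le_abs_self _).trans this
  have hs0 : 0 < s := (Real.exp_pos _).trans_le (hle i₀)
  have hpos : ∀ t ∈ Set.Icc (0 : ℝ) 1, 0 < 1 - t + t / s := by
    intro t ht
    rcases ht.2.eq_or_lt with rfl | h1
    · simp [hs0]
    · have : 0 ≤ t / s := div_nonneg ht.1 hs0.le
      linarith
  have hres : ∀ t ∈ Set.Icc (0 : ℝ) 1,
      ‖(t • (NormedSpace.exp x - 1) + 1 : CMat n)⁻¹‖ ≤ (1 - t + t / s)⁻¹ := by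
    intro t ht
    have hge : ∀ i, 1 - t + t / s ≤ t * (Real.exp (d i) - 1) + 1 := by
      intro i
      have h1 : 1 / s ≤ Real.exp (d i) := by
        have := hle i
        rw [Real.exp_neg] at this
        rw [one_div]
        exact inv_le_of_inv_le₀ (Real.exp_pos _) this
      have h2 : t / s = t * (1 / s) := by ring
      nlinarith [ht.1]
    have hcast : ∀ i, (t : ℂ) * (Real.exp (d i) - 1) + 1 =
        ((t * (Real.exp (d i) - 1) + 1 : ℝ) : ℂ) := fun i => by push_cast; ring
    rw [hexp, norm_resolvent_unitary_conj hU, resolvent_diagonal]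
    · have h3 : (Matrix.diagonal fun i => ((t : ℂ) * (Real.exp (d i) - 1) + 1)⁻¹ : CMat n) =
          rdiag fun i => (t * (Real.exp (d i) - 1) + 1)⁻¹ := by
        rw [rdiag]
        congr 1
        funext i
        rw [hcast, Complex.ofReal_inv]
      rw [h3, norm_rdiag_le_iff (inv_pos.2 (hpos t ht)).le]
      intro i
      rw [abs_of_pos (inv_pos.2 ((hpos t ht).trans_le (hge i)))]
      exact inv_anti₀ (hpos t ht) (hge i)
    · intro i
      rw [hcast]
      exact_mod_cast ((hpos t ht).trans_le (hge i)).ne'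
  have hc : ContinuousOn (fun t : ℝ => ((1 - t + t / s)⁻¹) ^ 2) (Set.uIcc 0 1) := by
    rw [Set.uIcc_of_le zero_le_one]
    exact (ContinuousOn.inv₀ (by fun_prop) fun t ht => (hpos t ht).ne').pow 2
  refine (le_abs_self _).trans ?_
  rw [← Real.norm_eq_abs]
  refine (intervalIntegral.norm_integral_le_of_norm_le zero_le_one
    (Filter.Eventually.of_forall fun t ht => ?_) hc.intervalIntegrable).trans
    (integral_inv_affine_sq hs0).le
  rw [norm_pow, norm_norm]
  gcongr
  exact hres t (Set.Ioc_subset_Icc_self ht)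

end

section

/-! ### Norms of the factors of Mostow's decomposition -/

lemma posDef_mul_inv {B : CMat n} (hB : B.PosDef) : B * B⁻¹ = 1 :=
  Matrix.mul_nonsing_inv B ((Matrix.isUnit_iff_isUnit_det _).1 hB.isUnit)

lemma posDef_inv_mul {B : CMat n} (hB : B.PosDef) : B⁻¹ * B = 1 :=
  Matrix.nonsing_inv_mul B ((Matrix.isUnit_iff_isUnit_det _).1 hB.isUnit)

lemma posDef_inv_inv {B : CMat n} (hB : B.PosDef) : B⁻¹⁻¹ = B :=
  Matrix.nonsing_inv_nonsing_inv B ((Matrix.isUnit_iff_isUnit_det _).1 hB.isUnit)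

lemma norm_mul_self_of_isHermitian {B : CMat n} (hB : B.IsHermitian) : ‖B * B‖ = ‖B‖ * ‖B‖ := by
  have := Matrix.l2_opNorm_conjTranspose_mul_self B
  rwa [hB.eq] at this

/-- The factors of Mostow's decomposition `Z = U Q Y` with `U` unitary, `Q = e^{iK}`, `Y = e^S`. -/
structure IsMostow (U Q Y : CMat n) : Prop where
  unitary : U ∈ Matrix.unitaryGroup (Fin n) ℂ
  posQ : Q.PosDef
  posY : Y.PosDef
  conjQ : conj Q = Q⁻¹
  conjY : conj Y = Y

namespace IsMostow

variable {U Q Y : CMat n}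

lemma conjInvQ (h : IsMostow U Q Y) : conj Q⁻¹ = Q := by rw [← h.conjQ, conj_conj]

lemma conjInvY (h : IsMostow U Q Y) : conj Y⁻¹ = Y⁻¹ := by rw [conj_inv, h.conjY]

lemma norm_eq (h : IsMostow U Q Y) : ‖U * Q * Y‖ = ‖Q * Y‖ := by
  rw [Matrix.mul_assoc, norm_unitary_mul h.unitary]

lemma inv_eq (h : IsMostow U Q Y) : (U * Q * Y)⁻¹ = Y⁻¹ * Q⁻¹ * Uᴴ := by
  rw [Matrix.mul_inv_rev, Matrix.mul_inv_rev, unitary_inv h.unitary, Matrix.mul_assoc]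

lemma norm_inv_eq (h : IsMostow U Q Y) : ‖(U * Q * Y)⁻¹‖ = ‖Y⁻¹ * Q⁻¹‖ := by
  rw [h.inv_eq, norm_mul_unitary (unitary_conjTranspose_mem h.unitary)]

lemma norm_invQ (h : IsMostow U Q Y) : ‖Q⁻¹‖ = ‖Q‖ := by rw [← h.conjQ, norm_conj]

lemma norm_invQ_mul_Y (h : IsMostow U Q Y) : ‖Q⁻¹ * Y‖ = ‖Q * Y‖ := by
  rw [← norm_conj, conj_mul, h.conjInvQ, h.conjY]

lemma norm_Y_mul_invQ (h : IsMostow U Q Y) : ‖Y * Q⁻¹‖ = ‖Q * Y‖ := by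
  rw [← Matrix.l2_opNorm_conjTranspose, Matrix.conjTranspose_mul, h.posY.isHermitian.eq,
    h.posQ.inv.isHermitian.eq, h.norm_invQ_mul_Y]

lemma norm_invY_mul_Q (h : IsMostow U Q Y) : ‖Y⁻¹ * Q‖ = ‖Y⁻¹ * Q⁻¹‖ := by
  rw [← norm_conj, conj_mul, h.conjQ, h.conjInvY]

lemma norm_Q_mul_invY (h : IsMostow U Q Y) : ‖Q * Y⁻¹‖ = ‖Y⁻¹ * Q⁻¹‖ := by
  rw [← Matrix.l2_opNorm_conjTranspose, Matrix.conjTranspose_mul, h.posQ.isHermitian.eq,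
    h.posY.inv.isHermitian.eq, h.norm_invY_mul_Q]

/-- Conjugation exchanges `Q` and `Q⁻¹` and fixes `Y`, so both factors in `Y² = (Y Q⁻¹)(Q Y)` have
the norm of `Q Y`. -/
lemma norm_Y_le (h : IsMostow U Q Y) : ‖Y‖ ≤ ‖Q * Y‖ := by
  have h1 : Y * Y = (Y * Q⁻¹) * (Q * Y) := by
    calc Y * Y = Y * (Q⁻¹ * Q) * Y := by rw [posDef_inv_mul h.posQ, Matrix.mul_one]
      _ = _ := by simp only [Matrix.mul_assoc]
  have h2 := norm_mul_self_of_isHermitian h.posY.isHermitian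
  have h3 := norm_mul_le (Y * Q⁻¹) (Q * Y)
  rw [← h1, h2, h.norm_Y_mul_invQ] at h3
  exact abs_le_of_sq_le_sq' (by nlinarith) (norm_nonneg _) |>.2

lemma norm_invY_le (h : IsMostow U Q Y) : ‖Y⁻¹‖ ≤ ‖Y⁻¹ * Q⁻¹‖ := by
  have h1 : Y⁻¹ * Y⁻¹ = (Y⁻¹ * Q⁻¹) * (Q * Y⁻¹) := by
    calc Y⁻¹ * Y⁻¹ = Y⁻¹ * (Q⁻¹ * Q) * Y⁻¹ := by rw [posDef_inv_mul h.posQ, Matrix.mul_one]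
      _ = _ := by simp only [Matrix.mul_assoc]
  have h2 := norm_mul_self_of_isHermitian h.posY.inv.isHermitian
  have h3 := norm_mul_le (Y⁻¹ * Q⁻¹) (Q * Y⁻¹)
  rw [← h1, h2, h.norm_Q_mul_invY] at h3
  exact abs_le_of_sq_le_sq' (by nlinarith) (norm_nonneg _) |>.2

lemma cond_eq (h : IsMostow U Q Y) : cond (U * Q * Y) = ‖Q * Y‖ * ‖Y⁻¹ * Q⁻¹‖ := by
  rw [← h.norm_eq, ← h.norm_inv_eq]
  rfl

lemma cond_Y_le (h : IsMostow U Q Y) : ‖Y‖ * ‖Y⁻¹‖ ≤ cond (U * Q * Y) := by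
  rw [h.cond_eq]
  exact mul_le_mul h.norm_Y_le h.norm_invY_le (norm_nonneg _) (norm_nonneg _)

lemma norm_Q_le (h : IsMostow U Q Y) : ‖Q‖ ≤ cond (U * Q * Y) := by
  rw [h.cond_eq]
  have h1 : Q = Q * Y * Y⁻¹ := by rw [Matrix.mul_assoc, posDef_mul_inv h.posY, Matrix.mul_one]
  calc ‖Q‖ = ‖Q * Y * Y⁻¹‖ := by rw [← h1]
    _ ≤ ‖Q * Y‖ * ‖Y⁻¹‖ := norm_mul_le _ _
    _ ≤ _ := mul_le_mul_of_nonneg_left h.norm_invY_le (norm_nonneg _)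

lemma one_le_norm_Q [NeZero n] (h : IsMostow U Q Y) : 1 ≤ ‖Q‖ := by
  have h1 := norm_mul_le Q Q⁻¹
  rw [posDef_mul_inv h.posQ, h.norm_invQ, CStarRing.norm_one] at h1
  nlinarith [norm_nonneg Q]

/-- The matrix `(P⁻¹ P̄)^{1/2}` for `P = Z* Z`, in terms of the factors of `Z = U Q Y`. -/
def sqrtFactor (Q Y : CMat n) : CMat n := Y⁻¹ * (Q⁻¹ * Q⁻¹) * Y

lemma norm_sqrtFactor_le (h : IsMostow U Q Y) : ‖sqrtFactor Q Y‖ ≤ cond (U * Q * Y) := by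
  have h1 : sqrtFactor Q Y = (Y⁻¹ * Q⁻¹) * (Q⁻¹ * Y) := by
    simp only [sqrtFactor, Matrix.mul_assoc]
  rw [h.cond_eq, h1, ← h.norm_invQ_mul_Y, mul_comm ‖Q⁻¹ * Y‖]
  exact norm_mul_le _ _

lemma conjTranspose_sqrtFactor (h : IsMostow U Q Y) :
    (sqrtFactor Q Y)ᴴ = Y * (Q⁻¹ * Q⁻¹) * Y⁻¹ := by
  simp only [sqrtFactor, Matrix.conjTranspose_mul, h.posY.isHermitian.eq,
    h.posY.inv.isHermitian.eq, h.posQ.inv.isHermitian.eq, Matrix.mul_assoc]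

lemma isSimilarPos_sqrtFactor (h : IsMostow U Q Y) : IsSimilarPos (sqrtFactor Q Y) := by
  obtain ⟨V, hV, d, hd, hQ⟩ := PosDef.exists_diagonalization h.posQ.inv
  refine ⟨Y⁻¹ * V, h.posY.inv.isUnit.mul (unitary_isUnit hV), fun i => d i * d i,
    fun i => mul_pos (hd i) (hd i), ?_⟩
  rw [sqrtFactor, Matrix.mul_inv_rev, posDef_inv_inv h.posY, unitary_inv hV, hQ,
    ← rdiag_mul_rdiag]
  have h1 : V * rdiag d * Vᴴ * (V * rdiag d * Vᴴ) = V * (rdiag d * rdiag d) * Vᴴ := by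
    calc _ = V * rdiag d * (Vᴴ * V) * rdiag d * Vᴴ := by simp only [Matrix.mul_assoc]
      _ = _ := by
        rw [unitary_conjTranspose_mul hV, Matrix.mul_one]
        simp only [Matrix.mul_assoc]
  rw [h1]
  simp only [Matrix.mul_assoc]

/-- The integral `∫₀^∞ ‖e^{-tA}‖² dt`. -/
def decayIntegral (A : CMat n) : ℝ :=
  ∫ t in Set.Ioi (0 : ℝ), ‖NormedSpace.exp (-(t • A))‖ ^ 2

/-- Test `sylvester_le` on `P = Y Q² Y`: then `P A + A* P = 2 Y²`, while `‖P‖ = ‖Q Y‖² ≥ ‖Y‖²`. -/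
lemma half_le_decayIntegral [NeZero n] (h : IsMostow U Q Y) :
    1 / 2 ≤ decayIntegral (sqrtFactor Q Y) := by
  have h1 := isUnitarilyInvariantNorm_normSeminorm.sylvester_le h.isSimilarPos_sqrtFactor
    (Y * (Q * Q) * Y)
  have h2 : Y * (Q * Q) * Y * sqrtFactor Q Y + (sqrtFactor Q Y)ᴴ * (Y * (Q * Q) * Y) =
      (2 : ℂ) • (Y * Y) := by
    have e1 : ∀ X, Y * (Y⁻¹ * X) = X := fun X => by
      rw [← Matrix.mul_assoc, posDef_mul_inv h.posY, Matrix.one_mul]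
    have e2 : ∀ X, Y⁻¹ * (Y * X) = X := fun X => by
      rw [← Matrix.mul_assoc, posDef_inv_mul h.posY, Matrix.one_mul]
    have e3 : ∀ X, Q * (Q⁻¹ * X) = X := fun X => by
      rw [← Matrix.mul_assoc, posDef_mul_inv h.posQ, Matrix.one_mul]
    have e4 : ∀ X, Q⁻¹ * (Q * X) = X := fun X => by
      rw [← Matrix.mul_assoc, posDef_inv_mul h.posQ, Matrix.one_mul]
    rw [h.conjTranspose_sqrtFactor, sqrtFactor]
    simp only [Matrix.mul_assoc, e1, e2, e3, e4]
    module
  rw [h2] at h1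
  simp only [coe_normSeminorm] at h1
  change _ ≤ decayIntegral (sqrtFactor Q Y) * _ at h1
  rw [norm_smul, norm_mul_self_of_isHermitian h.posY.isHermitian] at h1
  have h3 : ‖Y * (Q * Q) * Y‖ = ‖Q * Y‖ * ‖Q * Y‖ := by
    rw [← Matrix.l2_opNorm_conjTranspose_mul_self, Matrix.conjTranspose_mul,
      h.posQ.isHermitian.eq, h.posY.isHermitian.eq]
    simp only [Matrix.mul_assoc]
  have hY : 0 < ‖Y‖ := norm_pos_iff.2 h.posY.isUnit.ne_zero
  have hnn : 0 ≤ decayIntegral (sqrtFactor Q Y) :=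
    MeasureTheory.integral_nonneg fun t => by positivity
  rw [h3] at h1
  have h4 := h.norm_Y_le
  have h5 : ‖(2 : ℂ)‖ = 2 := by simp
  rw [h5] at h1
  by_contra hlt
  push Not at hlt
  nlinarith [mul_pos hY hY, mul_le_mul h4 h4 hY.le (norm_nonneg _)]

end IsMostow

/-! ### Tangent vectors to Mostow's decomposition -/

/-- Tangent vectors at the factors `U`, `Q`, `Y` of Mostow's decomposition; the tangent vector at
the unitary factor is `U Ω`. -/
structure IsMostowTangent (Q Ω dQ dY : CMat n) : Prop where
  skew : Ωᴴ = -Ω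
  hermQ : dQᴴ = dQ
  hermY : dYᴴ = dY
  conj_dQ : conj dQ = -(Q⁻¹ * dQ * Q⁻¹)
  conj_dY : conj dY = dY

/-- The derivative of the product `U Q Y`. -/
def mostowDeriv (U Q Y Ω dQ dY : CMat n) : CMat n := U * (Ω * Q * Y + dQ * Y + Q * dY)

namespace IsUnitarilyInvariantNorm

variable {N : Seminorm ℂ (CMat n)}

/-- The expression vanishes for scalar `B` and `C`. Splitting both at their centres removes the
product of the centres from the trivial bound `2‖B‖‖C‖`. -/
lemma norm_mul_sub_mul_le (hN : IsUnitarilyInvariantNorm N) {B C : CMat n} (hB : B.PosDef)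
    (hC : C.PosDef) (M : CMat n) :
    N (B * M * C - C * M * B) ≤ 2 * (‖B‖ * ‖C‖ - center B * center C) * N M := by
  have hB' := norm_sub_center_le hB
  have hC' := norm_sub_center_le hC
  set B' := B - (center B : ℂ) • (1 : CMat n) with hdB
  set C' := C - (center C : ℂ) • (1 : CMat n) with hdC
  have hb0 : 0 ≤ center B := by rw [center]; positivity
  have hc0 : 0 ≤ center C := by rw [center]; positivity
  have h1 : B * M * C - C * M * B = (center B : ℂ) • (M * C' - C' * M) +
      (center C : ℂ) • (B' * M - M * B') + (B' * M * C' - C' * M * B') := by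
    have eB : B = B' + (center B : ℂ) • (1 : CMat n) := by rw [hdB]; abel
    have eC : C = C' + (center C : ℂ) • (1 : CMat n) := by rw [hdC]; abel
    generalize center B = b at *
    generalize center C = c at *
    rw [eB, eC]
    simp only [Matrix.add_mul, Matrix.mul_add, Matrix.smul_mul, Matrix.mul_smul, Matrix.one_mul,
      Matrix.mul_one]
    module
  have hM := apply_nonneg N M
  have h2 : N ((center B : ℂ) • (M * C' - C' * M)) ≤ center B * (2 * ‖C'‖ * N M) := by
    rw [map_smul_eq_mul, Complex.norm_real, Real.norm_of_nonneg hb0]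
    refine mul_le_mul_of_nonneg_left ?_ hb0
    have := map_sub_le_add N (M * C') (C' * M)
    linarith [hN.mul_le_left C' M, hN.mul_le_right M C']
  have h3 : N ((center C : ℂ) • (B' * M - M * B')) ≤ center C * (2 * ‖B'‖ * N M) := by
    rw [map_smul_eq_mul, Complex.norm_real, Real.norm_of_nonneg hc0]
    refine mul_le_mul_of_nonneg_left ?_ hc0
    have := map_sub_le_add N (B' * M) (M * B')
    linarith [hN.mul_le_left B' M, hN.mul_le_right M B']
  have h4 : N (B' * M * C' - C' * M * B') ≤ 2 * (‖B'‖ * ‖C'‖) * N M := by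
    have := map_sub_le_add N (B' * M * C') (C' * M * B')
    linarith [hN.mul_mul_le B' M C', hN.mul_mul_le C' M B']
  have h5 : N (B * M * C - C * M * B) ≤
      2 * (center B * ‖C'‖ + center C * ‖B'‖ + ‖B'‖ * ‖C'‖) * N M := by
    rw [h1]
    have h6 := map_add_le_add N ((center B : ℂ) • (M * C' - C' * M) +
      (center C : ℂ) • (B' * M - M * B')) (B' * M * C' - C' * M * B')
    have h7 := map_add_le_add N ((center B : ℂ) • (M * C' - C' * M))
      ((center C : ℂ) • (B' * M - M * B'))
    linarith
  refine h5.trans (mul_le_mul_of_nonneg_right ?_ hM)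
  have hB2 : ‖B'‖ ≤ ‖B‖ - center B := by
    rw [center]
    linarith
  have hC2 : ‖C'‖ ≤ ‖C‖ - center C := by
    rw [center]
    linarith
  nlinarith [norm_nonneg B', norm_nonneg C', mul_le_mul hB2 hC2 (norm_nonneg _)
    ((norm_nonneg _).trans hB2), mul_le_mul_of_nonneg_left hC2 hb0,
    mul_le_mul_of_nonneg_left hB2 hc0]

lemma norm_commutator_le (hN : IsUnitarilyInvariantNorm N) {B : CMat n} (hB : B.PosDef)
    (M : CMat n) : N (B * M - M * B) ≤ (‖B‖ - ‖B⁻¹‖⁻¹) * N M := by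
  have hB' := norm_sub_center_le hB
  set B' := B - (center B : ℂ) • (1 : CMat n) with hdB
  have h1 : B * M - M * B = B' * M - M * B' := by
    rw [hdB]
    simp [Matrix.sub_mul, Matrix.mul_sub]
  have hM := apply_nonneg N M
  rw [h1]
  have := map_sub_le_add N (B' * M) (M * B')
  nlinarith [hN.mul_le_left B' M, hN.mul_le_right M B']

end IsUnitarilyInvariantNorm

end

section

/-! ### Bounds for the tangent vectors of Mostow's decomposition -/

namespace IsMostow

variable {U Q Y Ω dQ dY : CMat n} {N : Seminorm ℂ (CMat n)}

lemma mul_cancel_left {A B : CMat n} (h : A * B = 1) (X : CMat n) : A * (B * X) = X := by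
  rw [← Matrix.mul_assoc, h, Matrix.one_mul]

/-- This is the derivative of `Y² P⁻¹ Y² = conj P`, where `P = Z* Z` and `P⁻¹ Y²` is `sqrtFactor Q
Y`. -/
lemma sylvester_identity (h : IsMostow U Q Y) (ht : IsMostowTangent Q Ω dQ dY) :
    (dY * Y + Y * dY) * sqrtFactor Q Y + (sqrtFactor Q Y)ᴴ * (dY * Y + Y * dY) =
      conj ((mostowDeriv U Q Y Ω dQ dY)ᴴ * (U * Q * Y) +
        (U * Q * Y)ᴴ * mostowDeriv U Q Y Ω dQ dY) +
      (sqrtFactor Q Y)ᴴ * ((mostowDeriv U Q Y Ω dQ dY)ᴴ * (U * Q * Y) +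
        (U * Q * Y)ᴴ * mostowDeriv U Q Y Ω dQ dY) * sqrtFactor Q Y := by
  have e1 := mul_cancel_left (posDef_mul_inv h.posY)
  have e2 := mul_cancel_left (posDef_inv_mul h.posY)
  have e3 := mul_cancel_left (posDef_mul_inv h.posQ)
  have e4 := mul_cancel_left (posDef_inv_mul h.posQ)
  have e5 := mul_cancel_left (unitary_conjTranspose_mul h.unitary)
  have hdP : (mostowDeriv U Q Y Ω dQ dY)ᴴ * (U * Q * Y) +
      (U * Q * Y)ᴴ * mostowDeriv U Q Y Ω dQ dY =
      dY * (Q * Q) * Y + Y * (dQ * Q + Q * dQ) * Y + Y * (Q * Q) * dY := by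
    simp only [mostowDeriv, Matrix.conjTranspose_mul, Matrix.conjTranspose_add, ht.skew, ht.hermQ,
      ht.hermY, h.posY.isHermitian.eq, h.posQ.isHermitian.eq, Matrix.mul_add, Matrix.add_mul,
      Matrix.mul_assoc, e5, Matrix.neg_mul, Matrix.mul_neg]
    abel
  rw [hdP, h.conjTranspose_sqrtFactor, sqrtFactor]
  simp only [conj_add, conj_mul, h.conjQ, h.conjY, ht.conj_dQ, ht.conj_dY, Matrix.mul_add,
    Matrix.add_mul, Matrix.mul_assoc, e1, e2, e3, e4, Matrix.neg_mul, Matrix.mul_neg]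
  abel

/-- The constant `β cond(Z) (1 + cond(Z)²)` for `Z = U Q Y`. -/
def sharpConst (U Q Y : CMat n) : ℝ :=
  decayIntegral (sqrtFactor Q Y) * cond (U * Q * Y) * (1 + cond (U * Q * Y) ^ 2)

/-- The constant `β cond(Z) (1 + cond(Z)⁴)` for `Z = U Q Y`. -/
def bigConst (U Q Y : CMat n) : ℝ :=
  decayIntegral (sqrtFactor Q Y) * cond (U * Q * Y) * (1 + cond (U * Q * Y) ^ 4)

/-- The letters stand for `v = N dY`, `y = ‖Y⁻¹‖`, `x = N (d(Y²))`, `b` the decay integral, `w` the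
norm of the Sylvester right-hand side, `c = cond Z`, `p = N dP`, `z = ‖Z‖`, and `e` the norm of the
derivative of the product. -/
lemma sylvester_scalar_bound {v y x b w c p z e : ℝ} (hy : 0 ≤ y) (hb : 0 ≤ b) (he : 0 ≤ e)
    (h₁ : v ≤ y / 2 * x) (h₂ : x ≤ b * w) (h₃ : w ≤ (1 + c ^ 2) * p) (h₄ : p ≤ 2 * z * e)
    (h₅ : y * z ≤ c) : v ≤ b * c * (1 + c ^ 2) * e := by
  have hc : 0 ≤ 1 + c ^ 2 := by positivity
  calc v ≤ y / 2 * (b * ((1 + c ^ 2) * (2 * z * e))) := by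
        refine h₁.trans (mul_le_mul_of_nonneg_left ?_ (by positivity))
        refine h₂.trans (mul_le_mul_of_nonneg_left ?_ hb)
        exact h₃.trans (mul_le_mul_of_nonneg_left h₄ hc)
    _ = (y * z) * (b * (1 + c ^ 2) * e) := by ring
    _ ≤ c * (b * (1 + c ^ 2) * e) := mul_le_mul_of_nonneg_right h₅ (by positivity)
    _ = _ := by ring

/-- A Lyapunov equation recovers `dY` from `d(Y²)`, and the Sylvester equation bounds `d(Y²)` by
`dP`. Only `cond²` occurs, from `‖A‖² ≤ cond²`; the slack against `cond⁴` in `k(Z)` is spent on the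
bound for the unitary factor. -/
lemma le_sharpConst_mul (hN : IsUnitarilyInvariantNorm N) (h : IsMostow U Q Y)
    (ht : IsMostowTangent Q Ω dQ dY) :
    N dY ≤ sharpConst U Q Y * N (mostowDeriv U Q Y Ω dQ dY) := by
  have hinv : ‖Y⁻¹‖ * ‖U * Q * Y‖ ≤ cond (U * Q * Y) := by
    rw [h.cond_eq, h.norm_eq, mul_comm ‖Q * Y‖]
    exact mul_le_mul_of_nonneg_right h.norm_invY_le (norm_nonneg _)
  set H := mostowDeriv U Q Y Ω dQ dY with hH
  set Z := U * Q * Y with hZ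
  set A := sqrtFactor Q Y with hA
  set b := decayIntegral A with hb
  set c := cond Z with hc
  have hb0 : 0 ≤ b := MeasureTheory.integral_nonneg fun t => by positivity
  have h1 := hN.sylvester_le h.isSimilarPos_sqrtFactor (dY * Y + Y * dY)
  change _ ≤ b * _ at h1
  rw [h.sylvester_identity ht, ← hH, ← hZ, ← hA] at h1
  set P := Hᴴ * Z + Zᴴ * H with hP
  have hNP : N P ≤ 2 * ‖Z‖ * N H := by
    have h2 := map_add_le_add N (Hᴴ * Z) (Zᴴ * H)
    have h3 := hN.mul_le_right Hᴴ Z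
    have h4 := hN.mul_le_left Zᴴ H
    rw [hN.apply_conjTranspose] at h3
    rw [Matrix.l2_opNorm_conjTranspose] at h4
    linarith
  have hAc : ‖A‖ ≤ c := h.norm_sqrtFactor_le
  have h2 : N (conj P + Aᴴ * P * A) ≤ (1 + c ^ 2) * N P := by
    have h3 := map_add_le_add N (conj P) (Aᴴ * P * A)
    have h4 := hN.mul_mul_le Aᴴ P A
    rw [Matrix.l2_opNorm_conjTranspose] at h4
    rw [hN.apply_conj] at h3
    have h5 : ‖A‖ ^ 2 ≤ c ^ 2 := by gcongr
    have h6 : ‖A‖ ^ 2 * N P ≤ c ^ 2 * N P := mul_le_mul_of_nonneg_right h5 (apply_nonneg N P)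
    linarith
  have h3 := hN.lyapunov_le h.posY dY
  rw [add_comm (Y * dY)] at h3
  have hNH := apply_nonneg N H
  have h4 := sylvester_scalar_bound (norm_nonneg _) hb0 hNH h3 h1 h2 hNP hinv
  exact h4

lemma one_le_cond [NeZero n] (h : IsMostow U Q Y) : 1 ≤ cond (U * Q * Y) :=
  h.one_le_norm_Q.trans h.norm_Q_le

lemma sharpConst_nonneg (U Q Y : CMat n) : 0 ≤ sharpConst U Q Y := by
  have h1 : 0 ≤ decayIntegral (sqrtFactor Q Y) :=
    MeasureTheory.integral_nonneg fun t => by positivity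
  have h2 : 0 ≤ cond (U * Q * Y) := mul_nonneg (norm_nonneg _) (norm_nonneg _)
  unfold sharpConst
  positivity

lemma sharpConst_le_bigConst [NeZero n] (h : IsMostow U Q Y) :
    sharpConst U Q Y ≤ bigConst U Q Y := by
  have h1 : 0 ≤ decayIntegral (sqrtFactor Q Y) :=
    MeasureTheory.integral_nonneg fun t => by positivity
  have h2 := h.one_le_cond
  unfold sharpConst bigConst
  gcongr
  · norm_num

lemma cond_le_bigConst [NeZero n] (h : IsMostow U Q Y) : cond (U * Q * Y) ≤ bigConst U Q Y := by
  have h1 := h.half_le_decayIntegral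
  have h2 := h.one_le_cond
  unfold bigConst
  set b := decayIntegral (sqrtFactor Q Y)
  set c := cond (U * Q * Y)
  have h3 : 1 ≤ c ^ 4 := one_le_pow₀ h2
  have h4 : 1 ≤ b * (1 + c ^ 4) := by nlinarith
  nlinarith

/-- The scalar inequality that governs the bound for the unitary factor. -/
lemma scalar_bound {b c q : ℝ} (hb : 1 / 2 ≤ b) (hq : 1 ≤ q) (hqc : q ≤ c) :
    b * c * (1 + c ^ 2) * (2 * q - 1 - 1 / c) ≤ q * (b * c * (1 + c ^ 4)) - 1 := by
  have hc : 1 ≤ c := hq.trans hqc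
  have hc0 : c ≠ 0 := by positivity
  have h1 : b * c * (1 + c ^ 2) * (2 * q - 1 - 1 / c) =
      b * (1 + c ^ 2) * (2 * q * c - c - 1) := by
    field_simp
  rw [h1]
  -- Two suffices here because `b ≥ 1/2`.
  have h2 : 2 ≤ q * c * (1 + c ^ 4) - (1 + c ^ 2) * (2 * q * c - c - 1) := by
    have h3 : q * c * (1 + c ^ 4) - (1 + c ^ 2) * (2 * q * c - c - 1) =
        q * (c * (c ^ 4 - 2 * c ^ 2 - 1)) + (1 + c ^ 2) * (c + 1) := by ring
    rw [h3]
    -- The expression is affine in `q ∈ [1, c]`, so the sign of the slope decides which endpoint is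
    -- the worst case.
    rcases le_total 0 (c ^ 4 - 2 * c ^ 2 - 1) with hpos | hneg
    · have h4 : c * (c ^ 4 - 2 * c ^ 2 - 1) ≤ q * (c * (c ^ 4 - 2 * c ^ 2 - 1)) :=
        le_mul_of_one_le_left (by positivity) hq
      nlinarith [mul_nonneg (sub_nonneg.2 hc) (by positivity : (0 : ℝ) ≤ (c + 1) * (c ^ 3 + 1))]
    · have h4 : c * (c * (c ^ 4 - 2 * c ^ 2 - 1)) ≤ q * (c * (c ^ 4 - 2 * c ^ 2 - 1)) :=
        mul_le_mul_of_nonpos_right hqc (mul_nonpos_of_nonneg_of_nonpos (by positivity) hneg)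
      have h5 : 0 ≤ c ^ 5 + c ^ 4 - c ^ 3 + 1 := by
        have : c ^ 3 ≤ c ^ 4 := pow_le_pow_right₀ hc (by norm_num)
        have : 0 ≤ c ^ 5 := by positivity
        linarith
      nlinarith [mul_nonneg (sub_nonneg.2 hc) h5]
  nlinarith

/-- A lower bound for the least eigenvalue of `Y⁻¹`, which enters through the centre of `Y⁻¹`. -/
lemma inv_cond_le (h : IsMostow U Q Y) : ‖Y⁻¹‖ * (1 / cond (U * Q * Y)) ≤ ‖Y‖⁻¹ := by
  rcases (norm_nonneg Y).eq_or_lt with h0 | h0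
  · have hY : Y = 0 := norm_eq_zero.1 h0.symm
    simp [hY]
  have h1 := h.cond_Y_le
  rcases (norm_nonneg Y⁻¹).eq_or_lt with h2 | h2
  · rw [← h2, zero_mul]
    positivity
  have h3 : 0 < cond (U * Q * Y) := (mul_pos h0 h2).trans_le h1
  rw [mul_one_div, div_le_iff₀ h3, inv_mul_eq_div, le_div_iff₀ h0]
  linarith

/-- With `E₁ = U* H Y⁻¹`, the difference `E₁ - E₁ᴴ` eliminates the Hermitian `dQ` and leaves a
Lyapunov equation for `Ω`. The remaining term in `dY` is estimated with centres, and `scalar_bound`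
turns its cost into `q k - 1`; together with the `2` from `E₁ - E₁ᴴ` this makes `1 + q k`. -/
lemma le_mul_deriv_unitary [NeZero n] (hN : IsUnitarilyInvariantNorm N) (h : IsMostow U Q Y)
    (ht : IsMostowTangent Q Ω dQ dY) :
    N Ω ≤ ‖Q‖ * ‖Y⁻¹‖ / 2 * (1 + ‖Q‖ * bigConst U Q Y) * N (mostowDeriv U Q Y Ω dQ dY) := by
  have hdY := h.le_sharpConst_mul hN ht
  have hinv := h.inv_cond_le
  have hsc := scalar_bound h.half_le_decayIntegral h.one_le_norm_Q h.norm_Q_le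
  have hk0 := sharpConst_nonneg U Q Y
  change sharpConst U Q Y * _ ≤ ‖Q‖ * bigConst U Q Y - 1 at hsc
  have e1 := mul_cancel_left (posDef_mul_inv h.posY)
  have e2 := mul_cancel_left (posDef_inv_mul h.posY)
  have e5 := mul_cancel_left (unitary_conjTranspose_mul h.unitary)
  set H := mostowDeriv U Q Y Ω dQ dY with hH
  set E₁ := Uᴴ * H * Y⁻¹ with hE₁
  have hE : E₁ = Ω * Q + dQ + Q * dY * Y⁻¹ := by
    simp only [hE₁, hH, mostowDeriv, Matrix.mul_assoc, e5, Matrix.add_mul,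
      posDef_mul_inv h.posY, Matrix.mul_one]
  have hEs : E₁ᴴ = -(Q * Ω) + dQ + Y⁻¹ * dY * Q := by
    rw [hE]
    simp only [Matrix.conjTranspose_mul, Matrix.conjTranspose_add, ht.skew, ht.hermQ,
      ht.hermY, h.posY.inv.isHermitian.eq, h.posQ.isHermitian.eq, Matrix.mul_neg, Matrix.mul_assoc]
  have hNE : N E₁ ≤ ‖Y⁻¹‖ * N H := by
    have h1 := hN.mul_le_right (Uᴴ * H) Y⁻¹
    rw [hN.unitary_mul (unitary_conjTranspose_mem h.unitary)] at h1
    linarith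
  have hL := hN.lyapunov_le h.posQ Ω
  have hid : Q * Ω + Ω * Q = E₁ - E₁ᴴ - (Q * dY * Y⁻¹ - Y⁻¹ * dY * Q) := by
    rw [hEs, hE]
    abel
  rw [hid, h.norm_invQ] at hL
  have h1 := map_sub_le_add N (E₁ - E₁ᴴ) (Q * dY * Y⁻¹ - Y⁻¹ * dY * Q)
  have h2 := map_sub_le_add N E₁ E₁ᴴ
  rw [hN.apply_conjTranspose] at h2
  have h3 := hN.norm_mul_sub_mul_le h.posQ h.posY.inv dY
  -- Since `‖Q⁻¹‖ = ‖Q‖`, the centre is the mean of `q` and `1/q`.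
  have hcQ : 1 ≤ center Q := by
    have hq := h.one_le_norm_Q
    rw [center, h.norm_invQ]
    have : ‖Q‖ * ‖Q‖⁻¹ = 1 := mul_inv_cancel₀ (by positivity)
    have h4 : 0 < ‖Q‖⁻¹ := by positivity
    nlinarith [sq_nonneg (‖Q‖ - 1)]
  have hcY : (‖Y⁻¹‖ + ‖Y⁻¹‖ * (1 / cond (U * Q * Y))) / 2 ≤ center Y⁻¹ := by
    rw [center, posDef_inv_inv h.posY]
    linarith
  have hcY0 : 0 ≤ center Y⁻¹ := by rw [center]; positivity
  have hH0 := apply_nonneg N H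
  have hq := h.one_le_norm_Q
  have hc := h.one_le_cond
  have hs0 := norm_nonneg Y⁻¹
  have hdY0 := apply_nonneg N dY
  generalize cond (U * Q * Y) = c at *
  generalize sharpConst U Q Y = k' at *
  generalize bigConst U Q Y = k at *
  generalize ‖Y⁻¹‖ = s at *
  generalize ‖Q‖ = q at *
  generalize N H = e at *
  generalize center Q = α at *
  generalize center Y⁻¹ = γ at *
  have hc1 : 1 / c ≤ 1 := by
    rw [div_le_one (by linarith)]
    exact hc
  have h4 : q * s - α * γ ≤ s * (2 * q - 1 - 1 / c) / 2 := by nlinarith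
  have h5 : 0 ≤ s * (2 * q - 1 - 1 / c) / 2 :=
    div_nonneg (mul_nonneg hs0 (by linarith)) two_pos.le
  have h6 : 2 * (q * s - α * γ) * N dY ≤ s * (2 * q - 1 - 1 / c) * (k' * e) := by
    have h7 := mul_le_mul h4 hdY (apply_nonneg N _) h5
    linarith
  have h7 : s * (2 * q - 1 - 1 / c) * (k' * e) ≤ s * (q * k - 1) * e := by
    have h8 := mul_le_mul_of_nonneg_left hsc (mul_nonneg hs0 hH0)
    linarith
  have h8 : N (E₁ - E₁ᴴ - (Q * dY * Y⁻¹ - Y⁻¹ * dY * Q)) ≤ s * (1 + q * k) * e := by linarith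
  calc N Ω ≤ q / 2 * (s * (1 + q * k) * e) :=
        hL.trans (mul_le_mul_of_nonneg_left h8 (by linarith))
    _ = _ := by ring

/-- The combination `Q⁻¹ E₁ᴴ + E₁ Q⁻¹` eliminates `Ω`. Its `dQ` part changes sign under conjugation,
so subtracting the conjugate doubles that part and leaves only commutators of `Y⁻¹` with `dY`. -/
lemma le_mul_deriv_posQ [NeZero n] (hN : IsUnitarilyInvariantNorm N) (h : IsMostow U Q Y)
    (ht : IsMostowTangent Q Ω dQ dY) :
    N dQ ≤ ‖Q‖ * ‖Q‖ * ‖Y⁻¹‖ / 2 * (1 + ‖Q‖ * bigConst U Q Y) *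
      N (mostowDeriv U Q Y Ω dQ dY) := by
  have hdY := h.le_sharpConst_mul hN ht
  have hinv := h.inv_cond_le
  have hk0 := sharpConst_nonneg U Q Y
  have hkk := h.sharpConst_le_bigConst
  have hck := h.cond_le_bigConst
  have e1 := mul_cancel_left (posDef_mul_inv h.posY)
  have e2 := mul_cancel_left (posDef_inv_mul h.posY)
  have e3 := mul_cancel_left (posDef_mul_inv h.posQ)
  have e4 := mul_cancel_left (posDef_inv_mul h.posQ)
  have e5 := mul_cancel_left (unitary_conjTranspose_mul h.unitary)
  set H := mostowDeriv U Q Y Ω dQ dY with hH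
  set E₁ := Uᴴ * H * Y⁻¹ with hE₁
  have hE : E₁ = Ω * Q + dQ + Q * dY * Y⁻¹ := by
    simp only [hE₁, hH, mostowDeriv, Matrix.mul_assoc, e5, Matrix.add_mul,
      posDef_mul_inv h.posY, Matrix.mul_one]
  have hEs : E₁ᴴ = -(Q * Ω) + dQ + Y⁻¹ * dY * Q := by
    rw [hE]
    simp only [Matrix.conjTranspose_mul, Matrix.conjTranspose_add, ht.skew, ht.hermQ,
      ht.hermY, h.posY.inv.isHermitian.eq, h.posQ.isHermitian.eq, Matrix.mul_neg, Matrix.mul_assoc]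
  have hNE : N E₁ ≤ ‖Y⁻¹‖ * N H := by
    have h1 := hN.mul_le_right (Uᴴ * H) Y⁻¹
    rw [hN.unitary_mul (unitary_conjTranspose_mem h.unitary)] at h1
    linarith
  set F := Q⁻¹ * E₁ᴴ + E₁ * Q⁻¹ with hF
  set C := Y⁻¹ * dY - dY * Y⁻¹ with hC
  have hNF : N F ≤ 2 * ‖Q‖ * (‖Y⁻¹‖ * N H) := by
    have h1 := map_add_le_add N (Q⁻¹ * E₁ᴴ) (E₁ * Q⁻¹)
    have h2 := hN.mul_le_left Q⁻¹ E₁ᴴ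
    have h3 := hN.mul_le_right E₁ Q⁻¹
    rw [hN.apply_conjTranspose, h.norm_invQ] at h2
    rw [h.norm_invQ] at h3
    have h4 := mul_le_mul_of_nonneg_left hNE (norm_nonneg Q)
    linarith
  have hFe : F = Q⁻¹ * dQ + dQ * Q⁻¹ + Q⁻¹ * Y⁻¹ * dY * Q + Q * dY * Y⁻¹ * Q⁻¹ := by
    rw [hF, hEs, hE]
    simp only [Matrix.mul_add, Matrix.add_mul, Matrix.mul_neg, Matrix.mul_assoc, e4,
      posDef_mul_inv h.posQ, Matrix.mul_one]
    abel
  have hid : (2 : ℂ) • (Q⁻¹ * dQ + dQ * Q⁻¹) =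
      (F - conj F) - (Q⁻¹ * C * Q - Q * C * Q⁻¹) := by
    rw [hFe, hC]
    simp only [conj_add, conj_mul, h.conjQ, h.conjInvQ, h.conjInvY, ht.conj_dQ, ht.conj_dY,
      Matrix.mul_sub, Matrix.sub_mul, Matrix.mul_neg, Matrix.neg_mul, Matrix.mul_assoc, e3,
      posDef_inv_mul h.posQ, Matrix.mul_one]
    module
  have hL := hN.lyapunov_le h.posQ.inv dQ
  rw [posDef_inv_inv h.posQ] at hL
  have h0 : 2 * N (Q⁻¹ * dQ + dQ * Q⁻¹) = N ((2 : ℂ) • (Q⁻¹ * dQ + dQ * Q⁻¹)) := by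
    rw [map_smul_eq_mul]
    simp
  rw [hid] at h0
  have h1 := map_sub_le_add N (F - conj F) (Q⁻¹ * C * Q - Q * C * Q⁻¹)
  have h2 := map_sub_le_add N F (conj F)
  have h3 := map_sub_le_add N (Q⁻¹ * C * Q) (Q * C * Q⁻¹)
  have h4 := hN.mul_mul_le Q⁻¹ C Q
  have h5 := hN.mul_mul_le Q C Q⁻¹
  rw [h.norm_invQ] at h4 h5
  rw [hN.apply_conj] at h2
  have h6 := hN.norm_commutator_le h.posY.inv dY
  rw [← hC, posDef_inv_inv h.posY] at h6
  have hq := h.one_le_norm_Q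
  have hc := h.one_le_cond
  have hH0 := apply_nonneg N H
  have hs0 := norm_nonneg Y⁻¹
  have hdY0 := apply_nonneg N dY
  generalize N (Q⁻¹ * dQ + dQ * Q⁻¹) = D at *
  generalize cond (U * Q * Y) = c at *
  generalize sharpConst U Q Y = k' at *
  generalize bigConst U Q Y = k at *
  generalize ‖Y⁻¹‖ = s at *
  generalize ‖Q‖ = q at *
  generalize N H = e at *
  have hc1 : 1 / c ≤ 1 := by
    rw [div_le_one (by linarith)]
    exact hc
  have h7 : N C ≤ s * (1 - 1 / c) * (k * e) := by
    have h8 : N C ≤ s * (1 - 1 / c) * N dY :=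
      h6.trans (mul_le_mul_of_nonneg_right (by linarith) hdY0)
    refine h8.trans (mul_le_mul_of_nonneg_left ?_ (mul_nonneg hs0 (by linarith)))
    exact hdY.trans (mul_le_mul_of_nonneg_right hkk hH0)
  have h8 : D ≤ 2 * q * (s * e) + q * q * (s * (1 - 1 / c) * (k * e)) := by
    have h9 := mul_le_mul_of_nonneg_left h7 (mul_nonneg (by linarith : 0 ≤ q) (by linarith : 0 ≤ q))
    linarith
  -- The commutator bound saves a fraction `1/c`; because `c ≤ k` and `q ≥ 1`, this saving reduces
  -- the constant `2` to `1`.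
  have h9 : 1 ≤ q * (k * (1 / c)) := by
    have h10 : 1 ≤ k * (1 / c) := by
      rw [mul_one_div, one_le_div (by linarith)]
      exact hck
    nlinarith
  have h10 : 2 * q * (s * e) + q * q * (s * (1 - 1 / c) * (k * e)) ≤
      q * s * (1 + q * k) * e := by
    have h11 : 0 ≤ q * s * e := by positivity
    nlinarith [mul_le_mul_of_nonneg_left h9 h11]
  calc N dQ ≤ q / 2 * (q * s * (1 + q * k) * e) :=
        hL.trans (mul_le_mul_of_nonneg_left (h8.trans h10) (by linarith))
    _ = _ := by ring

end IsMostow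

end

section

/-! ### Exponentials of Hermitian matrices -/

lemma posDef_conj_rdiag {U : CMat n} (hU : U ∈ Matrix.unitaryGroup (Fin n) ℂ) {d : Fin n → ℝ}
    (hd : ∀ i, 0 < d i) : (U * rdiag d * Uᴴ).PosDef := by
  have h1 : (rdiag d).PosDef := Matrix.PosDef.diagonal fun i => by exact_mod_cast hd i
  exact (Matrix.IsUnit.posDef_star_right_conjugate_iff (unitary_isUnit hU)).2 h1

lemma isHermitian_conj_rdiag (U : CMat n) (d : Fin n → ℝ) : (U * rdiag d * Uᴴ).IsHermitian := by
  rw [Matrix.IsHermitian, Matrix.conjTranspose_mul, Matrix.conjTranspose_mul,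
    Matrix.conjTranspose_conjTranspose, Matrix.diagonal_conjTranspose, ← Matrix.mul_assoc]
  congr 3
  funext i
  simp

lemma posDef_exp {x : CMat n} (hx : x.IsHermitian) : (NormedSpace.exp x).PosDef := by
  obtain ⟨U, hU, d, -, rfl⟩ := exists_diagonalization hx
  rw [exp_unitary_conj hU, exp_rdiag]
  exact posDef_conj_rdiag hU fun i => Real.exp_pos _

lemma exists_exp_eq_of_posDef {A : CMat n} (hA : A.PosDef) :
    ∃ x : CMat n, x.IsHermitian ∧ NormedSpace.exp x = A := by
  obtain ⟨U, hU, d, hd, rfl⟩ := PosDef.exists_diagonalization hA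
  refine ⟨U * rdiag (fun i => Real.log (d i)) * Uᴴ, isHermitian_conj_rdiag _ _, ?_⟩
  rw [exp_unitary_conj hU, exp_rdiag]
  simp only [Real.exp_log (hd _)]

lemma exp_injective_of_isHermitian {x y : CMat n} (hx : x.IsHermitian) (hy : y.IsHermitian)
    (h : NormedSpace.exp x = NormedSpace.exp y) : x = y := by
  rw [← CFC.log_exp x hx, ← CFC.log_exp y hy, h]

lemma exp_half_mul_self (x : CMat n) :
    NormedSpace.exp ((2⁻¹ : ℂ) • x) * NormedSpace.exp ((2⁻¹ : ℂ) • x) = NormedSpace.exp x := by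
  rw [← Matrix.exp_add_of_commute _ _ (Commute.refl _)]
  congr 1
  module

lemma expI_injective_of_norm_lt {x y : CMat n} (hx : x.IsHermitian) (hy : y.IsHermitian)
    (hx' : ‖x‖ < Real.pi) (hy' : ‖y‖ < Real.pi)
    (h : NormedSpace.exp (Complex.I • x) = NormedSpace.exp (Complex.I • y)) : x = y := by
  have h1 := argSelfAdjoint_expUnitary (x := (⟨x, hx⟩ : selfAdjoint (CMat n))) hx'
  have h2 := argSelfAdjoint_expUnitary (x := (⟨y, hy⟩ : selfAdjoint (CMat n))) hy'
  have h3 : selfAdjoint.expUnitary (⟨x, hx⟩ : selfAdjoint (CMat n)) =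
      selfAdjoint.expUnitary ⟨y, hy⟩ := by
    exact Subtype.ext h
  rw [h3, h2] at h1
  exact (congrArg Subtype.val h1).symm

lemma exists_expI_eq {W : CMat n} (hW : W ∈ Matrix.unitaryGroup (Fin n) ℂ)
    (hs : (-1 : ℂ) ∉ spectrum ℂ W) :
    ∃ x : CMat n, x.IsHermitian ∧ ‖x‖ < Real.pi ∧ NormedSpace.exp (Complex.I • x) = W := by
  have h1 := (Unitary.norm_sub_one_lt_two_iff hW).2 hs
  have h2 := expUnitary_argSelfAdjoint (u := (⟨W, hW⟩ : unitary (CMat n))) h1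
  refine ⟨(Unitary.argSelfAdjoint (⟨W, hW⟩ : unitary (CMat n)) : CMat n),
    (Unitary.argSelfAdjoint (⟨W, hW⟩ : unitary (CMat n))).2, ?_, congrArg Subtype.val h2⟩
  have h3 := Unitary.norm_argSelfAdjoint (u := (⟨W, hW⟩ : unitary (CMat n))) h1
  change ‖Unitary.argSelfAdjoint (⟨W, hW⟩ : unitary (CMat n))‖ < Real.pi
  rw [h3]
  refine (Real.arccos_le_pi _).lt_of_ne fun h4 => ?_
  rw [Real.arccos_eq_pi] at h4
  have h5 : (4 : ℝ) ≤ ‖W - 1‖ ^ 2 := by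
    have : 1 - ‖W - 1‖ ^ 2 / 2 ≤ -1 := h4
    linarith
  nlinarith [norm_nonneg (W - 1)]

lemma norm_lt_iff_spectrum {x : CMat n} (hx : x.IsHermitian) {r : ℝ} (hr : 0 < r) :
    ‖x‖ < r ↔ ∀ d : ℝ, (d : ℂ) ∈ spectrum ℂ x → |d| < r := by
  rcases isEmpty_or_nonempty (Fin n) with he | hne
  · have h0 : ‖x‖ = 0 := by rw [Subsingleton.elim x 0, norm_zero]
    simp [h0, hr]
  constructor
  · intro h d hd
    have := spectrum.norm_le_norm_of_mem hd
    rw [Complex.norm_real] at this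
    exact this.trans_lt h
  · intro h
    obtain ⟨U, hU, d, hd, hx'⟩ := exists_diagonalization hx
    rw [hx', norm_conj_rdiag hU, Matrix.l2_opNorm_diagonal, pi_norm_lt_iff hr]
    intro i
    rw [Complex.norm_real]
    exact h _ (spectrum.algebraMap_mem ℂ (hd i))

/-! ### Square roots with positive spectrum -/

lemma IsSimilarPos.spectrum_pos {A : CMat n} (hA : IsSimilarPos A) {μ : ℂ}
    (hμ : μ ∈ spectrum ℂ A) : 0 < μ.re ∧ μ.im = 0 := by
  obtain ⟨G, ⟨g, rfl⟩, d, hd, rfl⟩ := hA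
  rw [← Matrix.coe_units_inv, spectrum.units_conjugate, spectrum_diagonal] at hμ
  obtain ⟨i, rfl⟩ := hμ
  simpa using hd i

/-- From `X (X - A) = -(X - A) A`, each column of `(X - A) G` would be an eigenvector of `X` for
some `-d j < 0`, hence is zero. No diagonalizability of `X` is needed. -/
lemma eq_of_mul_self_eq {X A : CMat n} (hA : IsSimilarPos A)
    (hX : ∀ μ ∈ spectrum ℂ X, 0 < μ.re) (h : X * X = A * A) : X = A := by
  obtain ⟨G, hG, d, hd, hA'⟩ := hA
  have hGi : G⁻¹ * G = 1 := Matrix.nonsing_inv_mul G ((Matrix.isUnit_iff_isUnit_det _).1 hG)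
  have hGi' : G * G⁻¹ = 1 := Matrix.mul_nonsing_inv G ((Matrix.isUnit_iff_isUnit_det _).1 hG)
  set D := (X - A) * G with hD
  have h1 : X * D = -(D * rdiag d) := by
    have h2 : A * G = G * rdiag d := by
      rw [hA', Matrix.mul_assoc, hGi, Matrix.mul_one]
    have h3 : X * (X - A) = -((X - A) * A) := by
      rw [Matrix.mul_sub, Matrix.sub_mul, h]
      abel
    rw [hD, ← Matrix.mul_assoc, h3, Matrix.mul_assoc (X - A) G, ← h2, ← Matrix.mul_assoc,
      Matrix.neg_mul]
  have h2 : D = 0 := by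
    ext i j
    have hu : IsUnit (algebraMap ℂ (CMat n) (-(d j : ℂ)) - X) := by
      by_contra hn
      have := hX _ (spectrum.mem_iff.2 hn)
      simp only [Complex.neg_re, Complex.ofReal_re] at this
      linarith [hd j]
    have h3 : (algebraMap ℂ (CMat n) (-(d j : ℂ)) - X) *ᵥ (fun k => D k j) = 0 := by
      rw [Matrix.sub_mulVec, Algebra.algebraMap_eq_smul_one, Matrix.smul_mulVec, Matrix.one_mulVec]
      funext k
      have h4 := congrFun (congrFun h1 k) j
      rw [Matrix.neg_apply, Matrix.mul_diagonal, Matrix.mul_apply] at h4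
      simp only [Pi.sub_apply, Pi.smul_apply, smul_eq_mul, Pi.zero_apply, Matrix.mulVec, dotProduct]
      rw [h4]
      ring
    have h5 := Matrix.mulVec_injective_of_isUnit hu
      (a₁ := fun k => D k j) (a₂ := 0) (by rw [h3, Matrix.mulVec_zero])
    exact congrFun h5 i
  have h3 : X - A = D * G⁻¹ := by rw [hD, Matrix.mul_assoc, hGi', Matrix.mul_one]
  rw [h2, Matrix.zero_mul] at h3
  exact sub_eq_zero.1 h3

lemma PosDef.isSimilarPos {A : CMat n} (hA : A.PosDef) : IsSimilarPos A := by
  obtain ⟨U, hU, d, hd, h⟩ := PosDef.exists_diagonalization hA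
  exact ⟨U, unitary_isUnit hU, d, hd, by rw [unitary_inv hU, h]⟩

lemma posDef_eq_of_mul_self_eq {A B : CMat n} (hA : A.PosDef) (hB : B.PosDef)
    (h : A * A = B * B) : A = B :=
  eq_of_mul_self_eq (PosDef.isSimilarPos hB)
    (fun _ hμ => ((PosDef.isSimilarPos hA).spectrum_pos hμ).1) h

lemma positiveSqrt_eq {A M : CMat n} (hA : IsSimilarPos A) (h : A * A = M) :
    positiveSqrt M = A := by
  have hex : ∃ X, IsPositiveSqrt X M := ⟨A, h, fun _ hμ => hA.spectrum_pos hμ⟩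
  rw [positiveSqrt, dif_pos hex]
  exact eq_of_mul_self_eq hA (fun μ hμ => (hex.choose_spec.pos μ hμ).1)
    (hex.choose_spec.mul_self.trans h.symm)

lemma psdSqrt_spec {A : CMat n} (hA : A.PosDef) :
    (psdSqrt A).PosDef ∧ psdSqrt A * psdSqrt A = A := by
  have h1 : psdSqrt A = (hA.isHermitian.eigenvectorUnitary : CMat n) *
      rdiag (fun i => Real.sqrt (hA.isHermitian.eigenvalues i)) *
      (hA.isHermitian.eigenvectorUnitary : CMat n)ᴴ := by
    rw [psdSqrt, hA.isHermitian.cfc_eq]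
    rfl
  have hU := hA.isHermitian.eigenvectorUnitary.2
  refine ⟨h1 ▸ posDef_conj_rdiag hU fun i => Real.sqrt_pos.2 (hA.eigenvalues_pos i), ?_⟩
  have h2 : A = (hA.isHermitian.eigenvectorUnitary : CMat n) *
      rdiag hA.isHermitian.eigenvalues * (hA.isHermitian.eigenvectorUnitary : CMat n)ᴴ := by
    conv_lhs => rw [hA.isHermitian.spectral_theorem]
    rfl
  conv_rhs => rw [h2]
  rw [h1]
  generalize (hA.isHermitian.eigenvectorUnitary : CMat n) = U at *
  calc _ = U * rdiag (fun i => Real.sqrt (hA.isHermitian.eigenvalues i)) * (Uᴴ * U) *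
        rdiag (fun i => Real.sqrt (hA.isHermitian.eigenvalues i)) * Uᴴ := by
        simp only [Matrix.mul_assoc]
    _ = _ := by
        rw [unitary_conjTranspose_mul hU, Matrix.mul_one, Matrix.mul_assoc U, rdiag_mul_rdiag]
        simp only [Real.mul_self_sqrt (hA.eigenvalues_pos _).le]

lemma posDef_conj {A C : CMat n} (hA : A.PosDef) (hC : C.PosDef) : (C * A * C).PosDef := by
  have := (Matrix.IsUnit.posDef_star_right_conjugate_iff hC.isUnit).2 hA
  rwa [Matrix.star_eq_conjTranspose, hC.isHermitian.eq] at this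

/-- The product is similar to the positive definite `A^{1/2} B A^{1/2}`. -/
lemma isSimilarPos_mul {A B : CMat n} (hA : A.PosDef) (hB : B.PosDef) : IsSimilarPos (A * B) := by
  obtain ⟨ha, haa⟩ := psdSqrt_spec hA
  set a := psdSqrt A
  obtain ⟨G, hG, d, hd, h⟩ := PosDef.isSimilarPos (posDef_conj hB ha)
  refine ⟨a * G, ha.isUnit.mul hG, d, hd, ?_⟩
  rw [Matrix.mul_inv_rev]
  calc A * B = a * (a * B * a) * a⁻¹ := by
        rw [← haa]
        simp only [Matrix.mul_assoc, posDef_mul_inv ha, Matrix.mul_one]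
    _ = _ := by
        rw [h]
        simp only [Matrix.mul_assoc]

/-- Positivity and the Riccati equation are all that is used of the geometric mean. -/
lemma geomMean_spec {A B : CMat n} (hA : A.PosDef) (hB : B.PosDef) :
    (geomMean A B).PosDef ∧ geomMean A B * A⁻¹ * geomMean A B = B := by
  obtain ⟨ha, haa⟩ := psdSqrt_spec hA
  obtain ⟨hb, hbb⟩ := psdSqrt_spec (posDef_conj hB ha.inv)
  rw [geomMean]
  set a := psdSqrt A
  set b := psdSqrt (a⁻¹ * B * a⁻¹)
  have e1 := IsMostow.mul_cancel_left (posDef_mul_inv ha)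
  have e2 := IsMostow.mul_cancel_left (posDef_inv_mul ha)
  refine ⟨posDef_conj hb ha, ?_⟩
  have hAi : A⁻¹ = a⁻¹ * a⁻¹ := by rw [← haa, Matrix.mul_inv_rev]
  calc _ = a * (b * b) * a := by
        rw [hAi]
        simp only [Matrix.mul_assoc, e1, e2]
    _ = B := by
        rw [hbb]
        simp only [Matrix.mul_assoc, e1, posDef_inv_mul ha, Matrix.mul_one]

lemma posDef_conj_entries {A : CMat n} (hA : A.PosDef) : (conj A).PosDef := by
  obtain ⟨x, hx, rfl⟩ := exists_exp_eq_of_posDef hA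
  rw [conj_exp]
  apply posDef_exp
  rw [Matrix.IsHermitian, conjTranspose_conj, ← conj_conjTranspose, hx.eq]

/-! ### Mostow's decomposition -/

namespace IsMostow

variable {U Q Y : CMat n}

lemma conjTranspose_mul_self_eq (h : IsMostow U Q Y) :
    (U * Q * Y)ᴴ * (U * Q * Y) = Y * (Q * Q) * Y := by
  have e5 := mul_cancel_left (unitary_conjTranspose_mul h.unitary)
  simp only [Matrix.conjTranspose_mul, h.posY.isHermitian.eq, h.posQ.isHermitian.eq,
    Matrix.mul_assoc, e5]

lemma sqrtFactor_mul_self (h : IsMostow U Q Y) :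
    sqrtFactor Q Y * sqrtFactor Q Y =
      ((U * Q * Y)ᴴ * (U * Q * Y))⁻¹ * conj ((U * Q * Y)ᴴ * (U * Q * Y)) := by
  have e1 := mul_cancel_left (posDef_mul_inv h.posY)
  have e3 := mul_cancel_left (posDef_mul_inv h.posQ)
  have e4 := mul_cancel_left (posDef_inv_mul h.posQ)
  rw [h.conjTranspose_mul_self_eq]
  simp only [conj_mul, h.conjQ, h.conjY, sqrtFactor, Matrix.mul_inv_rev, Matrix.mul_assoc, e1,
    mul_cancel_left (posDef_inv_mul h.posY)]

lemma positiveSqrt_eq (h : IsMostow U Q Y) :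
    positiveSqrt (((U * Q * Y)ᴴ * (U * Q * Y))⁻¹ * conj ((U * Q * Y)ᴴ * (U * Q * Y))) =
      sqrtFactor Q Y :=
  Bipolar.positiveSqrt_eq h.isSimilarPos_sqrtFactor h.sqrtFactor_mul_self

lemma kappa_eq (h : IsMostow U Q Y) : kappa (U * Q * Y) = bigConst U Q Y := by
  rw [kappa, beta, h.positiveSqrt_eq]
  rfl

lemma conjTranspose_mul_self_mul_sqrtFactor (h : IsMostow U Q Y) :
    (U * Q * Y)ᴴ * (U * Q * Y) * sqrtFactor Q Y = Y * Y := by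
  rw [h.conjTranspose_mul_self_eq, sqrtFactor]
  simp only [Matrix.mul_assoc, mul_cancel_left (posDef_mul_inv h.posY),
    mul_cancel_left (posDef_mul_inv h.posQ)]

/-- The product determines `P = Z* Z`, hence its positive square root `A = (P⁻¹ conj P)^{1/2}`,
hence `Y² = P A`, then `Q²` from `P = Y Q² Y`, and lastly `U`. -/
lemma unique {U' Q' Y' : CMat n} (h : IsMostow U Q Y) (h' : IsMostow U' Q' Y')
    (heq : U * Q * Y = U' * Q' * Y') : U = U' ∧ Q = Q' ∧ Y = Y' := by
  have hA : sqrtFactor Q Y = sqrtFactor Q' Y' := by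
    rw [← h.positiveSqrt_eq, ← h'.positiveSqrt_eq, heq]
  have hY : Y = Y' := posDef_eq_of_mul_self_eq h.posY h'.posY (by
    rw [← h.conjTranspose_mul_self_mul_sqrtFactor, ← h'.conjTranspose_mul_self_mul_sqrtFactor,
      heq, hA])
  subst hY
  have hQ : Q = Q' := posDef_eq_of_mul_self_eq h.posQ h'.posQ (by
    have h1 : Y * (Q * Q) * Y = Y * (Q' * Q') * Y := by
      rw [← h.conjTranspose_mul_self_eq, ← h'.conjTranspose_mul_self_eq, heq]
    have h2 : ∀ X : CMat n, Y⁻¹ * (Y * X * Y) * Y⁻¹ = X := fun X => by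
      simp only [Matrix.mul_assoc, mul_cancel_left (posDef_inv_mul h.posY), posDef_mul_inv h.posY,
        Matrix.mul_one]
    rw [← h2 (Q * Q), h1, h2])
  subst hQ
  refine ⟨?_, rfl, rfl⟩
  have h2 : ∀ V : CMat n, V * Q * Y * (Y⁻¹ * Q⁻¹) = V := fun V => by
    simp only [Matrix.mul_assoc, mul_cancel_left (posDef_mul_inv h.posY), posDef_mul_inv h.posQ,
      Matrix.mul_one]
  rw [← h2 U, heq, h2]

end IsMostow

/-- Mostow's decomposition in exponential form. -/
lemma exists_mostow {Z : CMat n} (hZ : IsUnit Z) :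
    ∃ U : CMat n, ∃ K S : RMat n, Kᵀ = -K ∧ Sᵀ = S ∧
      IsMostow U (expI K) (NormedSpace.exp (toC S)) ∧
      Z = U * expI K * NormedSpace.exp (toC S) ∧
      geomMean (Zᴴ * Z)⁻¹ (conj (Zᴴ * Z))⁻¹ =
        (NormedSpace.exp (toC S))⁻¹ * (NormedSpace.exp (toC S))⁻¹ := by
  have hP : (Zᴴ * Z).PosDef :=
    Matrix.PosDef.conjTranspose_mul_self Z (Matrix.mulVec_injective_of_isUnit hZ)
  obtain ⟨P, hPdef⟩ : ∃ P, P = Zᴴ * Z := ⟨_, rfl⟩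
  rw [← hPdef] at hP ⊢
  have hPc := posDef_conj_entries hP
  obtain ⟨hJ, hJP⟩ := geomMean_spec hP.inv hPc.inv
  rw [posDef_inv_inv hP] at hJP
  set J := geomMean P⁻¹ (conj P)⁻¹
  have hJc := posDef_conj_entries hJ
  have hJP' : conj J * P * conj J = (conj P)⁻¹ := by
    have h1 : conj J * conj P * conj J = P⁻¹ := by
      rw [← conj_mul, ← conj_mul, hJP, conj_inv, conj_conj]
    have h2 : P = (conj J)⁻¹ * (conj P)⁻¹ * (conj J)⁻¹ := by
      calc P = (conj J * conj P * conj J)⁻¹ := by rw [h1, posDef_inv_inv hP]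
        _ = _ := by rw [Matrix.mul_inv_rev, Matrix.mul_inv_rev, Matrix.mul_assoc]
    calc conj J * P * conj J = conj J * ((conj J)⁻¹ * (conj P)⁻¹ * (conj J)⁻¹) * conj J := by
          rw [← h2]
      _ = (conj P)⁻¹ := by
          simp only [Matrix.mul_assoc, IsMostow.mul_cancel_left (posDef_mul_inv hJc),
            posDef_inv_mul hJc, Matrix.mul_one]
  -- Both `X = J` and `X = conj J` solve `X P X = (conj P)⁻¹`. So `P J` and `P conj J` have the same
  -- square and positive spectra, and coincide.
  have hJreal : conj J = J := by
    have h1 : P * conj J = P * J := by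
      refine eq_of_mul_self_eq (isSimilarPos_mul hP hJ)
        (fun μ hμ => ((isSimilarPos_mul hP hJc).spectrum_pos hμ).1) ?_
      calc _ = P * (conj J * P * conj J) := by simp only [Matrix.mul_assoc]
        _ = P * (J * P * J) := by rw [hJP', hJP]
        _ = _ := by simp only [Matrix.mul_assoc]
    calc conj J = P⁻¹ * (P * conj J) := by
          rw [IsMostow.mul_cancel_left (posDef_inv_mul hP)]
      _ = J := by rw [h1, IsMostow.mul_cancel_left (posDef_inv_mul hP)]
  obtain ⟨x, hx, hxJ⟩ := exists_exp_eq_of_posDef hJ.inv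
  have hxc : conj x = x := by
    refine exp_injective_of_isHermitian ?_ hx ?_
    · rw [Matrix.IsHermitian, conjTranspose_conj, ← conj_conjTranspose, hx.eq]
    · rw [← conj_exp, hxJ, conj_inv, hJreal]
  set y : CMat n := (2⁻¹ : ℂ) • x with hy
  have hyc : conj y = y := by
    rw [hy, conj_smul, hxc, map_inv₀, Complex.conj_ofNat]
  have hyh : y.IsHermitian := by
    rw [Matrix.IsHermitian, hy, Matrix.conjTranspose_smul, hx.eq]
    simp
  set S := rePart y with hSdef
  have hS : toC S = y := toC_rePart hyc
  have hSt : Sᵀ = S := by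
    apply toC_injective
    rw [← toC_conjTranspose, hS, hyh.eq]
  have hYY : NormedSpace.exp (toC S) * NormedSpace.exp (toC S) = J⁻¹ := by
    rw [hS, exp_half_mul_self, hxJ]
  have hY : (NormedSpace.exp (toC S)).PosDef := hS ▸ posDef_exp hyh
  have hYc : conj (NormedSpace.exp (toC S)) = NormedSpace.exp (toC S) := by
    rw [conj_exp, conj_toC]
  set Y := NormedSpace.exp (toC S) with hYdef
  have hJY : J = Y⁻¹ * Y⁻¹ := by
    rw [← Matrix.mul_inv_rev, hYY, posDef_inv_inv hJ]
  set R := Y⁻¹ * P * Y⁻¹ with hR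
  have hRpos : R.PosDef := posDef_conj hP hY.inv
  -- `R` is to be `Q²`; this relation makes its Hermitian logarithm purely imaginary, so that half
  -- of it is `iK` with `K` real.
  have hRc : conj R = R⁻¹ := by
    have h1 : conj P = Y * Y * P⁻¹ * (Y * Y) := by
      have h2 : conj P = (J * P * J)⁻¹ := by rw [hJP, posDef_inv_inv hPc]
      rw [h2, Matrix.mul_inv_rev, Matrix.mul_inv_rev, ← hYY]
      simp only [Matrix.mul_assoc]
    rw [hR, conj_mul, conj_mul, conj_inv, hYc, h1, Matrix.mul_inv_rev, Matrix.mul_inv_rev,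
      posDef_inv_inv hY]
    simp only [Matrix.mul_assoc, IsMostow.mul_cancel_left (posDef_inv_mul hY),
      posDef_mul_inv hY, Matrix.mul_one]
  obtain ⟨w, hw, hwR⟩ := exists_exp_eq_of_posDef hRpos
  have hwc : conj w = -w := by
    refine exp_injective_of_isHermitian ?_ hw.neg ?_
    · rw [Matrix.IsHermitian, conjTranspose_conj, ← conj_conjTranspose, hw.eq]
    · rw [← conj_exp, hwR, hRc, Matrix.exp_neg, hwR]
  set v : CMat n := (2⁻¹ : ℂ) • w with hv
  have hvc : conj v = -v := by
    rw [hv, conj_smul, hwc, map_inv₀, Complex.conj_ofNat, smul_neg]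
  have hvh : v.IsHermitian := by
    rw [Matrix.IsHermitian, hv, Matrix.conjTranspose_smul, hw.eq]
    simp
  set K := imPart v with hKdef
  have hK : Complex.I • toC K = v := toC_imPart hvc
  have hKt : Kᵀ = -K := by
    apply toC_injective
    have h1 : toC K = -Complex.I • v := by
      rw [← hK, smul_smul]
      simp
    rw [← toC_conjTranspose, toC_neg, h1, Matrix.conjTranspose_smul, hvh.eq]
    simp
  have hQQ : expI K * expI K = R := by
    rw [expI, hK, exp_half_mul_self, hwR]
  have hQ : (expI K).PosDef := by
    rw [expI, hK]
    exact posDef_exp hvh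
  have hQc : conj (expI K) = (expI K)⁻¹ := by
    rw [expI, hK, conj_exp, hvc, Matrix.exp_neg]
  have hZeq : Z = Z * Y⁻¹ * (expI K)⁻¹ * expI K * Y := by
    simp only [Matrix.mul_assoc, IsMostow.mul_cancel_left (posDef_inv_mul hQ), posDef_inv_mul hY,
      Matrix.mul_one]
  refine ⟨Z * Y⁻¹ * (expI K)⁻¹, K, S, hKt, hSt, ⟨?_, hQ, hY, hQc, hYc⟩, hZeq, hJY⟩
  rw [Matrix.mem_unitaryGroup_iff', Matrix.star_eq_conjTranspose, Matrix.conjTranspose_mul,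
    Matrix.conjTranspose_mul, hQ.inv.isHermitian.eq, hY.inv.isHermitian.eq]
  calc _ = (expI K)⁻¹ * R * (expI K)⁻¹ := by
        rw [hR, hPdef]
        simp only [Matrix.mul_assoc]
    _ = 1 := by
        rw [← hQQ]
        simp only [IsMostow.mul_cancel_left (posDef_inv_mul hQ), posDef_mul_inv hQ]

end

section

/-! ### Exponentials of real symmetric and skew symmetric matrices -/

lemma isHermitian_toC {S : RMat n} (h : Sᵀ = S) : (toC S).IsHermitian := by
  rw [Matrix.IsHermitian, toC_conjTranspose, h]

lemma conjTranspose_toC_of_skew {L : RMat n} (h : Lᵀ = -L) : (toC L)ᴴ = -toC L := by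
  rw [toC_conjTranspose, h, toC_neg]

lemma isHermitian_I_smul {A : CMat n} (h : Aᴴ = -A) : (Complex.I • A).IsHermitian := by
  rw [Matrix.IsHermitian, Matrix.conjTranspose_smul, h]
  simp

lemma isHermitian_I_smul_toC {K : RMat n} (h : Kᵀ = -K) : (Complex.I • toC K).IsHermitian :=
  isHermitian_I_smul (conjTranspose_toC_of_skew h)

lemma conj_expI (A : RMat n) : conj (expI A) = expI (-A) := by
  rw [expI, expI, conj_exp, conj_smul, conj_toC, toC_neg]
  simp

lemma expI_neg (A : RMat n) : expI (-A) = (expI A)⁻¹ := by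
  rw [expI, expI, toC_neg, smul_neg, Matrix.exp_neg]

lemma transpose_expI (A : RMat n) : (expI A)ᵀ = expI Aᵀ := by
  rw [expI, expI, ← Matrix.exp_transpose, Matrix.transpose_smul, toC_transpose]

lemma conjTranspose_expI {T : RMat n} (h : Tᵀ = T) : (expI T)ᴴ = expI (-T) := by
  rw [expI, expI, ← Matrix.exp_conjTranspose, Matrix.conjTranspose_smul, (isHermitian_toC h).eq,
    toC_neg, smul_neg]
  simp

lemma posDef_expI {K : RMat n} (h : Kᵀ = -K) : (expI K).PosDef :=
  posDef_exp (isHermitian_I_smul_toC h)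

lemma exp_I_smul_mem_unitary {x : CMat n} (hx : x.IsHermitian) :
    NormedSpace.exp (Complex.I • x) ∈ Matrix.unitaryGroup (Fin n) ℂ := by
  rw [Matrix.mem_unitaryGroup_iff', Matrix.star_eq_conjTranspose, ← Matrix.exp_conjTranspose,
    Matrix.conjTranspose_smul, hx.eq]
  simpa using exp_neg_mul_exp (Complex.I • x)

lemma expI_mem_unitary {T : RMat n} (h : Tᵀ = T) : expI T ∈ Matrix.unitaryGroup (Fin n) ℂ :=
  exp_I_smul_mem_unitary (isHermitian_toC h)

lemma mem_orthogonalGroup_iff {W : RMat n} :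
    W ∈ Matrix.orthogonalGroup (Fin n) ℝ ↔ toC W ∈ Matrix.unitaryGroup (Fin n) ℂ := by
  rw [Matrix.mem_orthogonalGroup_iff', Matrix.mem_unitaryGroup_iff', Matrix.star_eq_conjTranspose,
    toC_conjTranspose, ← toC_mul, ← toC_one, toC_injective.eq_iff]

lemma isUnit_toC_iff {A : RMat n} : IsUnit (toC A) ↔ IsUnit A := by
  have h : (toC A).det = (A.det : ℂ) := (RingHom.map_det Complex.ofRealHom A).symm
  rw [Matrix.isUnit_iff_isUnit_det, Matrix.isUnit_iff_isUnit_det, h, isUnit_iff_ne_zero,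
    isUnit_iff_ne_zero, Complex.ofReal_ne_zero]

lemma mem_spectrum_toC_iff {A : RMat n} {r : ℝ} :
    (r : ℂ) ∈ spectrum ℂ (toC A) ↔ r ∈ spectrum ℝ A := by
  have h : algebraMap ℂ (CMat n) r - toC A = toC (algebraMap ℝ (RMat n) r - A) := by
    rw [toC_sub, Matrix.algebraMap_eq_diagonal, Matrix.algebraMap_eq_diagonal]
    congr 1
    simp [toC, Matrix.diagonal_map]
  rw [spectrum.mem_iff, spectrum.mem_iff, h, isUnit_toC_iff]

lemma norm_toC_lt_iff {T : RMat n} (h : Tᵀ = T) {r : ℝ} (hr : 0 < r) :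
    ‖toC T‖ < r ↔ spectrum ℝ T ⊆ Set.Ioo (-r) r := by
  rw [norm_lt_iff_spectrum (isHermitian_toC h) hr]
  simp only [mem_spectrum_toC_iff, Set.subset_def, Set.mem_Ioo, abs_lt]

lemma norm_toC_lt_iff_of_skew {L : RMat n} (h : Lᵀ = -L) {r : ℝ} (hr : 0 < r) :
    ‖toC L‖ < r ↔ ∀ μ ∈ spectrum ℂ (toC L), |μ.im| < r := by
  have hx := isHermitian_I_smul_toC h
  have hn : ‖toC L‖ = ‖Complex.I • toC L‖ := by rw [norm_smul]; simp
  have hs : ∀ μ : ℂ, μ ∈ spectrum ℂ (toC L) ↔ Complex.I * μ ∈ spectrum ℂ (Complex.I • toC L) := by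
    intro μ
    have := spectrum.smul_mem_smul_iff (R := ℂ) (a := toC L) (s := μ)
      (r := Units.mk0 Complex.I Complex.I_ne_zero)
    exact this.symm
  rw [hn, norm_lt_iff_spectrum hx hr]
  constructor
  · intro H μ hμ
    have h1 := (hs μ).1 hμ
    have h2 := IsSelfAdjoint.mem_spectrum_eq_re (show IsSelfAdjoint _ from hx) h1
    have h3 := H _ (h2 ▸ h1)
    simpa using h3
  · intro H d hd
    have := H (-Complex.I * d) ((hs _).2 (by
      rwa [← mul_assoc, mul_neg, Complex.I_mul_I, neg_neg, one_mul]))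
    simpa using this

/-! ### Uniqueness of the logarithms -/

lemma expI_injective_of_skew {K K' : RMat n} (h : Kᵀ = -K) (h' : K'ᵀ = -K')
    (he : expI K = expI K') : K = K' := by
  have h1 := exp_injective_of_isHermitian (isHermitian_I_smul_toC h) (isHermitian_I_smul_toC h') he
  exact toC_injective (smul_right_injective _ Complex.I_ne_zero h1)

lemma exp_toC_injective {S S' : RMat n} (h : Sᵀ = S) (h' : S'ᵀ = S')
    (he : NormedSpace.exp (toC S) = NormedSpace.exp (toC S')) : S = S' :=
  toC_injective (exp_injective_of_isHermitian (isHermitian_toC h) (isHermitian_toC h') he)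

lemma expI_mul_self (T : RMat n) :
    expI T * expI T = NormedSpace.exp (Complex.I • ((2 : ℂ) • toC T)) := by
  rw [expI, ← Matrix.exp_add_of_commute _ _ (Commute.refl _)]
  congr 1
  module

/-- The bound `π/2` on `T` keeps `2T` in the range where the logarithm of a unitary matrix is
unique. -/
lemma eq_of_expI_mul_self_eq {T T' : RMat n} (h : Tᵀ = T) (h' : T'ᵀ = T')
    (hn : ‖toC T‖ < Real.pi / 2) (hn' : ‖toC T'‖ < Real.pi / 2)
    (he : expI T * expI T = expI T' * expI T') : T = T' := by
  rw [expI_mul_self, expI_mul_self] at he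
  have key : ∀ {A : RMat n}, Aᵀ = A → ‖toC A‖ < Real.pi / 2 →
      ((2 : ℂ) • toC A).IsHermitian ∧ ‖(2 : ℂ) • toC A‖ < Real.pi := by
    intro A hA hnA
    refine ⟨?_, ?_⟩
    · rw [Matrix.IsHermitian, Matrix.conjTranspose_smul, (isHermitian_toC hA).eq]
      simp
    · rw [norm_smul, Complex.norm_ofNat]
      linarith
  have h1 := expI_injective_of_norm_lt (key h hn).1 (key h' hn').1 (key h hn).2 (key h' hn').2 he
  exact toC_injective (smul_right_injective _ two_ne_zero h1)

lemma IsPrincipalLog.norm_lt {L W : RMat n} (h : IsPrincipalLog L W) : ‖toC L‖ < Real.pi :=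
  (norm_toC_lt_iff_of_skew h.skew Real.pi_pos).2 h.spec

lemma IsPrincipalLog.unique {L L' W : RMat n} (h : IsPrincipalLog L W)
    (h' : IsPrincipalLog L' W) : L = L' := by
  have key : ∀ {A : RMat n}, IsPrincipalLog A W → (-(Complex.I • toC A)).IsHermitian ∧
      ‖-(Complex.I • toC A)‖ < Real.pi ∧
      NormedSpace.exp (Complex.I • (-(Complex.I • toC A))) = toC W := by
    intro A hA
    refine ⟨(isHermitian_I_smul_toC hA.skew).neg, ?_, ?_⟩
    · rw [norm_neg, norm_smul]
      simpa using hA.norm_lt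
    · rw [smul_neg, smul_smul, Complex.I_mul_I, neg_smul, neg_neg, one_smul, ← toC_exp, hA.exp_eq]
  obtain ⟨a1, a2, a3⟩ := key h
  obtain ⟨b1, b2, b3⟩ := key h'
  have h1 := expI_injective_of_norm_lt a1 b1 a2 b2 (a3.trans b3.symm)
  exact toC_injective (smul_right_injective _ Complex.I_ne_zero (neg_injective h1))

/-- Reality comes from uniqueness: if `e^{ix} = W` is real, then `-conj x` is another Hermitian
logarithm of norm below `π`. -/
lemma exists_isPrincipalLog {W : RMat n} (hW : W ∈ Matrix.orthogonalGroup (Fin n) ℝ)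
    (hs : (-1 : ℝ) ∉ spectrum ℝ W) : ∃ L, IsPrincipalLog L W := by
  obtain ⟨x, hx, hxn, hxW⟩ := exists_expI_eq (mem_orthogonalGroup_iff.1 hW) (by
    have := mem_spectrum_toC_iff (A := W) (r := -1)
    rw [Complex.ofReal_neg, Complex.ofReal_one] at this
    rwa [this])
  have hcx : (conj x).IsHermitian := by
    rw [Matrix.IsHermitian, conjTranspose_conj, ← conj_conjTranspose, hx.eq]
  have hxc : -conj x = x := by
    refine expI_injective_of_norm_lt hcx.neg hx (by rwa [norm_neg, norm_conj]) hxn ?_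
    have h1 : Complex.I • -conj x = conj (Complex.I • x) := by
      rw [conj_smul]
      simp
    rw [h1, ← conj_exp, hxW, conj_toC]
  have hxc' : conj x = -x := by rw [← neg_neg (conj x), hxc]
  have hreal : conj (Complex.I • x) = Complex.I • x := by
    rw [conj_smul, hxc']
    simp
  have hL : toC (rePart (Complex.I • x)) = Complex.I • x := toC_rePart hreal
  have hskew : (rePart (Complex.I • x))ᵀ = -rePart (Complex.I • x) := by
    apply toC_injective
    rw [← toC_conjTranspose, toC_neg, hL, Matrix.conjTranspose_smul, hx.eq]
    simp
  refine ⟨rePart (Complex.I • x), hskew, ?_, ?_⟩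
  · rw [← norm_toC_lt_iff_of_skew hskew Real.pi_pos, hL, norm_smul]
    simpa using hxn
  · apply toC_injective
    rw [toC_exp, hL, hxW]

/-! ### Existence and uniqueness of the bipolar decomposition -/

namespace IsBipolar

variable {Z : CMat n} {W₁ T K S : RMat n}

lemma norm_T_lt (h : IsBipolar Z W₁ T K S) : ‖toC T‖ < Real.pi / 2 :=
  (norm_toC_lt_iff h.symm_T (by positivity)).2 h.spec_T

lemma isMostow (h : IsBipolar Z W₁ T K S) :
    IsMostow (toC W₁ * expI T) (expI K) (NormedSpace.exp (toC S)) where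
  unitary := mul_mem (mem_orthogonalGroup_iff.1 h.orthogonal) (expI_mem_unitary h.symm_T)
  posQ := posDef_expI h.skew_K
  posY := posDef_exp (isHermitian_toC h.symm_S)
  conjQ := by rw [conj_expI, expI_neg]
  conjY := by rw [conj_exp, conj_toC]

/-- The orthogonal factor cancels, so `T` can be read off from the unitary factor of Mostow's
decomposition. -/
lemma transpose_mul_self (h : IsBipolar Z W₁ T K S) :
    (toC W₁ * expI T)ᵀ * (toC W₁ * expI T) = expI T * expI T := by
  have h1 : (toC W₁)ᵀ * toC W₁ = 1 := by
    have := unitary_conjTranspose_mul (mem_orthogonalGroup_iff.1 h.orthogonal)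
    rwa [toC_conjTranspose, toC_transpose] at this
  rw [Matrix.transpose_mul, transpose_expI, h.symm_T, Matrix.mul_assoc,
    ← Matrix.mul_assoc _ _ (expI T), h1, Matrix.one_mul]

lemma unique {W₁' T' K' S' : RMat n} (h : IsBipolar Z W₁ T K S)
    (h' : IsBipolar Z W₁' T' K' S') : W₁ = W₁' ∧ T = T' ∧ K = K' ∧ S = S' := by
  obtain ⟨hU, hQ, hY⟩ := h.isMostow.unique h'.isMostow (by rw [← h.eq, ← h'.eq])
  have hT : T = T' := eq_of_expI_mul_self_eq h.symm_T h'.symm_T h.norm_T_lt h'.norm_T_lt (by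
    rw [← h.transpose_mul_self, ← h'.transpose_mul_self, hU])
  subst hT
  refine ⟨?_, rfl, expI_injective_of_skew h.skew_K h'.skew_K hQ,
    exp_toC_injective h.symm_S h'.symm_S hY⟩
  apply toC_injective
  have h1 := congrArg (· * (expI T)ᴴ) hU
  simpa only [Matrix.mul_assoc, unitary_mul_conjTranspose (expI_mem_unitary h.symm_T),
    Matrix.mul_one] using h1

end IsBipolar

/-- The matrix in the spectral hypothesis is similar to `Uᵀ U` through `Y Q⁻¹`. Half the principal
logarithm of the symmetric unitary `Uᵀ U` gives `T`, and `U e^{-iT}` is then real. -/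
lemma exists_isBipolar {Z : CMat n} (hZ : IsUnit Z)
    (hσ : (-1 : ℂ) ∉ spectrum ℂ (Zᵀ * Z * geomMean (Zᴴ * Z)⁻¹ (conj (Zᴴ * Z))⁻¹)) :
    ∃ W₁ T K S : RMat n, IsBipolar Z W₁ T K S := by
  obtain ⟨U, K, S, hK, hS, hM, hZeq, hJ⟩ := exists_mostow hZ
  rw [hJ] at hσ
  set Y := NormedSpace.exp (toC S) with hY
  have hYt : Yᵀ = Y := by rw [hY, ← Matrix.exp_transpose, ← toC_transpose, hS]
  have hQt : (expI K)ᵀ = (expI K)⁻¹ := by rw [transpose_expI, hK, expI_neg]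
  have hsim : Zᵀ * Z * (Y⁻¹ * Y⁻¹) = (Y * (expI K)⁻¹) * (Uᵀ * U) * (Y * (expI K)⁻¹)⁻¹ := by
    rw [Matrix.mul_inv_rev, posDef_inv_inv hM.posQ, hZeq, Matrix.transpose_mul,
      Matrix.transpose_mul, hYt, hQt]
    simp only [Matrix.mul_assoc, IsMostow.mul_cancel_left (posDef_mul_inv hM.posY)]
  have hMu : Uᵀ * U ∈ Matrix.unitaryGroup (Fin n) ℂ :=
    mul_mem (transpose_mem_unitary hM.unitary) hM.unitary
  obtain ⟨g, hg⟩ := hM.posY.isUnit.mul hM.posQ.inv.isUnit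
  rw [hsim, ← hg, ← Matrix.coe_units_inv, spectrum.units_conjugate] at hσ
  obtain ⟨x, hx, hxn, hxM⟩ := exists_expI_eq hMu hσ
  have hxt : xᵀ = x := by
    have hth : (xᵀ).IsHermitian := hx.transpose
    refine expI_injective_of_norm_lt hth hx (by rwa [norm_transpose]) hxn ?_
    rw [← Matrix.transpose_smul, Matrix.exp_transpose, hxM, Matrix.transpose_mul,
      Matrix.transpose_transpose]
  have hxc : conj x = x := by rw [← hx.eq, conj_conjTranspose, hxt]; rw [hx.eq]
  set y : CMat n := (2⁻¹ : ℂ) • x with hy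
  have hyc : conj y = y := by rw [hy, conj_smul, hxc, map_inv₀, Complex.conj_ofNat]
  have hT : toC (rePart y) = y := toC_rePart hyc
  have hTt : (rePart y)ᵀ = rePart y := by
    apply toC_injective
    rw [toC_transpose, hT, hy, Matrix.transpose_smul, hxt]
  have hTn : ‖toC (rePart y)‖ < Real.pi / 2 := by
    rw [hT, hy, norm_smul, norm_inv, Complex.norm_ofNat]
    linarith
  have hW2 := expI_mem_unitary hTt
  have hTT : expI (rePart y) * expI (rePart y) = Uᵀ * U := by
    rw [expI_mul_self, hT, hy, smul_inv_smul₀ two_ne_zero, hxM]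
  set W₂ := expI (rePart y) with hW2def
  have hW2t : W₂ᵀ = W₂ := by rw [hW2def, transpose_expI, hTt]
  have hW2i := unitary_mul_conjTranspose hW2
  have hW2i' := unitary_conjTranspose_mul hW2
  have hV : U * W₂ᴴ ∈ Matrix.unitaryGroup (Fin n) ℂ :=
    mul_mem hM.unitary (unitary_conjTranspose_mem hW2)
  have hVV : (U * W₂ᴴ)ᵀ * (U * W₂ᴴ) = 1 := by
    have h1 : (W₂ᴴ)ᵀ = W₂ᴴ := by
      rw [hW2def, conjTranspose_expI hTt, transpose_expI, Matrix.transpose_neg, hTt]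
    rw [Matrix.transpose_mul, h1, Matrix.mul_assoc, ← Matrix.mul_assoc Uᵀ, ← hTT]
    simp only [Matrix.mul_assoc, hW2i, Matrix.mul_one, hW2i']
  -- A unitary `V` with `Vᵀ V = 1` has `Vᵀ = Vᴴ`, that is, real entries.
  have hVc : conj (U * W₂ᴴ) = U * W₂ᴴ := by
    have h1 : (U * W₂ᴴ)ᵀ = (U * W₂ᴴ)ᴴ := by
      calc (U * W₂ᴴ)ᵀ = (U * W₂ᴴ)ᵀ * ((U * W₂ᴴ) * (U * W₂ᴴ)ᴴ) := by
            rw [unitary_mul_conjTranspose hV, Matrix.mul_one]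
        _ = _ := by rw [← Matrix.mul_assoc, hVV, Matrix.one_mul]
    calc conj (U * W₂ᴴ) = conj (U * W₂ᴴ)ᴴᴴ := by rw [Matrix.conjTranspose_conjTranspose]
      _ = (U * W₂ᴴ)ᴴᵀ := conj_conjTranspose _
      _ = U * W₂ᴴ := by rw [← h1, Matrix.transpose_transpose]
  have hVr := toC_rePart hVc
  refine ⟨rePart (U * W₂ᴴ), rePart y, K, S, ?_, hTt, ?_, hK, hS, ?_⟩
  · rw [mem_orthogonalGroup_iff, hVr]
    exact hV
  · exact (norm_toC_lt_iff hTt (by positivity)).1 hTn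
  · rw [hVr, ← hW2def, Matrix.mul_assoc U, hW2i', Matrix.mul_one, hZeq]

end

section

/-! ### Tangent vectors to the bipolar decomposition -/

/-- Logarithmic coordinates of a bipolar decomposition: `l` is real skew symmetric, `t` imaginary
symmetric, `k` imaginary skew symmetric and `s` real symmetric. -/
structure IsBipolarCoord (l t k s : CMat n) : Prop where
  conj_l : conj l = l
  transpose_l : lᵀ = -l
  conj_t : conj t = -t
  transpose_t : tᵀ = t
  conj_k : conj k = -k
  transpose_k : kᵀ = -k
  conj_s : conj s = s
  transpose_s : sᵀ = s

/-- The logarithmic derivative `e^{-l} D exp(l) l'` of the exponential. -/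
def logDeriv (l l' : CMat n) : CMat n := NormedSpace.exp (-l) * dexp l l'

/-- The logarithmic derivative of `(l, t) ↦ e^l e^t`. -/
def logDerivProd (l t l' t' : CMat n) : CMat n :=
  NormedSpace.exp (-t) * logDeriv l l' * NormedSpace.exp t + logDeriv t t'

lemma conjTranspose_logDeriv {x y : CMat n} (hx : xᴴ = -x) (hy : yᴴ = -y) :
    (logDeriv x y)ᴴ = -logDeriv x y := by
  rw [logDeriv, Matrix.conjTranspose_mul, conjTranspose_dexp, hx, hy, dexp_neg,
    ← Matrix.exp_conjTranspose, Matrix.conjTranspose_neg, hx, neg_neg, Matrix.neg_mul,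
    Matrix.mul_assoc, Matrix.mul_assoc, exp_neg_mul_exp, Matrix.mul_one]

lemma exp_mem_unitary {x : CMat n} (hx : xᴴ = -x) :
    NormedSpace.exp x ∈ Matrix.unitaryGroup (Fin n) ℂ := by
  rw [Matrix.mem_unitaryGroup_iff', Matrix.star_eq_conjTranspose, ← Matrix.exp_conjTranspose, hx,
    exp_neg_mul_exp]

/-- A skew Hermitian matrix is unitarily diagonalizable. -/
lemma exists_diagonalization_of_skew {x : CMat n} (hx : xᴴ = -x) :
    ∃ U ∈ Matrix.unitaryGroup (Fin n) ℂ, ∃ d : Fin n → ℝ,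
      x = U * Matrix.diagonal (fun i => (d i : ℂ) * Complex.I) * Uᴴ ∧ ∀ i, |d i| ≤ ‖x‖ := by
  have hn : ‖-(Complex.I • x)‖ = ‖x‖ := by
    rw [norm_neg, norm_smul]
    simp
  obtain ⟨U, hU, d, -, hd⟩ := exists_diagonalization (isHermitian_I_smul hx).neg
  have hx' : x = U * Matrix.diagonal (fun i => (d i : ℂ) * Complex.I) * Uᴴ := by
    have h1 : Matrix.diagonal (fun i => (d i : ℂ) * Complex.I) = Complex.I • rdiag d := by
      rw [rdiag, ← Matrix.diagonal_smul]
      congr 1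
      funext i
      simp [mul_comm]
    rw [h1, Matrix.mul_smul, Matrix.smul_mul, ← hd, smul_neg, smul_smul, Complex.I_mul_I]
    simp
  refine ⟨U, hU, d, hx', fun i => ?_⟩
  rw [← hn, hd, norm_conj_rdiag hU] 
  exact (norm_rdiag_le_iff (norm_nonneg _)).1 le_rfl i

variable {N : Seminorm ℂ (CMat n)}

lemma IsUnitarilyInvariantNorm.le_logConst_mul_dexp (hN : IsUnitarilyInvariantNorm N) {x : CMat n}
    (hx : xᴴ = -x) (hn : ‖x‖ < Real.pi) (h : CMat n) :
    N h ≤ logConst (NormedSpace.exp x) * N (dexp x h) := by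
  obtain ⟨U, hU, d, hd, hdn⟩ := exists_diagonalization_of_skew hx
  exact hN.le_integral_resolvent_mul_dexp hU (fun i => by simpa using (hdn i).trans_lt hn) hd h

lemma IsUnitarilyInvariantNorm.apply_logDeriv (hN : IsUnitarilyInvariantNorm N) {x : CMat n}
    (hx : xᴴ = -x) (h : CMat n) : N (logDeriv x h) = N (dexp x h) := by
  refine hN.unitary_mul (exp_mem_unitary ?_) _
  rw [Matrix.conjTranspose_neg, hx]

namespace IsBipolarCoord

variable {l t k s l' t' k' s' : CMat n}

lemma of_real {L T K S : RMat n} (hL : Lᵀ = -L) (hT : Tᵀ = T) (hK : Kᵀ = -K) (hS : Sᵀ = S) :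
    IsBipolarCoord (toC L) (Complex.I • toC T) (Complex.I • toC K) (toC S) where
  conj_l := conj_toC L
  transpose_l := by rw [← toC_transpose, hL, toC_neg]
  conj_t := by rw [conj_smul, conj_toC]; simp
  transpose_t := by rw [Matrix.transpose_smul, ← toC_transpose, hT]
  conj_k := by rw [conj_smul, conj_toC]; simp
  transpose_k := by rw [Matrix.transpose_smul, ← toC_transpose, hK, toC_neg, smul_neg]
  conj_s := conj_toC S
  transpose_s := by rw [← toC_transpose, hS]

lemma conjTranspose_l (b : IsBipolarCoord l t k s) : lᴴ = -l := by
  rw [← transpose_conj, b.conj_l, b.transpose_l]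

lemma conjTranspose_t (b : IsBipolarCoord l t k s) : tᴴ = -t := by
  rw [← transpose_conj, b.conj_t, Matrix.transpose_neg, b.transpose_t]

lemma conjTranspose_k (b : IsBipolarCoord l t k s) : kᴴ = k := by
  rw [← transpose_conj, b.conj_k, Matrix.transpose_neg, b.transpose_k, neg_neg]

lemma conjTranspose_s (b : IsBipolarCoord l t k s) : sᴴ = s := by
  rw [← transpose_conj, b.conj_s, b.transpose_s]

lemma isMostow (b : IsBipolarCoord l t k s) {B : CMat n}
    (hB : B ∈ Matrix.unitaryGroup (Fin n) ℂ) :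
    IsMostow (B * NormedSpace.exp l * NormedSpace.exp t) (NormedSpace.exp k)
      (NormedSpace.exp s) where
  unitary := mul_mem (mul_mem hB (exp_mem_unitary b.conjTranspose_l))
    (exp_mem_unitary b.conjTranspose_t)
  posQ := posDef_exp b.conjTranspose_k
  posY := posDef_exp b.conjTranspose_s
  conjQ := by rw [conj_exp, b.conj_k, Matrix.exp_neg]
  conjY := by rw [conj_exp, b.conj_s]

lemma isMostowTangent (b : IsBipolarCoord l t k s) (b' : IsBipolarCoord l' t' k' s') :
    IsMostowTangent (NormedSpace.exp k) (logDerivProd l t l' t') (dexp k k') (dexp s s') where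
  skew := by
    rw [logDerivProd, Matrix.conjTranspose_add, Matrix.conjTranspose_mul, Matrix.conjTranspose_mul,
      conjTranspose_logDeriv b.conjTranspose_l b'.conjTranspose_l,
      conjTranspose_logDeriv b.conjTranspose_t b'.conjTranspose_t, ← Matrix.exp_conjTranspose,
      ← Matrix.exp_conjTranspose, Matrix.conjTranspose_neg, b.conjTranspose_t, neg_neg,
      Matrix.neg_mul, Matrix.mul_neg, Matrix.mul_assoc]
    abel
  hermQ := by rw [conjTranspose_dexp, b.conjTranspose_k, b'.conjTranspose_k]
  hermY := by rw [conjTranspose_dexp, b.conjTranspose_s, b'.conjTranspose_s]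
  conj_dQ := by rw [conj_dexp, b.conj_k, b'.conj_k, dexp_neg, Matrix.exp_neg]
  conj_dY := by rw [conj_dexp, b.conj_s, b'.conj_s]

lemma transpose_logDeriv (b : IsBipolarCoord l t k s) (b' : IsBipolarCoord l' t' k' s') :
    (logDeriv l l')ᵀ = -logDeriv l l' := by
  have h1 : conj (logDeriv l l') = logDeriv l l' := by
    rw [logDeriv, conj_mul, conj_exp, conj_dexp, conj_neg, b.conj_l, b'.conj_l]
  rw [← conj_conjTranspose, conjTranspose_logDeriv b.conjTranspose_l b'.conjTranspose_l, conj_neg,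
    h1]

lemma exp_mul_logDerivProd :
    NormedSpace.exp t * logDerivProd l t l' t' =
      logDeriv l l' * NormedSpace.exp t + dexp t t' := by
  rw [logDerivProd, logDeriv, logDeriv, Matrix.mul_add]
  simp only [← Matrix.mul_assoc, exp_mul_exp_neg, Matrix.one_mul]

lemma transpose_exp_t (b : IsBipolarCoord l t k s) :
    (NormedSpace.exp t)ᵀ = NormedSpace.exp t := by
  rw [← Matrix.exp_transpose, b.transpose_t]

lemma transpose_dexp_t (b : IsBipolarCoord l t k s) (b' : IsBipolarCoord l' t' k' s') :
    (dexp t t')ᵀ = dexp t t' := by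
  rw [transpose_dexp, b.transpose_t, b'.transpose_t]

/-- In `e^t Ω = ω e^t + D exp(t) t'` the last term is symmetric and `ω` is skew, so subtracting the
transpose isolates `ω`. -/
lemma anticommutator_logDeriv (b : IsBipolarCoord l t k s) (b' : IsBipolarCoord l' t' k' s') :
    NormedSpace.exp t * logDeriv l l' + logDeriv l l' * NormedSpace.exp t =
      NormedSpace.exp t * logDerivProd l t l' t' -
        (NormedSpace.exp t * logDerivProd l t l' t')ᵀ := by
  rw [exp_mul_logDerivProd, Matrix.transpose_add, Matrix.transpose_mul, b.transpose_logDeriv b',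
    b.transpose_exp_t, b.transpose_dexp_t b', Matrix.mul_neg]
  abel

/-- After a further factor `e^t` the unwanted term `e^t ω e^t` is skew and drops out on adding the
transpose. -/
lemma anticommutator_dexp (b : IsBipolarCoord l t k s) (b' : IsBipolarCoord l' t' k' s') :
    NormedSpace.exp t * dexp t t' + dexp t t' * NormedSpace.exp t =
      NormedSpace.exp t * (NormedSpace.exp t * logDerivProd l t l' t') +
        (NormedSpace.exp t * (NormedSpace.exp t * logDerivProd l t l' t'))ᵀ := by
  rw [exp_mul_logDerivProd, Matrix.transpose_mul, Matrix.transpose_add, Matrix.transpose_mul,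
    b.transpose_logDeriv b', b.transpose_exp_t, b.transpose_dexp_t b', Matrix.mul_neg,
    Matrix.mul_add, Matrix.add_mul, Matrix.neg_mul, Matrix.mul_assoc]
  abel

lemma apply_anticommutator_logDeriv_le (b : IsBipolarCoord l t k s)
    (b' : IsBipolarCoord l' t' k' s') (hN : IsUnitarilyInvariantNorm N) :
    N (NormedSpace.exp t * logDeriv l l' + logDeriv l l' * NormedSpace.exp t) ≤
      2 * N (logDerivProd l t l' t') := by
  have hW := exp_mem_unitary b.conjTranspose_t
  rw [b.anticommutator_logDeriv b']
  refine (map_sub_le_add N _ _).trans_eq ?_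
  rw [hN.apply_transpose, hN.unitary_mul hW]
  ring

lemma apply_anticommutator_dexp_le (b : IsBipolarCoord l t k s)
    (b' : IsBipolarCoord l' t' k' s') (hN : IsUnitarilyInvariantNorm N) :
    N (NormedSpace.exp t * dexp t t' + dexp t t' * NormedSpace.exp t) ≤
      2 * N (logDerivProd l t l' t') := by
  have hW := exp_mem_unitary b.conjTranspose_t
  rw [b.anticommutator_dexp b']
  refine (map_add_le_add N _ _).trans_eq ?_
  rw [hN.apply_transpose, hN.unitary_mul hW, hN.unitary_mul hW]
  ring

end IsBipolarCoord

lemma exp_skew_eq {U x : CMat n} (hU : U ∈ Matrix.unitaryGroup (Fin n) ℂ) {d : Fin n → ℝ}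
    (hx : x = U * Matrix.diagonal (fun i => (d i : ℂ) * Complex.I) * Uᴴ) :
    NormedSpace.exp x = U * Matrix.diagonal (fun i => Complex.exp (d i * Complex.I)) * Uᴴ := by
  rw [hx, exp_unitary_conj hU, exp_diagonal']

lemma exp_mul_I_add_ne_zero {a b : ℝ} (ha : |a| < Real.pi / 2) (hb : |b| < Real.pi / 2) :
    Complex.exp (a * Complex.I) + Complex.exp (b * Complex.I) ≠ 0 := by
  intro h
  have h1 := congrArg Complex.re h
  rw [Complex.add_re, Complex.exp_ofReal_mul_I_re, Complex.exp_ofReal_mul_I_re,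
    Complex.zero_re] at h1
  rw [abs_lt] at ha hb
  linarith [Real.cos_pos_of_mem_Ioo ha, Real.cos_pos_of_mem_Ioo hb]

lemma one_add_exp_sub_ne_zero {a b : ℝ} (ha : |a| < Real.pi / 2) (hb : |b| < Real.pi / 2) :
    1 + Complex.exp ((a - b) * Complex.I) ≠ 0 := by
  intro h
  apply exp_mul_I_add_ne_zero ha hb
  have h1 : Complex.exp (a * Complex.I) =
      Complex.exp ((a - b) * Complex.I) * Complex.exp (b * Complex.I) := by
    rw [← Complex.exp_add]
    congr 1
    ring
  rw [h1]
  linear_combination Complex.exp (b * Complex.I) * h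

lemma eq_zero_of_anticommute_exp {t M : CMat n} (ht : tᴴ = -t) (hn : ‖t‖ < Real.pi / 2)
    (h : NormedSpace.exp t * M + M * NormedSpace.exp t = 0) : M = 0 := by
  obtain ⟨U, hU, d, hd, hdn⟩ := exists_diagonalization_of_skew ht
  rw [exp_skew_eq hU hd] at h
  exact eq_zero_of_anticommute hU
    (fun i j => exp_mul_I_add_ne_zero ((hdn i).trans_lt hn) ((hdn j).trans_lt hn)) h

lemma IsUnitarilyInvariantNorm.le_anticommutator_exp (hN : IsUnitarilyInvariantNorm N) {t : CMat n}
    (ht : tᴴ = -t) (hn : ‖t‖ < Real.pi / 2) {a : ℤ → ℂ} (ha : Summable fun m => ‖a m‖)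
    (hsum : ∀ θ φ : ℝ, Complex.exp (θ * Complex.I) ∈ spectrum ℂ (NormedSpace.exp t) →
      Complex.exp (φ * Complex.I) ∈ spectrum ℂ (NormedSpace.exp t) →
      ∑' m : ℤ, (-1 : ℂ) ^ m * a m * Complex.exp (m * (θ - φ) * Complex.I) =
        1 / (1 + Complex.exp ((θ - φ) * Complex.I))) (M : CMat n) :
    N M ≤ (∑' m : ℤ, ‖a m‖) * N (NormedSpace.exp t * M + M * NormedSpace.exp t) := by
  obtain ⟨U, hU, d, hd, hdn⟩ := exists_diagonalization_of_skew ht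
  have hW := exp_skew_eq hU hd
  have hs : ∀ i, Complex.exp (d i * Complex.I) ∈ spectrum ℂ (NormedSpace.exp t) := by
    intro i
    obtain ⟨u, hu⟩ := unitary_isUnit hU
    rw [hW, ← unitary_inv hU, ← hu, ← Matrix.coe_units_inv, spectrum.units_conjugate,
      spectrum_diagonal]
    exact ⟨i, rfl⟩
  exact hN.anticommutator_le hU
    (fun i j => one_add_exp_sub_ne_zero ((hdn i).trans_lt hn) ((hdn j).trans_lt hn)) ha
    (fun i j => hsum _ _ (hs i) (hs j)) hW M

/-! ### The parametrization by logarithmic coordinates -/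

/-- The real skew symmetric part. -/
def projL : CMat n →L[ℝ] CMat n :=
  (4⁻¹ : ℝ) • (ContinuousLinearMap.id ℝ _ + conjCLM - transposeCLM - conjCLM.comp transposeCLM)

/-- The imaginary symmetric part. -/
def projT : CMat n →L[ℝ] CMat n :=
  (4⁻¹ : ℝ) • (ContinuousLinearMap.id ℝ _ - conjCLM + transposeCLM - conjCLM.comp transposeCLM)

/-- The imaginary skew symmetric part. -/
def projK : CMat n →L[ℝ] CMat n :=
  (4⁻¹ : ℝ) • (ContinuousLinearMap.id ℝ _ - conjCLM - transposeCLM + conjCLM.comp transposeCLM)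

/-- The real symmetric part. -/
def projS : CMat n →L[ℝ] CMat n :=
  (4⁻¹ : ℝ) • (ContinuousLinearMap.id ℝ _ + conjCLM + transposeCLM + conjCLM.comp transposeCLM)

lemma projL_apply (m : CMat n) : projL m = (4⁻¹ : ℝ) • (m + conj m - mᵀ - conj mᵀ) := rfl
lemma projT_apply (m : CMat n) : projT m = (4⁻¹ : ℝ) • (m - conj m + mᵀ - conj mᵀ) := rfl
lemma projK_apply (m : CMat n) : projK m = (4⁻¹ : ℝ) • (m - conj m - mᵀ + conj mᵀ) := rfl
lemma projS_apply (m : CMat n) : projS m = (4⁻¹ : ℝ) • (m + conj m + mᵀ + conj mᵀ) := rfl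

lemma conj_real_smul (r : ℝ) (A : CMat n) : conj (r • A) = r • conj A := conjCLM.map_smul r A

lemma projL_add_projT_add_projK_add_projS (m : CMat n) :
    projL m + projT m + projK m + projS m = m := by
  rw [projL_apply, projT_apply, projK_apply, projS_apply]
  module

lemma isBipolarCoord_proj (m : CMat n) :
    IsBipolarCoord (projL m) (projT m) (projK m) (projS m) := by
  rw [projL_apply, projT_apply, projK_apply, projS_apply]
  have h : ∀ A : CMat n, (conj A)ᵀ = conj Aᵀ := fun A => rfl
  constructor <;>
  simp only [conj_real_smul, conj_add, conj_sub, conj_conj, Matrix.transpose_smul,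
    Matrix.transpose_add, Matrix.transpose_sub, Matrix.transpose_transpose, h] <;> module

lemma IsBipolarCoord.proj_sum {l t k s : CMat n} (b : IsBipolarCoord l t k s) :
    projL (l + t + k + s) = l ∧ projT (l + t + k + s) = t ∧ projK (l + t + k + s) = k ∧
      projS (l + t + k + s) = s := by
  rw [projL_apply, projT_apply, projK_apply, projS_apply]
  simp only [Matrix.transpose_add, conj_add, b.conj_l, b.conj_t, b.conj_k, b.conj_s,
    b.transpose_l, b.transpose_t, b.transpose_k, b.transpose_s, conj_neg]
  refine ⟨?_, ?_, ?_, ?_⟩ <;> module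

/-- The product `B e^l e^t e^k e^s`. -/
def bipolarMap (B m : CMat n) : CMat n :=
  B * NormedSpace.exp (projL m) * NormedSpace.exp (projT m) * NormedSpace.exp (projK m) *
    NormedSpace.exp (projS m)

lemma contDiff_bipolarMap (B : CMat n) (r : WithTop ℕ∞) : ContDiff ℝ r (bipolarMap B) := by
  have h : ∀ p : CMat n →L[ℝ] CMat n, ContDiff ℝ r fun m => NormedSpace.exp (p m) :=
    fun p => (contDiff_exp r).comp p.contDiff
  exact (((contDiff_const.mul (h projL)).mul (h projT)).mul (h projK)).mul (h projS)

lemma fderiv_bipolarMap (B m h : CMat n) :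
    fderiv ℝ (bipolarMap B) m h =
      mostowDeriv (B * NormedSpace.exp (projL m) * NormedSpace.exp (projT m))
        (NormedSpace.exp (projK m)) (NormedSpace.exp (projS m))
        (logDerivProd (projL m) (projT m) (projL h) (projT h))
        (dexp (projK m) (projK h)) (dexp (projS m) (projS h)) := by
  have hd : ∀ p : CMat n →L[ℝ] CMat n, HasFDerivAt (fun m => NormedSpace.exp (p m))
      ((dexp (p m)).comp p) m := fun p => (hasFDerivAt_exp (p m)).comp m p.hasFDerivAt
  have h1 := ((((hasFDerivAt_const B m).mul' (hd projL)).mul' (hd projT)).mul' (hd projK)).mul'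
    (hd projS)
  have h2 : fderiv ℝ (bipolarMap B) m = _ := h1.fderiv
  rw [h2, mostowDeriv, logDerivProd, logDeriv, logDeriv]
  have e1 : ∀ X : CMat n, NormedSpace.exp (projL m) * (NormedSpace.exp (-projL m) * X) = X :=
    IsMostow.mul_cancel_left (exp_mul_exp_neg _)
  have e2 : ∀ X : CMat n, NormedSpace.exp (projT m) * (NormedSpace.exp (-projT m) * X) = X :=
    IsMostow.mul_cancel_left (exp_mul_exp_neg _)
  simp only [add_apply, smul_apply, smul_eq_mul, Pi.mul_apply,
    MulOpposite.smul_eq_mul_unop, MulOpposite.unop_op, zero_apply, zero_mul,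
    add_zero, ContinuousLinearMap.comp_apply, Matrix.mul_add, Matrix.add_mul, Matrix.mul_assoc, e1,
    e2]
  abel

end

section

/-! ### Local inversion to second order -/

/-- The derivative differs from its value at `y` by `O(‖w - y‖)`; the mean value inequality on the
ball of radius `‖z - y‖` supplies the second factor. -/
lemma taylor_two {E F : Type*} [NormedAddCommGroup E] [NormedSpace ℝ E] [NormedAddCommGroup F]
    [NormedSpace ℝ F] {f : E → F} {y : E} (hf : ContDiffAt ℝ 2 f y) :
    ∃ C : ℝ, ∀ᶠ z in nhds y, ‖f z - f y - fderiv ℝ f y (z - y)‖ ≤ C * ‖z - y‖ ^ 2 := by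
  have h1 : DifferentiableAt ℝ (fderiv ℝ f) y :=
    (hf.fderiv_right (m := 1) (by norm_num)).differentiableAt one_ne_zero
  obtain ⟨C, hC⟩ := h1.isBigO_sub.bound
  have h2 : ∀ᶠ z in nhds y, DifferentiableAt ℝ f z :=
    (hf.eventually (by simp)).mono fun z hz => hz.differentiableAt two_ne_zero
  obtain ⟨r, hr, hball⟩ := Metric.eventually_nhds_iff_ball.1 (hC.and h2)
  refine ⟨|C|, Metric.eventually_nhds_iff_ball.2 ⟨r, hr, fun z hz => ?_⟩⟩
  have hsub : Metric.closedBall y ‖z - y‖ ⊆ Metric.ball y r :=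
    Metric.closedBall_subset_ball (by rwa [← dist_eq_norm])
  have h3 := (convex_closedBall y ‖z - y‖).norm_image_sub_le_of_norm_hasFDerivWithin_le'
    (f := f) (f' := fderiv ℝ f) (φ := fderiv ℝ f y) (C := |C| * ‖z - y‖) (x := y) (y := z)
    (fun w hw => (hball w (hsub hw)).2.hasFDerivAt.hasFDerivWithinAt)
    (fun w hw => by
      refine (hball w (hsub hw)).1.trans ?_
      refine mul_le_mul (le_abs_self C) ?_ (norm_nonneg _) (abs_nonneg _)
      rwa [← dist_eq_norm])
    (Metric.mem_closedBall_self (norm_nonneg _)) (by simp [dist_eq_norm])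
  rwa [mul_assoc, ← pow_two] at h3

/-- An injective endomorphism in finite dimension is invertible, so the inverse function theorem
applies. The vector `h` is the first order displacement, to which the linear bounds are applied. -/
lemma exists_local_inverse {E : Type*} [NormedAddCommGroup E] [NormedSpace ℝ E]
    [FiniteDimensional ℝ E] {Φ : E → E} (hΦ : ContDiff ℝ 2 Φ) (x : E)
    (hinj : ∀ h, fderiv ℝ Φ x h = 0 → h = 0) :
    ∃ ψ : E → E, ∃ C : ℝ, Filter.Tendsto ψ (nhds (Φ x)) (nhds x) ∧
      ∀ᶠ z in nhds (Φ x), Φ (ψ z) = z ∧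
        ∃ h, fderiv ℝ Φ x h = z - Φ x ∧ ‖ψ z - x - h‖ ≤ C * ‖z - Φ x‖ ^ 2 := by
  have : CompleteSpace E := FiniteDimensional.complete ℝ E
  have hinj' : Function.Injective (fderiv ℝ Φ x : E →ₗ[ℝ] E) :=
    (injective_iff_map_eq_zero _).2 hinj
  let e : E ≃L[ℝ] E := (LinearEquiv.ofInjectiveEndo _ hinj').toContinuousLinearEquiv
  have he : (e : E →L[ℝ] E) = fderiv ℝ Φ x := by
    ext h
    rfl
  have hd : HasFDerivAt Φ (e : E →L[ℝ] E) x := by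
    rw [he]
    exact (hΦ.differentiable two_ne_zero x).hasFDerivAt
  have hs := hΦ.contDiffAt (x := x)
  have hψ := hs.to_localInverse hd two_ne_zero
  have hst := hs.hasStrictFDerivAt' hd two_ne_zero
  obtain ⟨C, hC⟩ := taylor_two hψ
  have hψx : hs.localInverse hd two_ne_zero (Φ x) = x := hst.localInverse_apply_image
  have hψd : fderiv ℝ (hs.localInverse hd two_ne_zero) (Φ x) = (e.symm : E →L[ℝ] E) :=
    hst.to_localInverse.hasFDerivAt.fderiv
  refine ⟨hs.localInverse hd two_ne_zero, C, ?_, ?_⟩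
  · have := hψ.continuousAt.tendsto
    rwa [hψx] at this
  · filter_upwards [hC, hst.eventually_right_inverse] with z hz hz'
    refine ⟨hz', e.symm (z - Φ x), ?_, ?_⟩
    · rw [← he]
      exact e.apply_symm_apply _
    · rwa [hψx, hψd] at hz

/-- A parametrization of the factors with injective derivative turns a bound for the derivative
into a first order perturbation bound. -/
lemma firstOrderBound_of_fderiv {N : Seminorm ℂ (CMat n)} (hN : IsUnitarilyInvariantNorm N)
    {R : CMat n → RMat n → Prop} {Φ : CMat n → CMat n} (hΦ : ContDiff ℝ 2 Φ) {x : CMat n}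
    (hinj : ∀ h, fderiv ℝ Φ x h = 0 → h = 0) (p : CMat n →L[ℝ] CMat n) {F : RMat n}
    (hF : toC F = p x) (hR : ∀ᶠ m in nhds x, ∃ F', R (Φ m) F' ∧ toC F' = p m)
    (huniq : ∀ {Z' F' F''}, R Z' F' → R Z' F'' → F' = F'') {c : ℝ}
    (hc : ∀ h, N (p h) ≤ c * N (fderiv ℝ Φ x h)) : FirstOrderBound N R (Φ x) F c := by
  obtain ⟨ψ, C, hψ, hev⟩ := exists_local_inverse hΦ x hinj
  obtain ⟨C₁, hC₁, h1⟩ := exists_norm_le_mul hN.definite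
  obtain ⟨C₂, hC₂, h2⟩ := exists_le_mul_norm N
  obtain ⟨r, hr, hball⟩ := Metric.eventually_nhds_iff_ball.1 (hev.and (hψ.eventually hR))
  -- `C₁` converts `N` to the operator norm, which shrinks the radius and enters the remainder
  -- squared; `C₂` converts back.
  refine ⟨r / C₁, by positivity, C₂ * (‖p‖ * (|C| * C₁ ^ 2)), fun Z' hZ' => ?_⟩
  have hn : ‖Z' - Φ x‖ ≤ C₁ * N (Z' - Φ x) := h1 _
  have hmem : Z' ∈ Metric.ball (Φ x) r := by
    rw [mem_ball_iff_norm]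
    rw [lt_div_iff₀ hC₁] at hZ'
    linarith
  obtain ⟨⟨hinv, h, hh, hest⟩, F', hF', hF'p⟩ := hball Z' hmem
  rw [hinv] at hF'
  refine ⟨⟨F', hF'⟩, fun F'' hF'' => ?_⟩
  rw [← huniq hF' hF'', hF'p, hF, ← map_sub]
  have hsplit : p (ψ Z' - x) = p h + p (ψ Z' - x - h) := by
    rw [← map_add]
    congr 1
    abel
  rw [hsplit]
  refine (map_add_le_add N _ _).trans (add_le_add ?_ ?_)
  · rw [← hh]
    exact hc h
  · have hN0 := apply_nonneg N (Z' - Φ x)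
    calc N (p (ψ Z' - x - h)) ≤ C₂ * ‖p (ψ Z' - x - h)‖ := h2 _
      _ ≤ C₂ * (‖p‖ * (|C| * (C₁ * N (Z' - Φ x)) ^ 2)) := by
          refine mul_le_mul_of_nonneg_left ((p.le_opNorm _).trans
            (mul_le_mul_of_nonneg_left (hest.trans ?_) (norm_nonneg _))) hC₂.le
          exact mul_le_mul (le_abs_self C) (pow_le_pow_left₀ (norm_nonneg _) hn 2) (by positivity)
            (abs_nonneg _)
      _ = _ := by ring

/-! ### Bounds for the derivative of the parametrization -/

variable {N : Seminorm ℂ (CMat n)} {B m h : CMat n}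

/-- Dimension zero is treated separately, because `1 ≤ ‖Q‖` and `1 ≤ cond Z` fail there. -/
lemma apply_eq_zero_of_eq_zero (hn : n = 0) (A : CMat n) : N A = 0 := by
  subst hn
  rw [Subsingleton.elim A 0, map_zero]

lemma le_logDerivProd (hN : IsUnitarilyInvariantNorm N)
    (hB : B ∈ Matrix.unitaryGroup (Fin n) ℂ) :
    N (logDerivProd (projL m) (projT m) (projL h) (projT h)) ≤
      ‖NormedSpace.exp (projK m)‖ * ‖(NormedSpace.exp (projS m))⁻¹‖ / 2 *
        (1 + ‖NormedSpace.exp (projK m)‖ * kappa (bipolarMap B m)) *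
          N (fderiv ℝ (bipolarMap B) m h) := by
  rcases eq_zero_or_neZero n with hn | hn
  · rw [apply_eq_zero_of_eq_zero hn, apply_eq_zero_of_eq_zero hn, mul_zero]
  · rw [fderiv_bipolarMap, bipolarMap, ((isBipolarCoord_proj m).isMostow hB).kappa_eq]
    exact ((isBipolarCoord_proj m).isMostow hB).le_mul_deriv_unitary hN
      ((isBipolarCoord_proj m).isMostowTangent (isBipolarCoord_proj h))

lemma le_dexp_projK (hN : IsUnitarilyInvariantNorm N) (hB : B ∈ Matrix.unitaryGroup (Fin n) ℂ) :
    N (dexp (projK m) (projK h)) ≤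
      ‖NormedSpace.exp (projK m)‖ * ‖NormedSpace.exp (projK m)‖ *
        ‖(NormedSpace.exp (projS m))⁻¹‖ / 2 *
        (1 + ‖NormedSpace.exp (projK m)‖ * kappa (bipolarMap B m)) *
          N (fderiv ℝ (bipolarMap B) m h) := by
  rcases eq_zero_or_neZero n with hn | hn
  · rw [apply_eq_zero_of_eq_zero hn, apply_eq_zero_of_eq_zero hn, mul_zero]
  · rw [fderiv_bipolarMap, bipolarMap, ((isBipolarCoord_proj m).isMostow hB).kappa_eq]
    exact ((isBipolarCoord_proj m).isMostow hB).le_mul_deriv_posQ hN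
      ((isBipolarCoord_proj m).isMostowTangent (isBipolarCoord_proj h))

lemma le_dexp_projS (hN : IsUnitarilyInvariantNorm N) (hB : B ∈ Matrix.unitaryGroup (Fin n) ℂ) :
    N (dexp (projS m) (projS h)) ≤
      kappa (bipolarMap B m) * N (fderiv ℝ (bipolarMap B) m h) := by
  rcases eq_zero_or_neZero n with hn | hn
  · rw [apply_eq_zero_of_eq_zero hn, apply_eq_zero_of_eq_zero hn, mul_zero]
  · have hM := (isBipolarCoord_proj m).isMostow hB
    rw [fderiv_bipolarMap, bipolarMap, hM.kappa_eq]
    exact (hM.le_sharpConst_mul hN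
      ((isBipolarCoord_proj m).isMostowTangent (isBipolarCoord_proj h))).trans
      (mul_le_mul_of_nonneg_right hM.sharpConst_le_bigConst (apply_nonneg N _))

/-- The linear bounds in the operator norm force every component to vanish. For the anticommutators
no sequence is required: `‖t‖ < π/2` alone keeps the sums of eigenvalues of `e^t` away from zero. -/
lemma fderiv_bipolarMap_injective (hB : B ∈ Matrix.unitaryGroup (Fin n) ℂ)
    (hL : ‖projL m‖ < Real.pi) (hT : ‖projT m‖ < Real.pi / 2)
    (hh : fderiv ℝ (bipolarMap B) m h = 0) : h = 0 := by
  have hN := isUnitarilyInvariantNorm_normSeminorm (n := n)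
  have b := isBipolarCoord_proj m
  have b' := isBipolarCoord_proj h
  have key : ∀ {A : CMat n} {c : ℝ}, normSeminorm ℂ (CMat n) A ≤
      c * normSeminorm ℂ (CMat n) (fderiv ℝ (bipolarMap B) m h) → A = 0 := by
    intro A c hA
    rw [hh, map_zero, mul_zero] at hA
    exact hN.definite A (le_antisymm hA (apply_nonneg _ _))
  have key0 : ∀ {A D : CMat n} {c : ℝ}, normSeminorm ℂ (CMat n) A ≤
      c * normSeminorm ℂ (CMat n) D → D = 0 → A = 0 := by
    intro A D c hA hD
    rw [hD, map_zero, mul_zero] at hA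
    exact hN.definite A (le_antisymm hA (apply_nonneg _ _))
  have hΩ := key (le_logDerivProd hN hB)
  have hK : projK h = 0 :=
    key0 (hN.le_norm_exp_neg_mul_dexp b.conjTranspose_k _) (key (le_dexp_projK hN hB))
  have hS : projS h = 0 :=
    key0 (hN.le_norm_exp_neg_mul_dexp b.conjTranspose_s _) (key (le_dexp_projS hN hB))
  have hT' : projT h = 0 := by
    refine key0 (hN.le_logConst_mul_dexp b.conjTranspose_t (hT.trans (by linarith [Real.pi_pos])) _)
      (eq_zero_of_anticommute_exp b.conjTranspose_t hT ?_)
    exact key0 (b.apply_anticommutator_dexp_le b' hN) hΩ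
  have hω : logDeriv (projL m) (projL h) = 0 :=
    eq_zero_of_anticommute_exp b.conjTranspose_t hT
      (key0 (b.apply_anticommutator_logDeriv_le b' hN) hΩ)
  have hL' : projL h = 0 := by
    refine key0 (hN.le_logConst_mul_dexp b.conjTranspose_l hL _) (hN.definite _ ?_)
    rw [← hN.apply_logDeriv b.conjTranspose_l, hω, map_zero]
  rw [← projL_add_projT_add_projK_add_projS h, hL', hT', hK, hS]
  simp

lemma logConst_nonneg (W : CMat n) : 0 ≤ logConst W :=
  intervalIntegral.integral_nonneg zero_le_one fun _ _ => sq_nonneg _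

lemma toC_imPart_eq {A : CMat n} (h : conj A = -A) : toC (imPart A) = -Complex.I • A := by
  conv_rhs => rw [← toC_imPart h]
  rw [smul_smul]
  simp

lemma transpose_of_toC {A : RMat n} {C : CMat n} (hA : toC A = C) (hC : Cᵀ = C) : Aᵀ = A :=
  toC_injective (by rw [toC_transpose, hA, hC])

lemma transpose_of_toC_neg {A : RMat n} {C : CMat n} (hA : toC A = C) (hC : Cᵀ = -C) :
    Aᵀ = -A :=
  toC_injective (by rw [toC_transpose, toC_neg, hA, hC])

lemma exp_mem_orthogonalGroup {L : RMat n} (hL : Lᵀ = -L) :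
    NormedSpace.exp L ∈ Matrix.orthogonalGroup (Fin n) ℝ := by
  rw [mem_orthogonalGroup_iff, toC_exp]
  exact exp_mem_unitary (conjTranspose_toC_of_skew hL)

lemma transpose_rePart_projL (m : CMat n) : (rePart (projL m))ᵀ = -rePart (projL m) :=
  transpose_of_toC_neg (toC_rePart (isBipolarCoord_proj m).conj_l)
    (isBipolarCoord_proj m).transpose_l

lemma isBipolar_bipolarMap {W : RMat n} (hW : W ∈ Matrix.orthogonalGroup (Fin n) ℝ)
    (hT : ‖projT m‖ < Real.pi / 2) :
    IsBipolar (bipolarMap (toC W) m) (W * NormedSpace.exp (rePart (projL m))) (imPart (projT m))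
      (imPart (projK m)) (rePart (projS m)) := by
  have b := isBipolarCoord_proj m
  have ht := toC_imPart_eq b.conj_t
  have htt : (imPart (projT m))ᵀ = imPart (projT m) :=
    transpose_of_toC ht (by rw [Matrix.transpose_smul, b.transpose_t])
  refine ⟨mul_mem hW (exp_mem_orthogonalGroup (transpose_rePart_projL m)), htt, ?_,
    transpose_of_toC_neg (toC_imPart_eq b.conj_k)
      (by rw [Matrix.transpose_smul, b.transpose_k, smul_neg]),
    transpose_of_toC (toC_rePart b.conj_s) b.transpose_s, ?_⟩
  · rw [← norm_toC_lt_iff htt (by positivity), ht, norm_smul]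
    simpa using hT
  · rw [expI, expI, toC_imPart b.conj_t, toC_imPart b.conj_k, toC_rePart b.conj_s, toC_mul,
      toC_exp, toC_rePart b.conj_l, bipolarMap]

lemma eventually_norm_proj_lt (p : CMat n →L[ℝ] CMat n) {r : ℝ} (hr : ‖p m‖ < r) :
    ∀ᶠ m' in nhds m, ‖p m'‖ < r :=
  (p.continuous.norm.tendsto m).eventually_lt_const hr

lemma isPrincipalLog_exp {L : RMat n} (hL : Lᵀ = -L) (hn : ‖toC L‖ < Real.pi) :
    IsPrincipalLog L (NormedSpace.exp L) :=
  ⟨hL, (norm_toC_lt_iff_of_skew hL Real.pi_pos).1 hn, rfl⟩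

/-! ### The perturbation bounds -/

variable {Z : CMat n} {W₁ T K S W L : RMat n}

/-- Coordinates of a bipolar decomposition relative to a base point `W` of the orthogonal group. -/
structure IsBipolarBase (Z : CMat n) (W L T K S : RMat n) (m : CMat n) : Prop where
  orthogonal : W ∈ Matrix.orthogonalGroup (Fin n) ℝ
  l_eq : projL m = toC L
  t_eq : projT m = Complex.I • toC T
  k_eq : projK m = Complex.I • toC K
  s_eq : projS m = toC S
  map_eq : bipolarMap (toC W) m = Z
  norm_l_lt : ‖projL m‖ < Real.pi
  norm_t_lt : ‖projT m‖ < Real.pi / 2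

lemma IsBipolar.exists_base (hb : IsBipolar Z W₁ T K S)
    (hW : W ∈ Matrix.orthogonalGroup (Fin n) ℝ) (hL : Lᵀ = -L) (hn : ‖toC L‖ < Real.pi)
    (he : W * NormedSpace.exp L = W₁) : ∃ m, IsBipolarBase Z W L T K S m := by
  obtain ⟨h1, h2, h3, h4⟩ :=
    (IsBipolarCoord.of_real hL hb.symm_T hb.skew_K hb.symm_S).proj_sum
  refine ⟨_, hW, h1, h2, h3, h4, ?_, by rwa [h1], ?_⟩
  · rw [bipolarMap, h1, h2, h3, h4, hb.eq, ← he, toC_mul, toC_exp]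
    rfl
  · rw [h2, norm_smul]
    simpa using hb.norm_T_lt

/-- Taking `W₁` as base point with `l = 0` avoids a logarithm of `W₁`, so the bounds for `T`, `K`
and `S` need no condition on its spectrum. -/
lemma IsBipolar.exists_base_self (hb : IsBipolar Z W₁ T K S) :
    ∃ m, IsBipolarBase Z W₁ 0 T K S m :=
  hb.exists_base hb.orthogonal (by simp) (by rw [toC_zero, norm_zero]; exact Real.pi_pos)
    (by rw [NormedSpace.exp_zero, Matrix.mul_one])

namespace IsBipolarBase

lemma unitary (hm : IsBipolarBase Z W L T K S m) : toC W ∈ Matrix.unitaryGroup (Fin n) ℂ :=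
  mem_orthogonalGroup_iff.1 hm.orthogonal

lemma fderiv_injective (hm : IsBipolarBase Z W L T K S m) (h : CMat n)
    (hh : fderiv ℝ (bipolarMap (toC W)) m h = 0) : h = 0 :=
  fderiv_bipolarMap_injective hm.unitary hm.norm_l_lt hm.norm_t_lt hh

lemma le_unitaryConst (hm : IsBipolarBase Z W L T K S m) (hN : IsUnitarilyInvariantNorm N)
    (h : CMat n) :
    N (logDerivProd (projL m) (projT m) (projL h) (projT h)) ≤
      unitaryConst Z K S * N (fderiv ℝ (bipolarMap (toC W)) m h) := by
  have hQ : ‖expI (-K)‖ = ‖expI K‖ := by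
    rw [← conj_expI, norm_conj]
  have h1 := le_logDerivProd (m := m) (h := h) hN hm.unitary
  rw [hm.map_eq, hm.k_eq, hm.s_eq, ← Matrix.exp_neg] at h1
  change _ ≤ ‖expI (-K)‖ * ‖NormedSpace.exp (-toC S)‖ / 2 * (1 + ‖expI K‖ * kappa Z) * _
  rw [hQ]
  exact h1

lemma bound_l (hm : IsBipolarBase Z W L T K S m) (hN : IsUnitarilyInvariantNorm N) {a : ℤ → ℂ}
    (ha : Summable fun m => ‖a m‖)
    (hsum : ∀ θ φ : ℝ, Complex.exp (θ * Complex.I) ∈ spectrum ℂ (expI T) →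
      Complex.exp (φ * Complex.I) ∈ spectrum ℂ (expI T) →
      ∑' m : ℤ, (-1 : ℂ) ^ m * a m * Complex.exp (m * (θ - φ) * Complex.I) =
        1 / (1 + Complex.exp ((θ - φ) * Complex.I))) (h : CMat n) :
    N (projL h) ≤ 2 * logConst (toC (NormedSpace.exp L)) * (∑' m : ℤ, ‖a m‖) *
      unitaryConst Z K S * N (fderiv ℝ (bipolarMap (toC W)) m h) := by
  have b := isBipolarCoord_proj m
  have b' := isBipolarCoord_proj h
  have hA : 0 ≤ ∑' m : ℤ, ‖a m‖ := tsum_nonneg fun _ => norm_nonneg _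
  have h1 := hN.le_logConst_mul_dexp b.conjTranspose_l hm.norm_l_lt (projL h)
  rw [← hN.apply_logDeriv b.conjTranspose_l] at h1
  have h2 := hN.le_anticommutator_exp b.conjTranspose_t hm.norm_t_lt ha
    (by rw [hm.t_eq]; exact hsum) (logDeriv (projL m) (projL h))
  have h3 := b.apply_anticommutator_logDeriv_le b' hN
  have h4 := hm.le_unitaryConst hN h
  rw [toC_exp, ← hm.l_eq]
  calc N (projL h) ≤ logConst (NormedSpace.exp (projL m)) * ((∑' m : ℤ, ‖a m‖) * (2 *
        (unitaryConst Z K S * N (fderiv ℝ (bipolarMap (toC W)) m h)))) := by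
        refine h1.trans (mul_le_mul_of_nonneg_left (h2.trans
          (mul_le_mul_of_nonneg_left (h3.trans ?_) hA)) (logConst_nonneg _))
        linarith
    _ = _ := by ring

lemma bound_t (hm : IsBipolarBase Z W L T K S m) (hN : IsUnitarilyInvariantNorm N) {a : ℤ → ℂ}
    (ha : Summable fun m => ‖a m‖)
    (hsum : ∀ θ φ : ℝ, Complex.exp (θ * Complex.I) ∈ spectrum ℂ (expI T) →
      Complex.exp (φ * Complex.I) ∈ spectrum ℂ (expI T) →
      ∑' m : ℤ, (-1 : ℂ) ^ m * a m * Complex.exp (m * (θ - φ) * Complex.I) =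
        1 / (1 + Complex.exp ((θ - φ) * Complex.I))) (h : CMat n) :
    N (projT h) ≤ 2 * logConst (expI T) * (∑' m : ℤ, ‖a m‖) *
      unitaryConst Z K S * N (fderiv ℝ (bipolarMap (toC W)) m h) := by
  have b := isBipolarCoord_proj m
  have b' := isBipolarCoord_proj h
  have hA : 0 ≤ ∑' m : ℤ, ‖a m‖ := tsum_nonneg fun _ => norm_nonneg _
  have h1 := hN.le_logConst_mul_dexp b.conjTranspose_t
    (hm.norm_t_lt.trans (by linarith [Real.pi_pos])) (projT h)
  have h2 := hN.le_anticommutator_exp b.conjTranspose_t hm.norm_t_lt ha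
    (by rw [hm.t_eq]; exact hsum) (dexp (projT m) (projT h))
  have h3 := b.apply_anticommutator_dexp_le b' hN
  have h4 := hm.le_unitaryConst hN h
  rw [expI, ← hm.t_eq]
  calc N (projT h) ≤ logConst (NormedSpace.exp (projT m)) * ((∑' m : ℤ, ‖a m‖) * (2 *
        (unitaryConst Z K S * N (fderiv ℝ (bipolarMap (toC W)) m h)))) := by
        refine h1.trans (mul_le_mul_of_nonneg_left (h2.trans
          (mul_le_mul_of_nonneg_left (h3.trans ?_) hA)) (logConst_nonneg _))
        linarith
    _ = _ := by ring

lemma bound_k (hm : IsBipolarBase Z W L T K S m) (hN : IsUnitarilyInvariantNorm N)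
    (hop : ∀ A, opNorm A ≤ N A) (h : CMat n) :
    N (projK h) ≤ N (expI (-K)) * (cond (expI K) * opNorm (NormedSpace.exp (-toC S)) / 2 *
      (1 + opNorm (expI K) * kappa Z)) * N (fderiv ℝ (bipolarMap (toC W)) m h) := by
  have hQ : ‖(expI K)⁻¹‖ = ‖expI K‖ := by rw [← expI_neg, ← conj_expI, norm_conj]
  have h1 := hN.le_norm_exp_neg_mul_dexp (isBipolarCoord_proj m).conjTranspose_k (projK h)
  have h2 := le_dexp_projK (m := m) (h := h) hN hm.unitary
  rw [hm.map_eq, hm.s_eq, ← Matrix.exp_neg] at h2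
  rw [hm.k_eq] at h1 h2
  rw [← smul_neg, ← toC_neg] at h1
  rw [mul_assoc]
  -- The normalisation enters only here, replacing `‖e^{-iK}‖` by the larger `N (expI (-K))`.
  refine h1.trans (mul_le_mul (hop _) ?_ (apply_nonneg _ _) (apply_nonneg _ _))
  change _ ≤ ‖expI K‖ * ‖(expI K)⁻¹‖ * ‖NormedSpace.exp (-toC S)‖ / 2 *
    (1 + ‖expI K‖ * kappa Z) * _
  rw [hQ]
  exact h2

lemma bound_s (hm : IsBipolarBase Z W L T K S m) (hN : IsUnitarilyInvariantNorm N)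
    (hop : ∀ A, opNorm A ≤ N A) (h : CMat n) :
    N (projS h) ≤ N (NormedSpace.exp (-toC S)) * kappa Z *
      N (fderiv ℝ (bipolarMap (toC W)) m h) := by
  have h1 := hN.le_norm_exp_neg_mul_dexp (isBipolarCoord_proj m).conjTranspose_s (projS h)
  have h2 := le_dexp_projS (m := m) (h := h) hN hm.unitary
  rw [hm.map_eq] at h2
  rw [hm.s_eq] at h1 h2
  rw [mul_assoc]
  exact h1.trans (mul_le_mul (hop _) h2 (apply_nonneg _ _) (apply_nonneg _ _))

lemma eventually_isBipolar (hm : IsBipolarBase Z W L T K S m) :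
    ∀ᶠ m' in nhds m, IsBipolar (bipolarMap (toC W) m') (W * NormedSpace.exp (rePart (projL m')))
      (imPart (projT m')) (imPart (projK m')) (rePart (projS m')) :=
  (eventually_norm_proj_lt projT hm.norm_t_lt).mono fun _ h =>
    isBipolar_bipolarMap hm.orthogonal h

end IsBipolarBase

lemma toC_eq_neg_I_smul {A : RMat n} {C : CMat n} (h : C = Complex.I • toC A) :
    toC A = (-Complex.I) • C := by
  rw [h, smul_smul]
  simp

lemma apply_neg_I_smul (N : Seminorm ℂ (CMat n)) (A : CMat n) : N ((-Complex.I) • A) = N A := by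
  rw [map_smul_eq_mul]
  simp

end

end Bipolar

end

end

/-! ### Assembly of the perturbation theorem -/

theorem theorem5p1 {n : ℕ} (N : Seminorm ℂ (Matrix (Fin n) (Fin n) ℂ))
    (hN : Bipolar.IsUnitarilyInvariantNorm N)
    (Z : Matrix (Fin n) (Fin n) ℂ) (hZ : IsUnit Z)
    (hσ : (-1 : ℂ) ∉ spectrum ℂ
      (Zᵀ * Z * Bipolar.geomMean (Zᴴ * Z)⁻¹ (Bipolar.conj (Zᴴ * Z))⁻¹)) :
    (∃ W₁ T K S : Matrix (Fin n) (Fin n) ℝ, Bipolar.IsBipolar Z W₁ T K S) ∧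
    ∀ W₁ T K S : Matrix (Fin n) (Fin n) ℝ, Bipolar.IsBipolar Z W₁ T K S →
      ((-1 : ℝ) ∉ spectrum ℝ W₁ → ∃ L, Bipolar.IsPrincipalLog L W₁) ∧
      (∀ a : ℤ → ℂ, Summable (fun m => ‖a m‖) →
        (∀ θ φ : ℝ,
          Complex.exp (θ * Complex.I) ∈ spectrum ℂ (Bipolar.expI T) →
          Complex.exp (φ * Complex.I) ∈ spectrum ℂ (Bipolar.expI T) →
          ∑' m : ℤ, (-1 : ℂ) ^ m * a m * Complex.exp (m * (θ - φ) * Complex.I) =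
            1 / (1 + Complex.exp ((θ - φ) * Complex.I))) →
        (∀ L, Bipolar.IsPrincipalLog L W₁ →
          Bipolar.FirstOrderBound N
            (fun Z' L' => ∃ W₁' T' K' S', Bipolar.IsBipolar Z' W₁' T' K' S' ∧
              Bipolar.IsPrincipalLog L' W₁')
            Z L (2 * Bipolar.logConst (Bipolar.toC (NormedSpace.exp L)) * (∑' m : ℤ, ‖a m‖) *
              Bipolar.unitaryConst Z K S)) ∧
        Bipolar.FirstOrderBound N
          (fun Z' T' => ∃ W₁' K' S', Bipolar.IsBipolar Z' W₁' T' K' S')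
          Z T (2 * Bipolar.logConst (Bipolar.expI T) * (∑' m : ℤ, ‖a m‖) *
            Bipolar.unitaryConst Z K S)) ∧
      ((∀ A, Bipolar.opNorm A ≤ N A) →
        Bipolar.FirstOrderBound N
          (fun Z' K' => ∃ W₁' T' S', Bipolar.IsBipolar Z' W₁' T' K' S')
          Z K (N (Bipolar.expI (-K)) *
            (Bipolar.cond (Bipolar.expI K) * Bipolar.opNorm (NormedSpace.exp (-Bipolar.toC S)) / 2 *
              (1 + Bipolar.opNorm (Bipolar.expI K) * Bipolar.kappa Z))) ∧
        Bipolar.FirstOrderBound N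
          (fun Z' S' => ∃ W₁' T' K', Bipolar.IsBipolar Z' W₁' T' K' S')
          Z S (N (NormedSpace.exp (-Bipolar.toC S)) * Bipolar.kappa Z)) := by
  refine ⟨Bipolar.exists_isBipolar hZ hσ, fun W₁ T K S hb => ?_⟩
  obtain ⟨m, hm⟩ := hb.exists_base_self
  have hsm := fun W => Bipolar.contDiff_bipolarMap (Bipolar.toC W : Bipolar.CMat n) 2
  refine ⟨Bipolar.exists_isPrincipalLog hb.orthogonal, fun a ha hsum => ⟨fun L hL => ?_, ?_⟩,
    fun hop => ⟨?_, ?_⟩⟩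
  -- For `L` the base point is the identity, so that the coordinate `l` is the principal logarithm
  -- itself.
  · obtain ⟨m, hm⟩ := hb.exists_base (one_mem _) hL.skew hL.norm_lt
      (by rw [Matrix.one_mul, hL.exp_eq])
    have h := Bipolar.firstOrderBound_of_fderiv hN
      (R := fun Z' L' => ∃ W₁' T' K' S', Bipolar.IsBipolar Z' W₁' T' K' S' ∧
        Bipolar.IsPrincipalLog L' W₁')
      (hsm 1) hm.fderiv_injective Bipolar.projL hm.l_eq.symm ?_ ?_ (hm.bound_l hN ha hsum)
    · rwa [hm.map_eq] at h
    · filter_upwards [hm.eventually_isBipolar,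
        Bipolar.eventually_norm_proj_lt Bipolar.projL hm.norm_l_lt] with m' h1 h2
      rw [Matrix.one_mul] at h1
      have hre := Bipolar.toC_rePart (Bipolar.isBipolarCoord_proj m').conj_l
      exact ⟨_, ⟨_, _, _, _, h1, Bipolar.isPrincipalLog_exp (Bipolar.transpose_rePart_projL m')
        (by rwa [hre])⟩, hre⟩
    · rintro Z' F' F'' ⟨_, _, _, _, h1, h2⟩ ⟨_, _, _, _, h3, h4⟩
      obtain ⟨rfl, -⟩ := h1.unique h3
      exact h2.unique h4
  · have h := Bipolar.firstOrderBound_of_fderiv hN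
      (R := fun Z' T' => ∃ W₁' K' S', Bipolar.IsBipolar Z' W₁' T' K' S')
      -- The coordinate is `iT`; the factor `-i` recovers `T` and leaves `N` unchanged.
      (hsm W₁) hm.fderiv_injective ((-Complex.I) • Bipolar.projT)
      (Bipolar.toC_eq_neg_I_smul hm.t_eq) ?_ ?_
      (fun h => (Bipolar.apply_neg_I_smul N _).trans_le (hm.bound_t hN ha hsum h))
    · rwa [hm.map_eq] at h
    · filter_upwards [hm.eventually_isBipolar] with m' h1
      exact ⟨_, ⟨_, _, _, h1⟩, Bipolar.toC_imPart_eq (Bipolar.isBipolarCoord_proj m').conj_t⟩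
    · rintro Z' F' F'' ⟨_, _, _, h1⟩ ⟨_, _, _, h3⟩
      exact (h1.unique h3).2.1
  · have h := Bipolar.firstOrderBound_of_fderiv hN
      (R := fun Z' K' => ∃ W₁' T' S', Bipolar.IsBipolar Z' W₁' T' K' S')
      (hsm W₁) hm.fderiv_injective ((-Complex.I) • Bipolar.projK)
      (Bipolar.toC_eq_neg_I_smul hm.k_eq) ?_ ?_
      (fun h => (Bipolar.apply_neg_I_smul N _).trans_le (hm.bound_k hN hop h))
    · rwa [hm.map_eq] at h
    · filter_upwards [hm.eventually_isBipolar] with m' h1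
      exact ⟨_, ⟨_, _, _, h1⟩, Bipolar.toC_imPart_eq (Bipolar.isBipolarCoord_proj m').conj_k⟩
    · rintro Z' F' F'' ⟨_, _, _, h1⟩ ⟨_, _, _, h3⟩
      exact (h1.unique h3).2.2.1
  · have h := Bipolar.firstOrderBound_of_fderiv hN
      (R := fun Z' S' => ∃ W₁' T' K', Bipolar.IsBipolar Z' W₁' T' K' S')
      (hsm W₁) hm.fderiv_injective Bipolar.projS hm.s_eq.symm ?_ ?_ (hm.bound_s hN hop)
    · rwa [hm.map_eq] at h
    · filter_upwards [hm.eventually_isBipolar] with m' h1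
      exact ⟨_, ⟨_, _, _, h1⟩, Bipolar.toC_rePart (Bipolar.isBipolarCoord_proj m').conj_s⟩
    · rintro Z' F' F'' ⟨_, _, _, h1⟩ ⟨_, _, _, h3⟩
      exact (h1.unique h3).2.2.2
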